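/- All rings are commutative. Let $R$ be a Cohen--Macaulay (noetherian) local ring with a dualizing module $D$, and let $C$ be a semidualizing $R$-module that is neither dualizing nor free. (An $R$-module $C$ is semidualizing if it is finitely generated, the homothety map $R\to\operatorname{Hom}_R(C,C)$ is an isomorphism, and $\operatorname{Ext}^i_R(C,C)=0$ for all $i\ge 1$; it is dualizing if moreover it has finite injective dimension.) For a module $M$ over a ring $A$ let $A\ltimes M$ denote the trivial extension, that is, $A\oplus M$ with $(a,m)(a',m')=(aa',am'+a'm)$. Put $$Q=(R\ltimes C)\ltimes\operatorname{Hom}_R(R\ltimes C,D),$$ where $\operatorname{Hom}_R(R\ltimes C,D)$ is an $(R\ltimes C)$-module through its first argument; as an $R$-module, $Q\cong R\oplus C\oplus\operatorname{Hom}_R(C,D)\oplus D$. Then $Q$ is a Gorenstein local ring, and there are ideals $I_1,I_2$ of $Q$ such that: 1. There is a ring isomorphism $R\cong Q/(I_1+I_2)$. 2. For $j=1,2$ the ring $Q/I_j$ is Cohen--Macaulay local with a dualizing module $D_j$, and is not Gorenstein. 3. $\widehat{\operatorname{Tor}}{}^Q_i(Q/I_1,Q/I_2)=0=\widehat{\operatorname{Ext}}{}_Q^i(Q/I_1,Q/I_2)$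 and $\widehat{\operatorname{Tor}}{}^Q_i(Q/I_2,Q/I_1)=0=\widehat{\operatorname{Ext}}{}_Q^i(Q/I_2,Q/I_1)$ for all $i\in\mathbb Z$. 4. The $Q$-modules $\operatorname{Hom}_Q(Q/I_1,Q/I_2)$ and $\operatorname{Hom}_Q(Q/I_2,Q/I_1)$ are not cyclic. 5. $\operatorname{Ext}^i_Q(Q/I_1,Q/I_2)=0=\operatorname{Ext}^i_Q(Q/I_2,Q/I_1)$ and $\operatorname{Tor}^Q_i(Q/I_1,Q/I_2)=0=\operatorname{Tor}^Q_i(Q/I_2,Q/I_1)$ for all $i\ge 1$; moreover $I_1\cap I_2=I_1I_2$. 6. For $j=1,2$ the G-dimension $\operatorname{G-dim}_{Q/I_j}(R)$ is finite, where $R$ is a $Q/I_j$-module via $Q/I_j\to Q/(I_1+I_2)\cong R$. 7. There is an $R$-module isomorphism $D_1\otimes_Q D_2\cong D$ (the left side is annihilated by $I_1+I_2$, hence is a module over $Q/(I_1+I_2)\cong R$), and $\operatorname{Tor}^Q_i(D_1,D_2)=0$ for all $i\ge 1$. Here a complex $X$ of finitely generated free modules over a ring $A$ is totally acyclic if $X$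 and $\operatorname{Hom}_A(X,A)$ are exact; a module is totally reflexive if it is isomorphic to $\operatorname{Coker}(X_1\to X_0)$ for such an $X$; the G-dimension of a module is the least length of a finite resolution of it by totally reflexive modules ($\infty$ if there is none). A Tate resolution of a $Q$-module $M$ is a diagram $T\xrightarrow{\alpha}P\to M$ with $P$ a resolution of $M$ by finitely generated free modules, $T$ totally acyclic, and $\alpha_i$ an isomorphism for $i\gg0$; then $\widehat{\operatorname{Tor}}{}^Q_i(M,N)=\mathrm H_i(T\otimes_QN)$ and $\widehat{\operatorname{Ext}}{}_Q^i(M,N)=\mathrm H_{-i}(\operatorname{Hom}_Q(T,N))$, for any Tate resolution of $M$. Part of (3) is that $Q/I_1$ and $Q/I_2$ have Tate resolutions over $Q$. -/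

import Mathlib

open CategoryTheory CategoryTheory.Limits MonoidalCategory

universe u

noncomputable section

/-! ### Cohen-Macaulay and Gorenstein local rings -/

/-- The depth of a local ring: the supremum of the lengths of its regular sequences.
(`IsRegular` includes `(rs) ≠ R`, so over a local ring such a sequence lies in the maximal
ideal.) -/
def localDepth (R : Type u) [CommRing R] : ℕ∞ :=
  ⨆ rs : {rs : List R // RingTheory.Sequence.IsRegular R rs}, (rs.1.length : ℕ∞)

/-- A Cohen-Macaulay (noetherian) local ring: depth equals Krull dimension. -/
structure IsCohenMacaulayLocal (R : Type u) [CommRing R] : Prop where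
  isNoetherianRing : IsNoetherianRing R
  isLocalRing : IsLocalRing R
  depth_eq_dim : ((localDepth R : ℕ∞) : WithBot ℕ∞) = ringKrullDim R

/-- A Gorenstein (noetherian) local ring: finite injective dimension over itself. -/
structure IsGorensteinLocal (R : Type u) [CommRing R] : Prop where
  isNoetherianRing : IsNoetherianRing R
  isLocalRing : IsLocalRing R
  injectiveDimension_ne_top : injectiveDimension (ModuleCat.of R R) ≠ ⊤

/-! ### Semidualizing and dualizing modules -/

/-- A semidualizing module: finitely generated, with bijective homothety map
`R → Hom_R(C, C)` and `Ext^i_R(C, C) = 0` for `i ≥ 1`. -/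
structure IsSemidualizing (R : Type u) [CommRing R] (C : Type u) [AddCommGroup C]
    [Module R C] : Prop where
  finite : Module.Finite R C
  homothety_bijective : Function.Bijective (LinearMap.lsmul R C)
  ext_eq_zero : ∀ i : ℕ, 1 ≤ i →
    Subsingleton (Abelian.Ext (ModuleCat.of R C) (ModuleCat.of R C) i)

/-- A dualizing module: a semidualizing module of finite injective dimension. -/
structure IsDualizing (R : Type u) [CommRing R] (D : Type u) [AddCommGroup D]
    [Module R D] : Prop extends IsSemidualizing R D where
  injectiveDimension_ne_top : injectiveDimension (ModuleCat.of R D) ≠ ⊤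

/-! ### Trivial extensions -/

/-- The underlying type `R ⊕ M` of the trivial extension `R ⋉ M`. -/
def TrivExt (R : Type u) (M : Type u) : Type u := TrivSqZeroExt R M

namespace TrivExt

variable {R M : Type u} [CommRing R] [AddCommGroup M] [Module R M]

/-- Mathlib's ring structure on the trivial square-zero extension, for the right action of `R` on
`M` that equals the left action. -/
instance : CommRing (TrivExt R M) :=
  letI : Module Rᵐᵒᵖ M := Module.compHom M ((RingHom.id R).fromOpposite mul_comm)
  haveI : IsCentralScalar R M := ⟨fun _ _ => rfl⟩
  (inferInstance : CommRing (TrivSqZeroExt R M))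

instance : Algebra R (TrivExt R M) :=
  letI : Module Rᵐᵒᵖ M := Module.compHom M ((RingHom.id R).fromOpposite mul_comm)
  haveI : IsCentralScalar R M := ⟨fun _ _ => rfl⟩
  (inferInstance : Algebra R (TrivSqZeroExt R M))

/-- The element `(r, m)` of `R ⋉ M`. -/
def mk (r : R) (m : M) : TrivExt R M := ((r, m) : R × M)

theorem mk_mul_mk (r s : R) (m n : M) :
    (mk r m * mk s n : TrivExt R M) = mk (r * s) (r • n + s • m) := rfl

theorem one_eq_mk : (1 : TrivExt R M) = mk 1 0 := rfl

theorem mk_add_mk (r s : R) (m n : M) :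
    (mk r m + mk s n : TrivExt R M) = mk (r + s) (m + n) := rfl

theorem algebraMap_eq_mk (r : R) : algebraMap R (TrivExt R M) r = mk r 0 := rfl

end TrivExt

/-- `Hom_R(A, D)` for an `R`-algebra `A`, to be regarded as an `A`-module. -/
def CoindHom (R A D : Type u) [CommRing R] [CommRing A] [Algebra R A] [AddCommGroup D]
    [Module R D] : Type u := A →ₗ[R] D

namespace CoindHom

variable {R A D : Type u} [CommRing R] [CommRing A] [Algebra R A] [AddCommGroup D] [Module R D]

instance : AddCommGroup (CoindHom R A D) := inferInstanceAs (AddCommGroup (A →ₗ[R] D))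

instance : SMul A (CoindHom R A D) :=
  ⟨fun a f => (LinearMap.comp (show A →ₗ[R] D from f) (LinearMap.mulLeft R a) : A →ₗ[R] D)⟩

theorem smul_apply (a : A) (f : CoindHom R A D) (x : A) :
    (show A →ₗ[R] D from a • f) x = (show A →ₗ[R] D from f) (a * x) := rfl

/-- The `A`-module structure on `Hom_R(A, D)`: `(a • f) x = f (a * x)`. -/
instance : Module A (CoindHom R A D) where
  one_smul f := LinearMap.ext fun x => by
    change (show A →ₗ[R] D from f) (1 * x) = (show A →ₗ[R] D from f) x
    rw [one_mul]
  mul_smul a b f := LinearMap.ext fun x => by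
    change (show A →ₗ[R] D from f) (a * b * x) = (show A →ₗ[R] D from f) (b * (a * x))
    rw [mul_comm a b, mul_assoc]
  smul_zero _ := rfl
  smul_add _ _ _ := rfl
  add_smul a b f := LinearMap.ext fun x => by
    change (show A →ₗ[R] D from f) ((a + b) * x) =
      (show A →ₗ[R] D from f) (a * x) + (show A →ₗ[R] D from f) (b * x)
    rw [add_mul, map_add]
  zero_smul f := LinearMap.ext fun x => by
    change (show A →ₗ[R] D from f) (0 * x) = 0
    rw [zero_mul, map_zero]

end CoindHom

/-- The iterated trivial extension `(R ⋉ C) ⋉ Hom_R(R ⋉ C, D)`. As an `R`-module it is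
`R ⊕ C ⊕ Hom_R(C, D) ⊕ D`. -/
abbrev IterTrivExt (R C D : Type u) [CommRing R] [AddCommGroup C] [Module R C] [AddCommGroup D]
    [Module R D] : Type u :=
  TrivExt (TrivExt R C) (CoindHom R (TrivExt R C) D)

/-! ### Totally acyclic complexes and G-dimension -/

section

variable {R : Type u} [CommRing R]

/-- The complex `Hom_R(X, N)`, with `Hom_R(X_i, N)` placed in cohomological degree `i`. -/
def homComplex (X : ChainComplex (ModuleCat.{u} R) ℤ) (N : ModuleCat.{u} R) :
    HomologicalComplex (ModuleCat.{u} R) (ComplexShape.down ℤ).symm :=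
  (((linearYoneda R (ModuleCat.{u} R)).obj N).mapHomologicalComplex _).obj X.op

/-- The complex `X ⊗_R N`. -/
def tensorComplex (X : ChainComplex (ModuleCat.{u} R) ℤ) (N : ModuleCat.{u} R) :
    ChainComplex (ModuleCat.{u} R) ℤ :=
  ((tensorRight N).mapHomologicalComplex _).obj X

/-- A totally acyclic complex: finitely generated free modules, with `X` and `Hom_R(X, R)`
exact. -/
structure IsTotallyAcyclic (X : ChainComplex (ModuleCat.{u} R) ℤ) : Prop where
  finite : ∀ i, Module.Finite R (X.X i)
  free : ∀ i, Module.Free R (X.X i)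
  exact : ∀ i, X.ExactAt i
  exact_dual : ∀ i, (homComplex X (ModuleCat.of R R)).ExactAt i

/-- A totally reflexive module: the cokernel of `∂_1` in a totally acyclic complex. -/
def IsTotallyReflexive (G : ModuleCat.{u} R) : Prop :=
  ∃ X : ChainComplex (ModuleCat.{u} R) ℤ,
    IsTotallyAcyclic X ∧ Nonempty (G ≅ cokernel (X.d 1 0))

/-- There is an exact sequence `0 → G_n → ⋯ → G_0 → M → 0` with every `G_i` totally reflexive. -/
def HasTotallyReflexiveResolution (M : ModuleCat.{u} R) (n : ℕ) : Prop :=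
  ∃ (G : ChainComplex (ModuleCat.{u} R) ℕ)
    (π : G ⟶ (ChainComplex.single₀ (ModuleCat.{u} R)).obj M),
    (∀ i, IsTotallyReflexive (G.X i)) ∧ (∀ i, n < i → IsZero (G.X i)) ∧ QuasiIso π

/-- The G-dimension of a module (`⊤` if there is no finite resolution by totally reflexive
modules). -/
def gdim (M : ModuleCat.{u} R) : ℕ∞ :=
  ⨅ (n : ℕ) (_ : HasTotallyReflexiveResolution M n), (n : ℕ∞)

/-! ### Tate homology and cohomology -/

/-- A Tate resolution `T → P → M`: `P` is a resolution of `M` by finitely generated free modules,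
`T` is totally acyclic and `T_i → P_i` is an isomorphism for `i ≫ 0`. -/
structure TateResolution (M : ModuleCat.{u} R) where
  T : ChainComplex (ModuleCat.{u} R) ℤ
  P : ChainComplex (ModuleCat.{u} R) ℤ
  α : T ⟶ P
  β : P ⟶ (HomologicalComplex.single (ModuleCat.{u} R) (ComplexShape.down ℤ) 0).obj M
  isTotallyAcyclic : IsTotallyAcyclic T
  isIso_α : ∃ n : ℤ, ∀ i, n ≤ i → IsIso (α.f i)
  finite : ∀ i, Module.Finite R (P.X i)
  free : ∀ i, Module.Free R (P.X i)
  isZero_of_neg : ∀ i, i < 0 → IsZero (P.X i)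
  quasiIso_β : QuasiIso β

/-- The Tate homology module of `M` and `N` in degree `i`, computed from a Tate resolution
of `M`. -/
def TateResolution.tor {M : ModuleCat.{u} R} (t : TateResolution M) (N : ModuleCat.{u} R)
    (i : ℤ) : ModuleCat.{u} R :=
  (tensorComplex t.T N).homology i

/-- The Tate cohomology module of `M` and `N` in degree `i`, computed from a Tate resolution
of `M`. -/
def TateResolution.ext {M : ModuleCat.{u} R} (t : TateResolution M) (N : ModuleCat.{u} R)
    (i : ℤ) : ModuleCat.{u} R :=
  (homComplex t.T N).homology i

/-- All Tate homology and cohomology modules of `M` with coefficients in `N` are zero: `M` has a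
Tate resolution, and the modules computed from any Tate resolution of `M` vanish in all degrees. -/
def TateVanishing (M N : ModuleCat.{u} R) : Prop :=
  Nonempty (TateResolution M) ∧
    ∀ (t : TateResolution M) (i : ℤ), IsZero (t.tor N i) ∧ IsZero (t.ext N i)

/-- Vanishing of `Tor_i^R(M, N)` for all `i ≥ 1`. -/
def TorVanishing (M N : ModuleCat.{u} R) : Prop :=
  ∀ i : ℕ, 1 ≤ i → IsZero (((Tor (ModuleCat.{u} R) i).obj M).obj N)

/-- Vanishing of `Ext^i_R(M, N)` for all `i ≥ 1`. -/
def ExtVanishing (M N : ModuleCat.{u} R) : Prop :=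
  ∀ i : ℕ, 1 ≤ i → Subsingleton (Abelian.Ext M N i)

end

end

noncomputable section

open scoped TensorProduct

/-! ### Short exact sequences of modules and vanishing of `Ext` -/

/-- The sequence `0 → K → X → M → 0` is exact. -/
structure IsSES {R : Type*} [CommRing R] {K X M : Type*} [AddCommGroup K] [AddCommGroup X]
    [AddCommGroup M] [Module R K] [Module R X] [Module R M] (f : K →ₗ[R] X) (g : X →ₗ[R] M) :
    Prop where
  inj : Function.Injective f
  exact : Function.Exact f g
  surj : Function.Surjective g

/-- `Ext^i_R(M, N) = 0`. -/
abbrev ExtZero (R : Type u) [CommRing R] (M N : Type u) [AddCommGroup M] [Module R M]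
    [AddCommGroup N] [Module R N] (i : ℕ) : Prop :=
  Subsingleton (Abelian.Ext (ModuleCat.of R M) (ModuleCat.of R N) i)

/-- `Ext^i_R(M, N) = 0` for all `i ≥ 1`. -/
abbrev ExtAcyclic (R : Type u) [CommRing R] (M N : Type u) [AddCommGroup M] [Module R M]
    [AddCommGroup N] [Module R N] : Prop :=
  ∀ i : ℕ, 1 ≤ i → ExtZero R M N i

namespace IsSES

section

variable {R : Type*} [CommRing R] {K X M N : Type*} [AddCommGroup K] [AddCommGroup X]
  [AddCommGroup M] [AddCommGroup N] [Module R K] [Module R X] [Module R M] [Module R N]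

theorem of_ker {g : X →ₗ[R] M} (hg : Function.Surjective g) :
    IsSES (LinearMap.ker g).subtype g where
  inj := Subtype.val_injective
  exact := LinearMap.exact_subtype_ker_map g
  surj := hg

theorem of_range {f : K →ₗ[R] X} (hf : Function.Injective f) :
    IsSES f (LinearMap.range f).mkQ where
  inj := hf
  exact := LinearMap.exact_map_mkQ_range f
  surj := Submodule.mkQ_surjective _

theorem prod (K M : Type*) [AddCommGroup K] [AddCommGroup M] [Module R K] [Module R M] :
    IsSES (LinearMap.inl R K M) (LinearMap.snd R K M) where
  inj := LinearMap.inl_injective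
  exact := Function.Exact.inl_snd
  surj := LinearMap.snd_surjective

variable {f : K →ₗ[R] X} {g : X →ₗ[R] M}

theorem comp_eq_zero (h : IsSES f g) (x : K) : g (f x) = 0 := h.exact.apply_apply_eq_zero x

/-- A linear map that kills the image of `f` factors through `g`. -/
theorem exists_desc (h : IsSES f g) (φ : X →ₗ[R] N) (hφ : ∀ k, φ (f k) = 0) :
    ∃ ψ : M →ₗ[R] N, ∀ x, ψ (g x) = φ x := by
  have hk : LinearMap.ker g ≤ LinearMap.ker φ := fun x hx => by
    obtain ⟨k, rfl⟩ := (h.exact x).1 hx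
    exact hφ k
  refine ⟨(LinearMap.ker g).liftQ φ hk ∘ₗ
    (g.quotKerEquivOfSurjective h.surj).symm.toLinearMap, fun x => ?_⟩
  have : (g.quotKerEquivOfSurjective h.surj).symm (g x) = (LinearMap.ker g).mkQ x := by
    rw [LinearEquiv.symm_apply_eq]; rfl
  simp [this]

/-- A linear map into `X` that is killed by `g` factors through `f`. -/
theorem exists_lift (h : IsSES f g) (φ : N →ₗ[R] X) (hφ : ∀ n, g (φ n) = 0) :
    ∃ ψ : N →ₗ[R] K, ∀ n, f (ψ n) = φ n := by
  have hr : ∀ n, φ n ∈ LinearMap.range f := fun n => (h.exact (φ n)).1 (hφ n)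
  refine ⟨(LinearEquiv.ofInjective f h.inj).symm.toLinearMap ∘ₗ φ.codRestrict _ hr, fun n => ?_⟩
  have := (LinearEquiv.ofInjective f h.inj).apply_symm_apply (φ.codRestrict _ hr n)
  exact congrArg Subtype.val this

end

variable {R : Type u} [CommRing R] {K X M N : Type u} [AddCommGroup K] [AddCommGroup X]
  [AddCommGroup M] [AddCommGroup N] [Module R K] [Module R X] [Module R M] [Module R N]
  {f : K →ₗ[R] X} {g : X →ₗ[R] M}

theorem shortExact (h : IsSES f g) :
    (ShortComplex.mk (ModuleCat.ofHom f) (ModuleCat.ofHom g)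
      (by ext x; exact h.comp_eq_zero x)).ShortExact where
  exact := (ShortComplex.ShortExact.moduleCat_exact_iff_function_exact _).2 h.exact
  mono_f := (ModuleCat.mono_iff_injective _).2 h.inj
  epi_g := (ModuleCat.epi_iff_surjective _).2 h.surj

theorem extend (h : IsSES f g) (h1 : ExtZero R M N 1) (φ : K →ₗ[R] N) :
    ∃ ψ : X →ₗ[R] N, ∀ k, ψ (f k) = φ k := by
  obtain ⟨ψ, hψ⟩ := Abelian.Ext.contravariant_sequence_exact₁ h.shortExact (ModuleCat.of R N)
    (Abelian.Ext.mk₀ (ModuleCat.ofHom φ)) (add_zero 1) (h1.elim _ _)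
  obtain ⟨ψ, rfl⟩ := Abelian.Ext.homEquiv₀.symm.surjective ψ
  have h2 : ModuleCat.ofHom f ≫ ψ = ModuleCat.ofHom φ :=
    Abelian.Ext.homEquiv₀.symm.injective (by simpa using hψ)
  exact ⟨ψ.hom, fun k => congrArg (fun t => t.hom k) h2⟩

theorem extZero_one (h : IsSES f g) (hX : ExtZero R X N 1)
    (he : ∀ φ : K →ₗ[R] N, ∃ ψ : X →ₗ[R] N, ∀ k, ψ (f k) = φ k) : ExtZero R M N 1 := by
  refine subsingleton_of_forall_eq 0 fun x => ?_
  obtain ⟨y, rfl⟩ := Abelian.Ext.contravariant_sequence_exact₃ h.shortExact (ModuleCat.of R N) x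
    (hX.elim _ _) (add_zero 1)
  obtain ⟨φ, rfl⟩ := Abelian.Ext.homEquiv₀.symm.surjective y
  obtain ⟨ψ, hψ⟩ := he φ.hom
  have : φ = ModuleCat.ofHom f ≫ ModuleCat.ofHom ψ := by
    ext k; exact (hψ k).symm
  subst this
  simp only [Abelian.Ext.homEquiv₀_symm_apply]
  rw [← Abelian.Ext.mk₀_comp_mk₀]
  exact h.shortExact.extClass_comp_assoc _

theorem extZero_right (h : IsSES f g) {i : ℕ} (hX : ExtZero R X N (i + 1))
    (hK : ExtZero R K N i) : ExtZero R M N (i + 1) := by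
  refine subsingleton_of_forall_eq 0 fun x => ?_
  obtain ⟨y, rfl⟩ := Abelian.Ext.contravariant_sequence_exact₃ h.shortExact (ModuleCat.of R N) x
    (hX.elim _ _) (add_comm 1 i)
  rw [hK.elim y 0, Abelian.Ext.comp_zero]

theorem extZero_left (h : IsSES f g) {i : ℕ} (hX : ExtZero R X N i)
    (hM : ExtZero R M N (i + 1)) : ExtZero R K N i := by
  refine subsingleton_of_forall_eq 0 fun x => ?_
  obtain ⟨y, rfl⟩ := Abelian.Ext.contravariant_sequence_exact₁ h.shortExact (ModuleCat.of R N) x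
    (add_comm 1 i) (hM.elim _ _)
  rw [hX.elim y 0, Abelian.Ext.comp_zero]

theorem extZero_mid (h : IsSES f g) {i : ℕ} (hK : ExtZero R K N i)
    (hM : ExtZero R M N i) : ExtZero R X N i := by
  refine subsingleton_of_forall_eq 0 fun x => ?_
  obtain ⟨y, rfl⟩ := Abelian.Ext.contravariant_sequence_exact₂ h.shortExact (ModuleCat.of R N) x
    (hK.elim _ _)
  rw [hM.elim y 0, Abelian.Ext.comp_zero]

theorem extAcyclic_left (h : IsSES f g) (hX : ExtAcyclic R X N) (hM : ExtAcyclic R M N) :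
    ExtAcyclic R K N := fun i hi => h.extZero_left (hX i hi) (hM _ (by omega))

theorem extAcyclic_right (h : IsSES f g) (hX : ExtAcyclic R X N) (hK : ExtAcyclic R K N)
    (he : ∀ φ : K →ₗ[R] N, ∃ ψ : X →ₗ[R] N, ∀ k, ψ (f k) = φ k) : ExtAcyclic R M N := by
  rintro (_ | _ | i) hi
  · omega
  · exact h.extZero_one (hX _ hi) he
  · exact h.extZero_right (hX _ hi) (hK _ (by omega))

variable {Y : Type u} [AddCommGroup Y] [Module R Y]

theorem lift (h : IsSES f g) (h1 : ExtZero R Y K 1) (φ : Y →ₗ[R] M) :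
    ∃ ψ : Y →ₗ[R] X, ∀ y, g (ψ y) = φ y := by
  obtain ⟨ψ, hψ⟩ := Abelian.Ext.covariant_sequence_exact₃ (ModuleCat.of R Y) h.shortExact
    (Abelian.Ext.mk₀ (ModuleCat.ofHom φ)) (zero_add 1) (h1.elim _ _)
  obtain ⟨ψ, rfl⟩ := Abelian.Ext.homEquiv₀.symm.surjective ψ
  have h2 : ψ ≫ ModuleCat.ofHom g = ModuleCat.ofHom φ :=
    Abelian.Ext.homEquiv₀.symm.injective (by simpa using hψ)
  exact ⟨ψ.hom, fun k => congrArg (fun t => t.hom k) h2⟩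

theorem extZero_one_of_lift (h : IsSES f g) (hX : ExtZero R Y X 1)
    (he : ∀ φ : Y →ₗ[R] M, ∃ ψ : Y →ₗ[R] X, ∀ y, g (ψ y) = φ y) : ExtZero R Y K 1 := by
  refine subsingleton_of_forall_eq 0 fun x => ?_
  obtain ⟨y, rfl⟩ := Abelian.Ext.covariant_sequence_exact₁ (ModuleCat.of R Y) h.shortExact x
    (hX.elim _ _) (zero_add 1)
  obtain ⟨φ, rfl⟩ := Abelian.Ext.homEquiv₀.symm.surjective y
  obtain ⟨ψ, hψ⟩ := he φ.hom
  have : φ = ModuleCat.ofHom ψ ≫ ModuleCat.ofHom g := by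
    ext k; exact (hψ k).symm
  subst this
  simp only [Abelian.Ext.homEquiv₀_symm_apply]
  rw [← Abelian.Ext.mk₀_comp_mk₀, Abelian.Ext.comp_assoc_of_second_deg_zero,
    h.shortExact.comp_extClass, Abelian.Ext.comp_zero]

theorem extZero_right_cov (h : IsSES f g) {i : ℕ} (hX : ExtZero R Y X i)
    (hK : ExtZero R Y K (i + 1)) : ExtZero R Y M i := by
  refine subsingleton_of_forall_eq 0 fun x => ?_
  obtain ⟨y, rfl⟩ := Abelian.Ext.covariant_sequence_exact₃ (ModuleCat.of R Y) h.shortExact x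
    rfl (hK.elim _ _)
  rw [hX.elim y 0, Abelian.Ext.zero_comp]

theorem extZero_left_cov (h : IsSES f g) {i : ℕ} (hX : ExtZero R Y X (i + 1))
    (hM : ExtZero R Y M i) : ExtZero R Y K (i + 1) := by
  refine subsingleton_of_forall_eq 0 fun x => ?_
  obtain ⟨y, rfl⟩ := Abelian.Ext.covariant_sequence_exact₁ (ModuleCat.of R Y) h.shortExact x
    (hX.elim _ _) rfl
  rw [hM.elim y 0, Abelian.Ext.zero_comp]

end IsSES

section

variable {R : Type u} [CommRing R] {M M' N N' : Type u} [AddCommGroup M]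
  [AddCommGroup M'] [AddCommGroup N] [AddCommGroup N'] [Module R M] [Module R M']
  [Module R N] [Module R N']

theorem ExtZero.of_equiv (e : M ≃ₗ[R] M') {i : ℕ} (h : ExtZero R M N i) : ExtZero R M' N i := by
  refine subsingleton_of_forall_eq 0 fun x => ?_
  have : x = (Abelian.Ext.mk₀ e.symm.toModuleIso.hom).comp
      ((Abelian.Ext.mk₀ e.symm.toModuleIso.inv).comp x (zero_add i)) (zero_add i) := by
    rw [Abelian.Ext.mk₀_comp_mk₀_assoc, Iso.hom_inv_id, Abelian.Ext.mk₀_id_comp]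
  rw [this, h.elim ((Abelian.Ext.mk₀ e.symm.toModuleIso.inv).comp x (zero_add i)) 0,
    Abelian.Ext.comp_zero]

theorem ExtZero.of_equiv_right (e : N ≃ₗ[R] N') {i : ℕ} (h : ExtZero R M N i) :
    ExtZero R M N' i := by
  refine subsingleton_of_forall_eq 0 fun x => ?_
  have : x = (x.comp (Abelian.Ext.mk₀ e.symm.toModuleIso.hom) (add_zero i)).comp
      (Abelian.Ext.mk₀ e.symm.toModuleIso.inv) (add_zero i) := by
    rw [Abelian.Ext.comp_assoc_of_second_deg_zero, Abelian.Ext.mk₀_comp_mk₀, Iso.hom_inv_id,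
      Abelian.Ext.comp_mk₀_id]
  rw [this, h.elim (x.comp (Abelian.Ext.mk₀ e.symm.toModuleIso.hom) (add_zero i)) 0,
    Abelian.Ext.zero_comp]

theorem ExtAcyclic.of_equiv (e : M ≃ₗ[R] M') (h : ExtAcyclic R M N) : ExtAcyclic R M' N :=
  fun i hi => (h i hi).of_equiv e

theorem ExtAcyclic.of_equiv_right (e : N ≃ₗ[R] N') (h : ExtAcyclic R M N) : ExtAcyclic R M N' :=
  fun i hi => (h i hi).of_equiv_right e

theorem extAcyclic_of_projective (M N : Type u) [AddCommGroup M] [AddCommGroup N] [Module R M]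
    [Module R N] [Module.Projective R M] : ExtAcyclic R M N := by
  rintro (_ | i) hi
  · omega
  · have : Projective (ModuleCat.of R M) := (IsProjective.iff_projective M).1 inferInstance
    exact subsingleton_of_forall_eq 0 fun x => x.eq_zero_of_projective

theorem extZero_of_hasInjectiveDimensionLT {n : ℕ}
    (h : HasInjectiveDimensionLT (ModuleCat.of R N) n) {i : ℕ} (hi : n ≤ i) : ExtZero R M N i :=
  HasInjectiveDimensionLT.subsingleton _ n i hi _

theorem exists_free_presentation (R : Type u) [CommRing R] (M : Type u) [AddCommGroup M]
    [Module R M] : ∃ (K : Type u) (_ : AddCommGroup K) (_ : Module R K) (f : K →ₗ[R] (M →₀ R))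
      (g : (M →₀ R) →ₗ[R] M), IsSES f g :=
  ⟨_, _, _, _, _,
    IsSES.of_ker (g := Finsupp.linearCombination R id) (Finsupp.linearCombination_id_surjective R M)⟩

theorem exists_finite_free_presentation (R : Type u) [CommRing R] (M : Type u) [AddCommGroup M]
    [Module R M] [Module.Finite R M] :
    ∃ (n : ℕ) (g : (Fin n → R) →ₗ[R] M), IsSES (LinearMap.ker g).subtype g := by
  obtain ⟨n, g, hg⟩ := Module.Finite.exists_fin' R M
  exact ⟨n, g, IsSES.of_ker hg⟩

theorem ExtZero.prod {i : ℕ} (h : ExtZero R M N i) (h' : ExtZero R M' N i) :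
    ExtZero R (M × M') N i := (IsSES.prod M M').extZero_mid h h'

theorem ExtAcyclic.prod (h : ExtAcyclic R M N) (h' : ExtAcyclic R M' N) :
    ExtAcyclic R (M × M') N := fun i hi => (h i hi).prod (h' i hi)

theorem ExtZero.finsupp (ι : Type u) {i : ℕ} (hi : 1 ≤ i) (h : ExtZero R M N i) :
    ExtZero R (ι →₀ M) N i := by
  induction i generalizing M with
  | zero => omega
  | succ i ih =>
    obtain ⟨K, _, _, f, g, hg⟩ := exists_free_presentation R M
    have hs : IsSES (R := R) (K := ι →₀ K) (X := ι →₀ M →₀ R) (M := ι →₀ M)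
        (Finsupp.mapRange.linearMap (α := ι) f)
        (Finsupp.mapRange.linearMap (α := ι) g) := by
      refine ⟨Finsupp.mapRange_injective _ (by simp) hg.inj, ?_,
        Finsupp.mapRange_surjective _ (by simp) hg.surj⟩
      intro y
      constructor
      · intro hy
        have : ∀ a, g (y a) = 0 := fun a => DFunLike.congr_fun hy a
        choose k hk using fun a => (hg.exact (y a)).1 (this a)
        refine ⟨⟨y.support, k, fun a => ?_⟩, Finsupp.ext hk⟩
        rw [Finsupp.mem_support_iff, ← hk a, ne_eq, map_eq_zero_iff f hg.inj]
      · rintro ⟨x, rfl⟩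
        ext a
        exact hg.comp_eq_zero (x a)
    have hF : ∀ j, 1 ≤ j → ExtZero R (ι →₀ M →₀ R) N j := extAcyclic_of_projective _ _
    rcases Nat.eq_zero_or_pos i with rfl | hi'
    · refine hs.extZero_one (hF 1 le_rfl) fun φ => ?_
      have : ∀ a : ι, ∃ ψ : (M →₀ R) →ₗ[R] N, ∀ k,
          ψ (f k) = φ (Finsupp.single a k) := fun a => hg.extend h (φ ∘ₗ Finsupp.lsingle a)
      choose ψ hψ using this
      refine ⟨Finsupp.lsum R ψ, fun k => ?_⟩
      have : (Finsupp.lsum R ψ) ∘ₗ (Finsupp.mapRange.linearMap (α := ι) f) = φ := by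
        ext a k
        simp [hψ]
      exact LinearMap.congr_fun this k
    · exact hs.extZero_right (hF _ hi) (ih hi'
        (hg.extZero_left (extAcyclic_of_projective _ _ _ hi') h))

theorem ExtAcyclic.finsupp (ι : Type u) (h : ExtAcyclic R M N) : ExtAcyclic R (ι →₀ M) N :=
  fun i hi => (h i hi).finsupp ι hi

theorem ExtAcyclic.fin_fun (n : ℕ) (h : ExtAcyclic R M N) : ExtAcyclic R (Fin n → M) N :=
  (h.finsupp (ULift.{u} (Fin n))).of_equiv
    ((Finsupp.linearEquivFunOnFinite R M _).trans (LinearEquiv.funCongrLeft R M Equiv.ulift.symm))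

theorem ExtZero.pi_right {ι : Type} {i : ℕ} (hi : 1 ≤ i) (h : ExtZero R M N i) :
    ExtZero R M (ι → N) i := by
  induction i generalizing M with
  | zero => omega
  | succ i ih =>
    obtain ⟨K, _, _, f, g, hg⟩ := exists_free_presentation R M
    have hF : ∀ j, 1 ≤ j → ExtZero R (M →₀ R) (ι → N) j := extAcyclic_of_projective _ _
    rcases Nat.eq_zero_or_pos i with rfl | hi'
    · refine hg.extZero_one (hF 1 le_rfl) fun φ => ?_
      choose ψ hψ using fun a : ι => hg.extend h (LinearMap.proj a ∘ₗ φ)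
      exact ⟨LinearMap.pi ψ, fun k => funext fun a => hψ a k⟩
    · exact hg.extZero_right (hF _ hi) (ih hi'
        (hg.extZero_left (extAcyclic_of_projective _ _ _ hi') h))

theorem ExtAcyclic.pi_right (ι : Type) (h : ExtAcyclic R M N) : ExtAcyclic R M (ι → N) :=
  fun i hi => (h i hi).pi_right hi

theorem ExtZero.prod_right {i : ℕ} (h : ExtZero R M N i) (h' : ExtZero R M N' i) :
    ExtZero R M (N × N') i := by
  refine subsingleton_of_forall_eq 0 fun x => ?_
  obtain ⟨y, rfl⟩ := Abelian.Ext.covariant_sequence_exact₂ (ModuleCat.of R M)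
    (IsSES.prod (R := R) N N').shortExact x (h'.elim _ _)
  rw [h.elim y 0, Abelian.Ext.zero_comp]

end

/-! ### Duals of resolutions and tensor evaluation -/


section TensorEval

variable {R : Type u} [CommRing R] {K X M B N G : Type u} [AddCommGroup K] [AddCommGroup X]
  [AddCommGroup M] [AddCommGroup B] [AddCommGroup N] [AddCommGroup G] [Module R K] [Module R X]
  [Module R M] [Module R B] [Module R N] [Module R G]

theorem exists_finite_syzygy (R : Type u) [CommRing R] [IsNoetherianRing R] (M : Type u)
    [AddCommGroup M] [Module R M] [Module.Finite R M] :
    ∃ (n : ℕ) (K : Type u) (_ : AddCommGroup K) (_ : Module R K) (_ : Module.Finite R K)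
      (f : K →ₗ[R] (Fin n → R)) (g : (Fin n → R) →ₗ[R] M), IsSES f g := by
  obtain ⟨n, g, hg⟩ := exists_finite_free_presentation R M
  exact ⟨n, _, _, _, Module.Finite.of_fg (IsNoetherian.noetherian _), _, g, hg⟩

theorem IsSES.dual {f : K →ₗ[R] X} {g : X →ₗ[R] M} (h : IsSES f g) (h1 : ExtZero R M B 1) :
    IsSES (LinearMap.lcomp R B g) (LinearMap.lcomp R B f) where
  inj φ ψ hφ := by
    ext m
    obtain ⟨x, rfl⟩ := h.surj m
    exact LinearMap.congr_fun hφ x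
  exact φ := by
    constructor
    · intro hφ
      obtain ⟨ψ, hψ⟩ := h.exists_desc φ fun k => LinearMap.congr_fun hφ k
      exact ⟨ψ, LinearMap.ext hψ⟩
    · rintro ⟨ψ, rfl⟩
      ext k
      simp [h.comp_eq_zero]
  surj φ := by
    obtain ⟨ψ, hψ⟩ := h.extend h1 φ
    exact ⟨ψ, LinearMap.ext hψ⟩

theorem extAcyclic_finFree_dual (n : ℕ) (h : ExtAcyclic R B N) :
    ExtAcyclic R ((Fin n → R) →ₗ[R] B) N :=
  (h.fin_fun n).of_equiv ((Pi.basisFun R (Fin n)).constr R)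

/-- If `N` has finite injective dimension and `Ext^i(B, N) = 0 = Ext^i(G, B)` for `i ≥ 1`,
then `Ext^i(Hom(G, B), N) = 0` for `i ≥ 1`. -/
theorem extAcyclic_hom [IsNoetherianRing R] [Module.Finite R G] {n : ℕ}
    (hN : HasInjectiveDimensionLT (ModuleCat.of R N) n) (hB : ExtAcyclic R B N)
    (hG : ExtAcyclic R G B) : ExtAcyclic R (G →ₗ[R] B) N := by
  suffices ∀ (k i : ℕ) (G : Type u) [AddCommGroup G] [Module R G] [Module.Finite R G],
      ExtAcyclic R G B → 1 ≤ i → n ≤ i + k → ExtZero R (G →ₗ[R] B) N i from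
    fun i hi => this n i G hG hi (by omega)
  intro k
  induction k with
  | zero => exact fun i G _ _ _ _ _ hk => extZero_of_hasInjectiveDimensionLT hN hk
  | succ k ih =>
    intro i G _ _ _ hG hi hk
    obtain ⟨m, K, _, _, _, f, g, h⟩ := exists_finite_syzygy R G
    exact (h.dual (hG 1 le_rfl)).extZero_left (extAcyclic_finFree_dual m hB i hi)
      (ih (i + 1) K (h.extAcyclic_left (extAcyclic_of_projective _ _) hG) (by omega) (by omega))

/-- Tensor evaluation `G ⊗ Hom(B, N) → Hom(Hom(G, B), N)`. -/
def tensorEval (R G B N : Type u) [CommRing R] [AddCommGroup G] [AddCommGroup B]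
    [AddCommGroup N] [Module R G] [Module R B] [Module R N] :
    G ⊗[R] (B →ₗ[R] N) →ₗ[R] ((G →ₗ[R] B) →ₗ[R] N) :=
  TensorProduct.lift (LinearMap.mk₂ R (fun g φ => φ ∘ₗ LinearMap.applyₗ g)
    (fun _ _ _ => by ext; simp) (fun _ _ _ => by ext; simp)
    (fun _ _ _ => by ext; simp) (fun _ _ _ => by ext; simp))

@[simp]
theorem tensorEval_tmul (g : G) (φ : B →ₗ[R] N) (h : G →ₗ[R] B) :
    tensorEval R G B N (g ⊗ₜ φ) h = φ (h g) := rfl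

theorem tensorEval_natural (f : K →ₗ[R] X) (t : K ⊗[R] (B →ₗ[R] N)) (h : X →ₗ[R] B) :
    tensorEval R X B N (f.rTensor _ t) h = tensorEval R K B N t (h ∘ₗ f) := by
  induction t with
  | zero => simp
  | tmul k φ => simp
  | add s t hs ht => simp [hs, ht]

theorem tensorEval_bijective_finFree (n : ℕ) (B N : Type u) [AddCommGroup B] [AddCommGroup N]
    [Module R B] [Module R N] : Function.Bijective (tensorEval R (Fin n → R) B N) := by
  have key : ∀ (φ : Fin n → (B →ₗ[R] N)) (j : Fin n) (b : B),
      tensorEval R (Fin n → R) B N (∑ i, Pi.single i 1 ⊗ₜ φ i)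
        ((LinearMap.proj j : (Fin n → R) →ₗ[R] R).smulRight b) = φ j b := by
    intro φ j b
    rw [map_sum, LinearMap.sum_apply, Finset.sum_eq_single j]
    · simp
    · intro i _ hij
      simp [Pi.single_eq_of_ne hij.symm]
    · simp
  have hsum : ∀ t : (Fin n → R) ⊗[R] (B →ₗ[R] N), ∃ φ : Fin n → (B →ₗ[R] N),
      t = ∑ i, Pi.single i 1 ⊗ₜ φ i := by
    intro t
    induction t with
    | zero => exact ⟨0, by simp⟩
    | tmul x φ =>
      refine ⟨fun i => x i • φ, ?_⟩
      conv_lhs => rw [pi_eq_sum_univ' x]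
      rw [TensorProduct.sum_tmul]
      refine Finset.sum_congr rfl fun i _ => ?_
      rw [TensorProduct.tmul_smul, TensorProduct.smul_tmul']
    | add s t hs ht =>
      obtain ⟨φ, rfl⟩ := hs
      obtain ⟨ψ, rfl⟩ := ht
      exact ⟨φ + ψ, by simp [TensorProduct.tmul_add, Finset.sum_add_distrib]⟩
  constructor
  · rw [injective_iff_map_eq_zero]
    intro t ht
    obtain ⟨φ, rfl⟩ := hsum t
    have : ∀ j, φ j = 0 := fun j => by
      ext b
      rw [← key φ j b, ht]; rfl
    simp [this]
  · intro Φ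
    refine ⟨∑ i, Pi.single i 1 ⊗ₜ
      (Φ ∘ₗ LinearMap.smulRightₗ (LinearMap.proj i : (Fin n → R) →ₗ[R] R)), ?_⟩
    ext h
    have : h = ∑ i, (LinearMap.proj i : (Fin n → R) →ₗ[R] R).smulRight (h (Pi.single i 1)) := by
      refine LinearMap.pi_ext' fun j => ?_
      ext
      simp [Pi.single_apply]
    conv_rhs => rw [this]
    simp

theorem tensorEval_surjective [IsNoetherianRing R] [Module.Finite R G] {n : ℕ}
    (hN : HasInjectiveDimensionLT (ModuleCat.of R N) n) (hB : ExtAcyclic R B N)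
    (hG : ExtAcyclic R G B) : Function.Surjective (tensorEval R G B N) := by
  obtain ⟨m, K, _, _, _, f, g, h⟩ := exists_finite_syzygy R G
  have hK : ExtAcyclic R K B := h.extAcyclic_left (extAcyclic_of_projective _ _) hG
  intro Φ
  obtain ⟨Ψ, hΨ⟩ := (h.dual (hG 1 le_rfl)).extend (extAcyclic_hom hN hB hK 1 le_rfl) Φ
  obtain ⟨t, rfl⟩ := (tensorEval_bijective_finFree m B N).2 Ψ
  refine ⟨g.rTensor _ t, ?_⟩
  ext φ
  rw [tensorEval_natural, ← hΨ]
  rfl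

theorem tensorEval_bijective [IsNoetherianRing R] [Module.Finite R G] {n : ℕ}
    (hN : HasInjectiveDimensionLT (ModuleCat.of R N) n) (hB : ExtAcyclic R B N)
    (hG : ExtAcyclic R G B) : Function.Bijective (tensorEval R G B N) := by
  refine ⟨?_, tensorEval_surjective hN hB hG⟩
  obtain ⟨m, K, _, _, _, f, g, h⟩ := exists_finite_syzygy R G
  have hK : ExtAcyclic R K B := h.extAcyclic_left (extAcyclic_of_projective _ _) hG
  rw [injective_iff_map_eq_zero]
  intro t ht
  obtain ⟨t, rfl⟩ := LinearMap.rTensor_surjective (B →ₗ[R] N) h.surj t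
  obtain ⟨Φ, hΦ⟩ := (h.dual (hG 1 le_rfl)).exists_desc (tensorEval R _ B N t) fun φ => by
    have := tensorEval_natural g t φ
    rw [ht] at this
    exact this.symm
  obtain ⟨s, rfl⟩ := tensorEval_surjective hN hB hK Φ
  have hs : f.rTensor _ s = t := by
    refine (tensorEval_bijective_finFree m B N).1 ?_
    ext φ
    rw [tensorEval_natural, ← hΦ φ]
    rfl
  rw [← hs, ← LinearMap.rTensor_comp_apply, show g ∘ₗ f = 0 from LinearMap.ext h.comp_eq_zero]
  simp

end TensorEval

/-! ### Biduality with respect to a dualizing module -/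

section Biduality

variable {R : Type u} [CommRing R]

theorem IsDualizing.exists_hasInjectiveDimensionLT {D : Type u} [AddCommGroup D] [Module R D]
    (hD : IsDualizing R D) : ∃ n, HasInjectiveDimensionLT (ModuleCat.of R D) n := by
  obtain ⟨n, hn⟩ := (injectiveDimension_ne_top_iff _).1 hD.injectiveDimension_ne_top
  exact ⟨_, hn⟩

variable [IsNoetherianRing R] {D G : Type u} [AddCommGroup D] [Module R D] [AddCommGroup G]
  [Module R G]

theorem IsDualizing.extAcyclic_dual (hD : IsDualizing R D) [Module.Finite R G]
    (hG : ExtAcyclic R G D) : ExtAcyclic R (G →ₗ[R] D) D := by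
  obtain ⟨n, hn⟩ := hD.exists_hasInjectiveDimensionLT
  exact extAcyclic_hom hn hD.ext_eq_zero hG

theorem IsDualizing.biduality (hD : IsDualizing R D) [Module.Finite R G]
    (hG : ExtAcyclic R G D) :
    Function.Bijective (LinearMap.applyₗ : G →ₗ[R] (G →ₗ[R] D) →ₗ[R] D) := by
  obtain ⟨n, hn⟩ := hD.exists_hasInjectiveDimensionLT
  have h := tensorEval_bijective hn hD.ext_eq_zero hG
  let e : R ≃ₗ[R] (D →ₗ[R] D) := LinearEquiv.ofBijective (LinearMap.lsmul R D)
    hD.homothety_bijective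
  let e' : G ≃ₗ[R] G ⊗[R] (D →ₗ[R] D) :=
    (TensorProduct.rid R G).symm.trans (TensorProduct.congr (LinearEquiv.refl R G) e)
  have : (LinearMap.applyₗ : G →ₗ[R] (G →ₗ[R] D) →ₗ[R] D) = tensorEval R G D D ∘ₗ e' := by
    ext g φ
    simp [e', e]
  rw [this]
  exact h.comp e'.bijective

end Biduality

/-! ### Semidualizing modules and modules of finite injective dimension -/

section Semidualizing

variable {R : Type u} [CommRing R] {C : Type u} [AddCommGroup C] [Module R C]

theorem IsSemidualizing.annihilator (hC : IsSemidualizing R C) : Module.annihilator R C = ⊥ := by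
  rw [eq_bot_iff]
  intro r hr
  refine hC.homothety_bijective.1 ?_
  ext c
  simpa using Module.mem_annihilator.1 hr c

theorem subsingleton_of_subsingleton_hom [IsNoetherianRing R] [Module.Finite R C]
    (hC : Module.annihilator R C = ⊥) {M : Type*} [AddCommGroup M] [Module R M]
    (h : Subsingleton (C →ₗ[R] M)) : Subsingleton M := by
  refine subsingleton_of_forall_eq 0 fun m => ?_
  have : Subsingleton (C →ₗ[R] (Submodule.span R {m})) := by
    refine subsingleton_of_forall_eq 0 fun φ => ?_
    ext c
    exact LinearMap.congr_fun (h.elim ((Submodule.span R {m}).subtype ∘ₗ φ) 0) c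
  obtain ⟨r, hr, hreg⟩ := IsSMulRegular.subsingleton_linearMap_iff.1 this
  rw [hC, Ideal.mem_bot] at hr
  subst hr
  have h0 := hreg (a₁ := ⟨m, Submodule.mem_span_singleton_self m⟩) (a₂ := 0) (by simp)
  exact congrArg Subtype.val h0

theorem subsingleton_of_subsingleton_tensor [IsNoetherianRing R] [Module.Finite R C]
    (hC : Module.annihilator R C = ⊥) {L : Type*} [AddCommGroup L] [Module R L]
    (h : Subsingleton (C ⊗[R] L)) : Subsingleton L := by
  have h1 : Subsingleton (C →ₗ[R] CharacterModule L) := by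
    refine subsingleton_of_forall_eq 0 fun φ => ?_
    ext c l
    have : CharacterModule.uncurry φ (c ⊗ₜ l) = 0 := by
      rw [h.elim (c ⊗ₜ l) 0, map_zero]
    exact this
  have h2 := subsingleton_of_subsingleton_hom hC h1
  refine subsingleton_of_forall_eq 0 fun l => ?_
  exact CharacterModule.eq_zero_of_character_apply fun c => by rw [h2.elim c 0]; rfl

theorem IsSemidualizing.eval_bijective [IsNoetherianRing R] (hC : IsSemidualizing R C)
    {N : Type u} [AddCommGroup N] [Module R N] {n : ℕ}
    (hN : HasInjectiveDimensionLT (ModuleCat.of R N) n) (h : ExtAcyclic R C N) :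
    Function.Bijective
      (TensorProduct.lift (LinearMap.applyₗ : C →ₗ[R] (C →ₗ[R] N) →ₗ[R] N)) := by
  have := hC.finite
  have h1 := tensorEval_bijective hN h hC.ext_eq_zero
  have h2 : Function.Bijective
      (LinearMap.applyₗ LinearMap.id : ((C →ₗ[R] C) →ₗ[R] N) →ₗ[R] N) := by
    constructor
    · rw [injective_iff_map_eq_zero]
      intro Φ hΦ
      ext φ
      obtain ⟨r, rfl⟩ := hC.homothety_bijective.2 φ
      have : LinearMap.lsmul R C r = r • LinearMap.id := by ext; simp
      rw [this, map_smul]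
      simpa using congrArg (r • ·) hΦ
    · intro x
      let e := LinearEquiv.ofBijective (LinearMap.lsmul R C) hC.homothety_bijective
      refine ⟨(LinearMap.toSpanSingleton R N x) ∘ₗ e.symm.toLinearMap, ?_⟩
      have : e.symm LinearMap.id = 1 := by
        rw [LinearEquiv.symm_apply_eq]; ext; simp [e]
      simp [this]
  have : TensorProduct.lift (LinearMap.applyₗ : C →ₗ[R] (C →ₗ[R] N) →ₗ[R] N) =
      (LinearMap.applyₗ LinearMap.id : ((C →ₗ[R] C) →ₗ[R] N) →ₗ[R] N) ∘ₗ tensorEval R C C N := by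
    ext c φ
    simp
  rw [this]
  exact h2.comp h1

theorem exists_injective_ses (N : Type u) [AddCommGroup N] [Module R N] :
    ∃ (E L : Type u) (_ : AddCommGroup E) (_ : AddCommGroup L) (_ : Module R E) (_ : Module R L)
      (f : N →ₗ[R] E) (g : E →ₗ[R] L), IsSES f g ∧
      HasInjectiveDimensionLT (ModuleCat.of R E) 1 := by
  let E : ModuleCat.{u} R := Injective.under (ModuleCat.of R N)
  let ι : ModuleCat.of R N ⟶ E := Injective.ι (ModuleCat.of R N)
  refine ⟨E, _, _, _, _, _, ι.hom, _,
    IsSES.of_range ((ModuleCat.mono_iff_injective ι).1 inferInstance), ?_⟩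
  exact injective_iff_hasInjectiveDimensionLT_one.1
    (inferInstanceAs (Injective (Injective.under (ModuleCat.of R N))))

/-- A semidualizing module has no higher `Ext` into modules of finite injective dimension. -/
theorem IsSemidualizing.extAcyclic [IsNoetherianRing R] (hC : IsSemidualizing R C) (n : ℕ)
    (N : Type u) [AddCommGroup N] [Module R N]
    (hN : HasInjectiveDimensionLT (ModuleCat.of R N) n) : ExtAcyclic R C N := by
  induction n generalizing N with
  | zero => exact fun i hi => extZero_of_hasInjectiveDimensionLT hN (Nat.zero_le i)
  | succ n ih =>
    rcases Nat.eq_zero_or_pos n with rfl | hn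
    · exact fun i hi => extZero_of_hasInjectiveDimensionLT hN hi
    obtain ⟨E, L, _, _, _, _, f, g, h, hE⟩ := exists_injective_ses (R := R) N
    have hE' : ∀ Y : Type u, ∀ [AddCommGroup Y] [Module R Y], ExtAcyclic R Y E :=
      fun Y _ _ i hi => extZero_of_hasInjectiveDimensionLT hE hi
    have hLd : HasInjectiveDimensionLT (ModuleCat.of R L) n :=
      h.shortExact.hasInjectiveDimensionLT_X₃ n (hasInjectiveDimensionLT_of_ge _ 1 n hn) hN
    have hL := ih L hLd
    have := hC.finite
    rintro (_ | _ | i) hi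
    · omega
    · refine h.extZero_one_of_lift (hE' C 1 hi) ?_
      let q : (C →ₗ[R] E) →ₗ[R] (C →ₗ[R] L) := LinearMap.compRight R g
      have hq : Function.Surjective (q.lTensor C) := by
        intro t
        obtain ⟨x, hx⟩ := h.surj (TensorProduct.lift
          (LinearMap.applyₗ : C →ₗ[R] (C →ₗ[R] L) →ₗ[R] L) t)
        obtain ⟨s, rfl⟩ := (hC.eval_bijective hE (hE' C)).2 x
        refine ⟨s, (hC.eval_bijective hLd hL).1 ?_⟩
        rw [← hx, ← LinearMap.comp_apply, ← LinearMap.comp_apply]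
        congr 1
        ext c φ
        simp [q]
      have h0 : Subsingleton (C ⊗[R] ((C →ₗ[R] L) ⧸ LinearMap.range q)) := by
        refine subsingleton_of_forall_eq 0 fun t => ?_
        obtain ⟨t, rfl⟩ := LinearMap.lTensor_surjective C (Submodule.mkQ_surjective _) t
        obtain ⟨s, rfl⟩ := hq t
        rw [← LinearMap.lTensor_comp_apply, LinearMap.range_mkQ_comp]
        simp
      have h1 := subsingleton_of_subsingleton_tensor hC.annihilator h0
      have h2 : LinearMap.range q = ⊤ := Submodule.Quotient.subsingleton_iff.1 h1
      intro φ
      obtain ⟨ψ, rfl⟩ := LinearMap.range_eq_top.1 h2 φ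
      exact ⟨ψ, fun y => rfl⟩
    · exact h.extZero_left_cov (hE' C _ hi) (hL _ (by omega))

end Semidualizing

/-! ### Dual pairs of semidualizing modules -/

/-- Semidualizing modules `C` and `B` that are dual to each other, through the pairing `p`, with
respect to the dualizing module `D`. -/
structure DualPair {R C B D : Type u} [CommRing R] [AddCommGroup C] [AddCommGroup B]
    [AddCommGroup D] [Module R C] [Module R B] [Module R D] (p : C →ₗ[R] B →ₗ[R] D) : Prop where
  left : IsSemidualizing R C
  right : IsSemidualizing R B
  dualizing : IsDualizing R D
  ext_left : ExtAcyclic R C D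
  ext_right : ExtAcyclic R B D
  bijective : Function.Bijective p
  bijective_flip : Function.Bijective p.flip
  surjective : Function.Surjective (TensorProduct.lift p)

namespace DualPair

variable {R : Type u} [CommRing R] {C B D : Type u} [AddCommGroup C] [AddCommGroup B]
  [AddCommGroup D] [Module R C] [Module R B] [Module R D] {p : C →ₗ[R] B →ₗ[R] D}

theorem symm (h : DualPair p) : DualPair p.flip where
  left := h.right
  right := h.left
  dualizing := h.dualizing
  ext_left := h.ext_right
  ext_right := h.ext_left
  bijective := h.bijective_flip
  bijective_flip := h.bijective
  surjective := by
    have : TensorProduct.lift p.flip =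
        TensorProduct.lift p ∘ₗ (TensorProduct.comm R B C).toLinearMap := by
      ext; simp
    rw [this]
    exact h.surjective.comp (TensorProduct.comm R B C).surjective

end DualPair

section

variable {R : Type u} [CommRing R] [IsNoetherianRing R] {C D : Type u} [AddCommGroup C]
  [AddCommGroup D] [Module R C] [Module R D]

theorem IsSemidualizing.extZero_dual_dual (hC : IsSemidualizing R C) (hD : IsDualizing R D)
    (i : ℕ) (hi : 1 ≤ i) (G : Type u) [AddCommGroup G] [Module R G] [Module.Finite R G]
    (hGC : ExtAcyclic R G C) (hGD : ExtAcyclic R G D) :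
    ExtZero R (C →ₗ[R] D) (G →ₗ[R] D) i := by
  have := hC.finite
  obtain ⟨n, hn⟩ := hD.exists_hasInjectiveDimensionLT
  have hCD := hC.extAcyclic n D hn
  have hb := hD.biduality hCD
  induction i generalizing G with
  | zero => omega
  | succ i ih =>
    obtain ⟨m, K, _, _, _, f, g, h⟩ := exists_finite_syzygy R G
    have hF : ExtAcyclic R (C →ₗ[R] D) ((Fin m → R) →ₗ[R] D) :=
      ((hD.extAcyclic_dual hCD).pi_right (Fin m)).of_equiv_right
        ((Pi.basisFun R (Fin m)).constr R)
    have hd := h.dual (hGD 1 le_rfl)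
    rcases Nat.eq_zero_or_pos i with rfl | hi'
    · refine hd.extZero_one_of_lift (hF 1 le_rfl) fun φ => ?_
      let e := LinearEquiv.ofBijective _ hb
      obtain ⟨κ, hκ⟩ := h.extend (hGC 1 le_rfl) (e.symm.toLinearMap ∘ₗ φ.flip)
      refine ⟨LinearMap.lcomp R D κ, fun b => ?_⟩
      ext k
      have h1 : e (κ (f k)) = φ.flip k := by rw [hκ]; simp
      exact LinearMap.congr_fun h1 b
    · exact hd.extZero_left_cov (hF _ hi) (ih hi' K
        (h.extAcyclic_left (extAcyclic_of_projective _ _) hGC)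
        (h.extAcyclic_left (extAcyclic_of_projective _ _) hGD))

theorem IsSemidualizing.dualPair (hC : IsSemidualizing R C) (hD : IsDualizing R D) :
    DualPair (LinearMap.applyₗ : C →ₗ[R] (C →ₗ[R] D) →ₗ[R] D) := by
  have := hC.finite
  have := hD.finite
  obtain ⟨n, hn⟩ := hD.exists_hasInjectiveDimensionLT
  have hCD := hC.extAcyclic n D hn
  have hb := hD.biduality hCD
  refine ⟨hC, ⟨inferInstance, ⟨?_, ?_⟩, fun i hi =>
    hC.extZero_dual_dual hD i hi C hC.ext_eq_zero hCD⟩, hD, hCD, hD.extAcyclic_dual hCD, hb, ?_,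
    (hC.eval_bijective hn hCD).2⟩
  · rw [injective_iff_map_eq_zero]
    intro r hr
    refine hC.homothety_bijective.1 ?_
    ext c
    refine hb.1 ?_
    ext φ
    simpa using LinearMap.congr_fun (LinearMap.congr_fun hr φ) c
  · intro f
    let e := LinearEquiv.ofBijective _ hb
    obtain ⟨r, hr⟩ := hC.homothety_bijective.2 (e.symm.toLinearMap ∘ₗ f.flip)
    refine ⟨r, ?_⟩
    ext b c
    have h1 : e (r • c) = f.flip c := by
      rw [← LinearMap.lsmul_apply, hr]; simp
    simpa [e] using LinearMap.congr_fun h1 b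
  · have : (LinearMap.applyₗ : C →ₗ[R] (C →ₗ[R] D) →ₗ[R] D).flip = LinearMap.id := by
      ext; simp
    rw [this]
    exact Function.bijective_id

end

/-! ### Coinduced modules -/

theorem IsSES.restrictScalars (R : Type*) {S : Type*} [CommRing R] [CommRing S] [Algebra R S]
    {K X M : Type*} [AddCommGroup K] [AddCommGroup X] [AddCommGroup M] [Module R K] [Module R X]
    [Module R M] [Module S K] [Module S X] [Module S M] [IsScalarTower R S K]
    [IsScalarTower R S X] [IsScalarTower R S M] {f : K →ₗ[S] X} {g : X →ₗ[S] M}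
    (h : IsSES f g) : IsSES (f.restrictScalars R) (g.restrictScalars R) :=
  ⟨h.inj, h.exact, h.surj⟩

namespace CoindHom

variable {R S : Type u} [CommRing R] [CommRing S] [Algebra R S] {B : Type u} [AddCommGroup B]
  [Module R B]

instance instModuleBase : Module R (CoindHom R S B) := inferInstanceAs (Module R (S →ₗ[R] B))

instance instIsScalarTowerBase : IsScalarTower R S (CoindHom R S B) where
  smul_assoc r s f := LinearMap.ext fun x => by
    change (show S →ₗ[R] B from f) ((r • s) * x) = r • (show S →ₗ[R] B from f) (s * x)
    rw [smul_mul_assoc, map_smul]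

/-- The identity map from `CoindHom R S B` to `Hom_R(S, B)`. -/
def toHom : CoindHom R S B ≃ₗ[R] (S →ₗ[R] B) := LinearEquiv.refl R (S →ₗ[R] B)

@[simp]
theorem toHom_smul_apply (s : S) (f : CoindHom R S B) (x : S) :
    toHom (s • f) x = toHom f (s * x) := rfl

@[ext]
theorem hom_ext {f g : CoindHom R S B} (h : ∀ x, toHom f x = toHom g x) : f = g :=
  LinearMap.ext h

variable {M : Type u} [AddCommGroup M] [Module R M] [Module S M] [IsScalarTower R S M]

/-- The `S`-linear map `M → Hom_R(S, B)` that corresponds to an `R`-linear map `M → B`. -/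
def curry (φ : M →ₗ[R] B) : M →ₗ[S] CoindHom R S B where
  toFun m := toHom.symm (φ ∘ₗ (LinearMap.toSpanSingleton S M m).restrictScalars R)
  map_add' x y := by
    ext s
    change φ (s • (x + y)) = φ (s • x) + φ (s • y)
    rw [smul_add, map_add]
  map_smul' s x := by
    ext t
    simp only [RingHom.id_apply, toHom_smul_apply, LinearEquiv.apply_symm_apply]
    simp [mul_smul, smul_comm s t]

@[simp]
theorem toHom_curry_apply (φ : M →ₗ[R] B) (m : M) (s : S) : toHom (curry φ m) s = φ (s • m) := rfl

/-- Evaluation at `1` of an `S`-linear map `M → Hom_R(S, B)`. -/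
def evalOne (Φ : M →ₗ[S] CoindHom R S B) : M →ₗ[R] B :=
  LinearMap.applyₗ (1 : S) ∘ₗ toHom.toLinearMap ∘ₗ Φ.restrictScalars R

theorem evalOne_apply (Φ : M →ₗ[S] CoindHom R S B) (m : M) : evalOne Φ m = toHom (Φ m) 1 := rfl

theorem toHom_apply_eq (Φ : M →ₗ[S] CoindHom R S B) (m : M) (s : S) :
    toHom (Φ m) s = evalOne Φ (s • m) := by
  rw [evalOne_apply, map_smul, toHom_smul_apply, mul_one]

end CoindHom

section

variable {R S : Type u} [CommRing R] [CommRing S] [Algebra R S] {B : Type u} [AddCommGroup B]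
  [Module R B]

open CoindHom in
/-- `Ext_S^i(M, Hom_R(S, B)) = 0` if and only if `Ext_R^i(M, B) = 0`, provided that
`Ext_R^j(S, B) = 0` for `j ≥ 1`. -/
theorem extZero_coindHom_iff (hS : ExtAcyclic R S B) (i : ℕ) (hi : 1 ≤ i) (M : Type u)
    [AddCommGroup M] [Module R M] [Module S M] [IsScalarTower R S M] :
    ExtZero S M (CoindHom R S B) i ↔ ExtZero R M B i := by
  induction i generalizing M with
  | zero => omega
  | succ i ih =>
    obtain ⟨K, _, _, f, g, h⟩ := exists_free_presentation S M
    let _ : Module R K := Module.compHom K (algebraMap R S)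
    have : IsScalarTower R S K := .of_algebraMap_smul fun _ _ => rfl
    have h' := h.restrictScalars R
    have hF : ExtAcyclic S (M →₀ S) (CoindHom R S B) := extAcyclic_of_projective _ _
    have hF' : ExtAcyclic R (M →₀ S) B := hS.finsupp M
    rcases Nat.eq_zero_or_pos i with rfl | hi'
    · constructor
      · intro h0
        refine h'.extZero_one (hF' 1 le_rfl) fun φ => ?_
        obtain ⟨ψ, hψ⟩ := h.extend h0 (curry φ)
        refine ⟨evalOne ψ, fun k => ?_⟩
        rw [evalOne_apply, LinearMap.restrictScalars_apply, hψ, toHom_curry_apply, one_smul]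
      · intro h0
        refine h.extZero_one (hF 1 le_rfl) fun φ => ?_
        obtain ⟨ψ, hψ⟩ := h'.extend h0 (evalOne φ)
        refine ⟨curry ψ, fun k => ?_⟩
        ext s
        rw [toHom_curry_apply, toHom_apply_eq, ← hψ, LinearMap.restrictScalars_apply, map_smul f]
    · constructor
      · exact fun h0 => h'.extZero_right (hF' _ hi)
          ((ih hi' K).1 (h.extZero_left (hF _ hi') h0))
      · exact fun h0 => h.extZero_right (hF _ hi)
          ((ih hi' K).2 (h'.extZero_left (hF' _ hi') h0))

theorem extAcyclic_coindHom_iff (hS : ExtAcyclic R S B) (M : Type u)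
    [AddCommGroup M] [Module R M] [Module S M] [IsScalarTower R S M] :
    ExtAcyclic S M (CoindHom R S B) ↔ ExtAcyclic R M B :=
  forall₂_congr fun i hi => extZero_coindHom_iff hS i hi M

theorem injectiveDimension_coindHom_ne_top (hS : ExtAcyclic R S B)
    (h : injectiveDimension (ModuleCat.of R B) ≠ ⊤) :
    injectiveDimension (ModuleCat.of S (CoindHom R S B)) ≠ ⊤ := by
  obtain ⟨n, hn⟩ := (injectiveDimension_ne_top_iff _).1 h
  refine (injectiveDimension_ne_top_iff _).2 ⟨n, ?_⟩
  refine hasInjectiveDimensionLT_of_enoughProjectives _ _ fun Y => ?_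
  let _ : Module R Y := Module.compHom Y (algebraMap R S)
  have : IsScalarTower R S Y := .of_algebraMap_smul fun _ _ => rfl
  exact (extZero_coindHom_iff hS (n + 1) (by omega) Y).2
    (extZero_of_hasInjectiveDimensionLT hn le_rfl)

theorem injectiveDimension_ne_top_of_coindHom (hS : ExtAcyclic R S B) (ε : S →ₐ[R] R)
    (h : injectiveDimension (ModuleCat.of S (CoindHom R S B)) ≠ ⊤) :
    injectiveDimension (ModuleCat.of R B) ≠ ⊤ := by
  obtain ⟨n, hn⟩ := (injectiveDimension_ne_top_iff _).1 h
  refine (injectiveDimension_ne_top_iff _).2 ⟨n, ?_⟩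
  refine hasInjectiveDimensionLT_of_enoughProjectives _ _ fun Y => ?_
  let _ : Module S Y := Module.compHom Y ε.toRingHom
  have : IsScalarTower R S Y := .of_algebraMap_smul fun r y => by
    change ε (algebraMap R S r) • y = r • y
    rw [ε.commutes]; rfl
  exact (extZero_coindHom_iff hS (n + 1) (by omega) Y).1
    (extZero_of_hasInjectiveDimensionLT hn le_rfl)

open CoindHom in
theorem IsDualizing.coindHom [IsNoetherianRing R] [Module.Finite R S] {D : Type u}
    [AddCommGroup D] [Module R D] (hD : IsDualizing R D) (hS : ExtAcyclic R S D) :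
    IsDualizing S (CoindHom R S D) where
  finite := by
    have := hD.finite
    have : Module.Finite R (CoindHom R S D) := inferInstanceAs (Module.Finite R (S →ₗ[R] D))
    exact Module.Finite.of_restrictScalars_finite R S _
  homothety_bijective := by
    have hb := hD.biduality hS
    constructor
    · rw [injective_iff_map_eq_zero]
      intro s hs
      refine hb.1 ?_
      ext φ
      have := congrArg (fun t => toHom t 1) (LinearMap.congr_fun hs (toHom.symm φ))
      simpa using this
    · intro Φ
      obtain ⟨s, hs⟩ := hb.2 (evalOne Φ ∘ₗ toHom.symm.toLinearMap)
      refine ⟨s, ?_⟩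
      ext f t
      have h1 : toHom (Φ f) t = evalOne Φ (t • f) := toHom_apply_eq Φ f t
      have h2 : toHom (t • f) s = evalOne Φ (t • f) := LinearMap.congr_fun hs (toHom (t • f))
      rw [h1, ← h2, toHom_smul_apply, mul_comm]
      rfl
  ext_eq_zero := (extAcyclic_coindHom_iff hS (CoindHom R S D)).2
    ((hD.extAcyclic_dual hS).of_equiv toHom.symm)
  injectiveDimension_ne_top := injectiveDimension_coindHom_ne_top hS hD.injectiveDimension_ne_top

/-- An `R`-linear form `l : S → B` is perfect if `s ↦ l(s · )` is a bijection
`S → Hom_R(S, B)`. -/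
def IsPerfectForm (l : S →ₗ[R] B) : Prop :=
  Function.Bijective (CoindHom.curry l : S →ₗ[S] CoindHom R S B)

/-- The isomorphism `S ≅ Hom_R(S, B)` of a perfect form. -/
def IsPerfectForm.equiv {l : S →ₗ[R] B} (hl : IsPerfectForm l) : S ≃ₗ[S] CoindHom R S B :=
  LinearEquiv.ofBijective _ hl

theorem IsPerfectForm.isGorensteinLocal {l : S →ₗ[R] B} (hl : IsPerfectForm l)
    (hn : IsNoetherianRing S) (hloc : IsLocalRing S)
    (hS : ExtAcyclic R S B) (h : injectiveDimension (ModuleCat.of R B) ≠ ⊤) :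
    IsGorensteinLocal S := by
  refine ⟨hn, hloc, ?_⟩
  rw [injectiveDimension_eq_of_iso hl.equiv.toModuleIso]
  exact injectiveDimension_coindHom_ne_top hS h

theorem IsPerfectForm.injectiveDimension_ne_top {l : S →ₗ[R] B} (hl : IsPerfectForm l)
    (hS : ExtAcyclic R S B) (ε : S →ₐ[R] R) (h : IsGorensteinLocal S) :
    injectiveDimension (ModuleCat.of R B) ≠ ⊤ := by
  refine injectiveDimension_ne_top_of_coindHom hS ε ?_
  rw [← injectiveDimension_eq_of_iso hl.equiv.toModuleIso]
  exact h.injectiveDimension_ne_top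

end

/-! ### Regular sequences on semidualizing modules -/

section Regular

open RingTheory.Sequence
open scoped Pointwise

variable {R : Type u} [CommRing R]

theorem mem_smul_top_iff {M : Type*} [AddCommGroup M] [Module R M] {r : R} {m : M} :
    m ∈ r • (⊤ : Submodule R M) ↔ ∃ x, r • x = m := by
  simp [Submodule.mem_smul_pointwise_iff_exists]

/-- `M/rM ≅ N` for a surjection `M → N` with kernel `rM`. -/
def quotSMulTopEquiv {M N : Type*} [AddCommGroup M] [AddCommGroup N] [Module R M] [Module R N]
    (r : R) (f : M →ₗ[R] N) (hf : Function.Surjective f)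
    (hk : ∀ m, f m = 0 ↔ ∃ x, r • x = m) : QuotSMulTop r M ≃ₗ[R] N :=
  (Submodule.quotEquivOfEq _ _ (by
    ext m; rw [mem_smul_top_iff, LinearMap.mem_ker, hk])).trans (f.quotKerEquivOfSurjective hf)

theorem RingTheory.Sequence.IsWeaklyRegular.prod {M N : Type*} [AddCommGroup M] [AddCommGroup N]
    [Module R M] [Module R N] {rs : List R} (hM : IsWeaklyRegular M rs)
    (hN : IsWeaklyRegular N rs) : IsWeaklyRegular (M × N) rs := by
  induction rs generalizing M N with
  | nil => exact .nil R _
  | cons r rs ih =>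
    rw [isWeaklyRegular_cons_iff] at hM hN ⊢
    refine ⟨?_, ?_⟩
    · intro x y hxy
      exact Prod.ext (hM.1 (congrArg Prod.fst hxy)) (hN.1 (congrArg Prod.snd hxy))
    · let f : M × N →ₗ[R] QuotSMulTop r M × QuotSMulTop r N :=
        LinearMap.prodMap (Submodule.mkQ _) (Submodule.mkQ _)
      refine ((quotSMulTopEquiv r f
        (Function.Surjective.prodMap (Submodule.mkQ_surjective _) (Submodule.mkQ_surjective _))
        fun m => ?_).isWeaklyRegular_congr rs).2 (ih hM.2 hN.2)
      have h1 : f m = 0 ↔ (m.1 ∈ r • (⊤ : Submodule R M) ∧ m.2 ∈ r • (⊤ : Submodule R N)) := by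
        simp [f, Prod.ext_iff, Submodule.Quotient.mk_eq_zero]
      rw [h1, mem_smul_top_iff, mem_smul_top_iff]
      constructor
      · rintro ⟨⟨x, hx⟩, ⟨y, hy⟩⟩
        exact ⟨(x, y), Prod.ext hx hy⟩
      · rintro ⟨x, rfl⟩
        exact ⟨⟨x.1, rfl⟩, ⟨x.2, rfl⟩⟩

/-- A sequence that is regular on `Hom(B, N)` is regular on `N`, if `B` is faithful and
`Ext^i(B, N) = 0` for `i ≥ 1`. -/
theorem isWeaklyRegular_of_hom [IsNoetherianRing R] {B N : Type u} [AddCommGroup B]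
    [AddCommGroup N] [Module R B] [Module R N] [Module.Finite R B]
    (hB : Module.annihilator R B = ⊥) (hN : ExtAcyclic R B N) {rs : List R}
    (h : IsWeaklyRegular (B →ₗ[R] N) rs) : IsWeaklyRegular N rs := by
  induction rs generalizing N with
  | nil => exact .nil R _
  | cons r rs ih =>
    rw [isWeaklyRegular_cons_iff] at h ⊢
    have hr : Function.Injective (LinearMap.lsmul R N r) := by
      rw [← LinearMap.ker_eq_bot, ← Submodule.subsingleton_iff_eq_bot]
      refine subsingleton_of_subsingleton_hom hB (subsingleton_of_forall_eq 0 fun φ => ?_)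
      ext b
      have h0 : (LinearMap.ker (LinearMap.lsmul R N r)).subtype ∘ₗ φ = 0 := by
        refine h.1 ?_
        ext b
        change r • ((φ b : LinearMap.ker (LinearMap.lsmul R N r)) : N) = r • (0 : N)
        rw [smul_zero]
        exact LinearMap.mem_ker.1 (φ b).2
      exact LinearMap.congr_fun h0 b
    have hs : IsSES (LinearMap.lsmul R N r) (Submodule.mkQ (r • (⊤ : Submodule R N))) := by
      refine ⟨hr, fun x => ?_, Submodule.mkQ_surjective _⟩
      rw [Submodule.mkQ_apply, Submodule.Quotient.mk_eq_zero, mem_smul_top_iff]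
      rfl
    refine ⟨hr, ih (fun i hi => hs.extZero_right_cov (hN i hi) (hN _ (by omega))) ?_⟩
    refine ((quotSMulTopEquiv r (LinearMap.compRight R (M := B)
      (Submodule.mkQ (r • (⊤ : Submodule R N)))) ?_ ?_).isWeaklyRegular_congr rs).1 h.2
    · intro φ
      obtain ⟨ψ, hψ⟩ := hs.lift (hN 1 le_rfl) φ
      exact ⟨ψ, LinearMap.ext hψ⟩
    · intro φ
      constructor
      · intro hφ
        obtain ⟨ψ, hψ⟩ := hs.exists_lift φ fun b => LinearMap.congr_fun hφ b
        exact ⟨ψ, LinearMap.ext hψ⟩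
      · rintro ⟨ψ, rfl⟩
        ext b
        exact hs.comp_eq_zero (ψ b)

theorem IsSemidualizing.isWeaklyRegular [IsNoetherianRing R] {B : Type u} [AddCommGroup B]
    [Module R B] (hB : IsSemidualizing R B) {rs : List R} (h : IsWeaklyRegular R rs) :
    IsWeaklyRegular B rs := by
  have := hB.finite
  exact isWeaklyRegular_of_hom hB.annihilator hB.ext_eq_zero
    (((LinearEquiv.ofBijective _ hB.homothety_bijective).isWeaklyRegular_congr rs).1 h)

theorem localDepth_le_ringKrullDim [IsNoetherianRing R] [IsLocalRing R] :
    ((localDepth R : ℕ∞) : WithBot ℕ∞) ≤ ringKrullDim R := by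
  have hbot : ringKrullDim R ≠ ⊥ := by
    have := ringKrullDim_nonneg_of_nontrivial (R := R)
    intro h
    rw [h] at this
    exact absurd this (by simp)
  obtain ⟨d, hd⟩ := WithBot.ne_bot_iff_exists.1 hbot
  rw [← hd, WithBot.coe_le_coe]
  refine iSup_le fun rs => ?_
  have h1 := ringKrullDim_add_length_eq_ringKrullDim_of_isRegular rs.1 rs.2
  have h2 : ((rs.1.length : ℕ∞) : WithBot ℕ∞) ≤ ringKrullDim R := by
    rw [← h1]
    have : Nontrivial (R ⧸ Ideal.ofList rs.1) := by
      refine Ideal.Quotient.nontrivial_iff.2 fun h => rs.2.top_ne_smul ?_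
      rw [h]; simp
    have h3 := ringKrullDim_nonneg_of_nontrivial (R := R ⧸ Ideal.ofList rs.1)
    exact le_add_of_nonneg_left h3
  rw [← hd] at h2
  exact WithBot.coe_le_coe.1 h2

end Regular

/-! ### Trivial extensions -/

/-- The `R`-algebra `S` is the trivial extension `R ⋉ B`, with coordinates `ε` and `l`. -/
structure IsTrivialExt {R S B : Type u} [CommRing R] [CommRing S] [Algebra R S] [AddCommGroup B]
    [Module R B] (ε : S →ₐ[R] R) (l : S →ₗ[R] B) : Prop where
  bijective : Function.Bijective (ε.toLinearMap.prod l)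
  mul : ∀ s t, l (s * t) = ε s • l t + ε t • l s

namespace IsTrivialExt

variable {R S B : Type u} [CommRing R] [CommRing S] [Algebra R S] [AddCommGroup B]
  [Module R B] {ε : S →ₐ[R] R} {l : S →ₗ[R] B}

/-- `R ⋉ B ≅ R × B` as `R`-modules. -/
def equiv (h : IsTrivialExt ε l) : S ≃ₗ[R] R × B := LinearEquiv.ofBijective _ h.bijective

theorem ext (h : IsTrivialExt ε l) {s t : S} (h1 : ε s = ε t) (h2 : l s = l t) : s = t :=
  h.bijective.1 (Prod.ext h1 h2)

theorem exists_eq (h : IsTrivialExt ε l) (r : R) (b : B) : ∃ s, ε s = r ∧ l s = b := by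
  obtain ⟨s, hs⟩ := h.bijective.2 (r, b)
  exact ⟨s, congrArg Prod.fst hs, congrArg Prod.snd hs⟩

theorem map_one (h : IsTrivialExt ε l) : l 1 = 0 := by
  have := h.mul 1 1
  simpa using this

theorem mul_eq_zero (h : IsTrivialExt ε l) {s t : S} (hs : ε s = 0) (ht : ε t = 0) :
    s * t = 0 := by
  refine h.ext ?_ ?_
  · simp [hs]
  · simp [h.mul, hs, ht]

theorem isPerfectForm (h : IsTrivialExt ε l) (hB : IsSemidualizing R B) : IsPerfectForm l := by
  constructor
  · rw [injective_iff_map_eq_zero]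
    intro s hs
    have h1 : ∀ t, l (t * s) = 0 := fun t => congrArg (fun f => CoindHom.toHom f t) hs
    have h2 : l s = 0 := by simpa using h1 1
    refine h.ext ?_ (by simpa using h2)
    rw [map_zero]
    refine hB.homothety_bijective.1 (LinearMap.ext fun b => ?_)
    obtain ⟨t, ht, rfl⟩ := h.exists_eq 0 b
    simpa [h.mul, ht] using h1 t
  · intro f
    let j : B →ₗ[R] S := h.equiv.symm.toLinearMap ∘ₗ LinearMap.inr R R B
    have hj : ∀ b, h.equiv (j b) = (0, b) := fun b => h.equiv.apply_symm_apply _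
    obtain ⟨r, hr⟩ := hB.homothety_bijective.2 (CoindHom.toHom f ∘ₗ j)
    obtain ⟨s, hs, hs'⟩ := h.exists_eq r (CoindHom.toHom f 1)
    refine ⟨s, ?_⟩
    ext t
    have ht : t = ε t • 1 + j (l t) := by
      have h1 : ε (j (l t)) = 0 := congrArg Prod.fst (hj (l t))
      have h2 : l (j (l t)) = l t := congrArg Prod.snd (hj (l t))
      refine h.ext ?_ ?_
      · simp [h1]
      · simp [h2, h.map_one]
    have h3 : r • l t = CoindHom.toHom f (j (l t)) := LinearMap.congr_fun hr (l t)
    conv_rhs => rw [ht, map_add, map_smul, ← h3, ← hs']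
    rw [CoindHom.toHom_curry_apply, smul_eq_mul, h.mul, hs]

theorem finite (h : IsTrivialExt ε l) [Module.Finite R B] : Module.Finite R S :=
  Module.Finite.equiv h.equiv.symm

theorem isNoetherianRing (h : IsTrivialExt ε l) [IsNoetherianRing R] [Module.Finite R B] :
    IsNoetherianRing S := by
  have := h.finite
  exact IsNoetherianRing.of_finite R S

theorem extAcyclic (h : IsTrivialExt ε l) {N : Type u} [AddCommGroup N] [Module R N]
    (hN : ExtAcyclic R B N) : ExtAcyclic R S N :=
  ((extAcyclic_of_projective R N).prod hN).of_equiv h.equiv.symm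

theorem surjective (h : IsTrivialExt ε l) : Function.Surjective ε := fun r => by
  obtain ⟨s, hs, -⟩ := h.exists_eq r 0
  exact ⟨s, hs⟩

theorem isLocalRing (h : IsTrivialExt ε l) [IsLocalRing R] : IsLocalRing S := by
  have : IsLocalHom ε.toRingHom := by
    refine ⟨fun s hs => ?_⟩
    have hs' : IsUnit (algebraMap R S (ε s)) := RingHom.isUnit_map _ hs
    have hn : IsNilpotent (s - algebraMap R S (ε s)) :=
      ⟨2, by rw [sq]; exact h.mul_eq_zero (by simp) (by simp)⟩
    have := hn.isUnit_add_left_of_commute hs' (Commute.all _ _)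
    simpa using this
  exact RingHom.domain_isLocalRing ε.toRingHom

theorem ringKrullDim_eq (h : IsTrivialExt ε l) : ringKrullDim S = ringKrullDim R := by
  refine le_antisymm ?_ (ringKrullDim_le_of_surjective ε.toRingHom h.surjective)
  rw [← ringKrullDim_eq_of_ringEquiv (RingHom.quotientKerEquivOfSurjective h.surjective),
    ringKrullDim_quotient]
  have hz : PrimeSpectrum.zeroLocus (RingHom.ker ε : Set S) = Set.univ := by
    rw [Set.eq_univ_iff_forall]
    intro p x hx
    have : x * x = 0 := h.mul_eq_zero hx hx
    exact (or_self_iff).1 (p.2.mem_or_mem (this ▸ p.asIdeal.zero_mem))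
  change Order.krullDim (PrimeSpectrum S) ≤ _
  refine Order.krullDim_le_of_strictMono
    (fun p => (⟨p, hz ▸ Set.mem_univ p⟩ : PrimeSpectrum.zeroLocus (RingHom.ker ε : Set S)))
    fun p q hpq => hpq

theorem isCohenMacaulayLocal (h : IsTrivialExt ε l) (hR : IsCohenMacaulayLocal R)
    (hB : IsSemidualizing R B) : IsCohenMacaulayLocal S := by
  have := hR.isNoetherianRing
  have := hR.isLocalRing
  have := hB.finite
  have hS := h.isLocalRing
  have hS' := h.isNoetherianRing
  refine ⟨hS', hS, le_antisymm localDepth_le_ringKrullDim ?_⟩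
  rw [h.ringKrullDim_eq, ← hR.depth_eq_dim, WithBot.coe_le_coe]
  refine iSup_le fun rs => ?_
  have hreg : RingTheory.Sequence.IsRegular S (rs.1.map (algebraMap R S)) := by
    refine ⟨?_, ?_⟩
    · rw [RingTheory.Sequence.isWeaklyRegular_map_algebraMap_iff]
      exact (h.equiv.isWeaklyRegular_congr rs.1).2
        (rs.2.toIsWeaklyRegular.prod (hB.isWeaklyRegular rs.2.toIsWeaklyRegular))
    · intro htop
      refine rs.2.top_ne_smul ?_
      rw [smul_eq_mul, Ideal.mul_top] at htop ⊢
      have h2 := congrArg (Ideal.map ε.toRingHom) htop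
      rw [Ideal.map_top, Ideal.map_ofList, List.map_map] at h2
      rw [h2]
      congr 1
      conv_rhs => rw [← List.map_id rs.1]
      refine List.map_congr_left fun r _ => ?_
      simp
  refine le_trans (le_of_eq ?_) (le_iSup (fun rs : {rs : List S //
    RingTheory.Sequence.IsRegular S rs} => (rs.1.length : ℕ∞)) ⟨_, hreg⟩)
  simp

theorem not_isGorensteinLocal (h : IsTrivialExt ε l) (hB : IsSemidualizing R B)
    (hB' : ¬ IsDualizing R B) : ¬ IsGorensteinLocal S := fun hS =>
  hB' ⟨hB, (h.isPerfectForm hB).injectiveDimension_ne_top (h.extAcyclic hB.ext_eq_zero) ε hS⟩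

end IsTrivialExt

/-! ### Perfect pairings of modules without higher extensions into the ring -/

/-- A perfect pairing between finitely generated modules with `Ext^i(·, S) = 0` for `i ≥ 1`. -/
structure IsReflexivePair {S G H : Type u} [CommRing S] [AddCommGroup G] [AddCommGroup H]
    [Module S G] [Module S H] (p : G →ₗ[S] H →ₗ[S] S) : Prop where
  finite_left : Module.Finite S G
  finite_right : Module.Finite S H
  bijective : Function.Bijective p
  bijective_flip : Function.Bijective p.flip
  ext_left : ExtAcyclic S G S
  ext_right : ExtAcyclic S H S

namespace IsReflexivePair

variable {S G H : Type u} [CommRing S] [AddCommGroup G] [AddCommGroup H]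
  [Module S G] [Module S H] {p : G →ₗ[S] H →ₗ[S] S}

theorem symm (h : IsReflexivePair p) : IsReflexivePair p.flip :=
  ⟨h.finite_right, h.finite_left, h.bijective_flip, h.bijective, h.ext_right, h.ext_left⟩

variable {K X : Type u} [AddCommGroup K] [AddCommGroup X] [Module S K] [Module S X]
  {f : K →ₗ[S] X} {g : X →ₗ[S] G}

/-- The dual of a presentation of `G` is a short exact sequence `0 → H → X^* → K^* → 0`. -/
theorem dual_ses (h : IsReflexivePair p) (hs : IsSES f g) :
    IsSES (LinearMap.lcomp S S g ∘ₗ p.flip) (LinearMap.lcomp S S f) where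
  inj := (hs.dual (h.ext_left 1 le_rfl)).inj.comp h.bijective_flip.1
  exact φ := by
    rw [(hs.dual (h.ext_left 1 le_rfl)).exact φ]
    exact (h.bijective_flip.2.range_comp (LinearMap.lcomp S S g)).symm ▸ Iff.rfl
  surj := (hs.dual (h.ext_left 1 le_rfl)).surj

theorem syzygy [IsNoetherianRing S] (h : IsReflexivePair p) [Module.Finite S X]
    [Module.Free S X] (hs : IsSES f g) :
    IsReflexivePair (LinearMap.applyₗ : K →ₗ[S] (K →ₗ[S] S) →ₗ[S] S) := by
  have hK : Module.Finite S K := Module.Finite.of_injective f hs.inj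
  have hd := h.dual_ses hs
  have hX : Function.Bijective (LinearMap.applyₗ : X →ₗ[S] (X →ₗ[S] S) →ₗ[S] S) := by
    exact Module.bijective_dual_eval S X
  refine ⟨hK, inferInstance, ⟨?_, ?_⟩, ?_,
    hs.extAcyclic_left (extAcyclic_of_projective _ _) h.ext_left, ?_⟩
  · rw [injective_iff_map_eq_zero]
    intro k hk
    refine hs.inj ?_
    rw [map_zero]
    refine hX.1 ?_
    ext φ
    have := LinearMap.congr_fun hk (φ ∘ₗ f)
    simpa using this
  · intro Φ
    obtain ⟨x, hx⟩ := hX.2 (Φ ∘ₗ LinearMap.lcomp S S f)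
    have hx' : ∀ φ : X →ₗ[S] S, φ x = Φ (φ ∘ₗ f) := fun φ => LinearMap.congr_fun hx φ
    have hg : g x = 0 := by
      refine h.bijective.1 ?_
      ext y
      rw [map_zero]
      have := hx' (p.flip y ∘ₗ g)
      have h0 : (p.flip y ∘ₗ g) ∘ₗ f = 0 := by
        ext k; simp [hs.comp_eq_zero]
      rw [h0, map_zero] at this
      exact this
    obtain ⟨k, rfl⟩ := (hs.exact x).1 hg
    refine ⟨k, ?_⟩
    ext ψ
    obtain ⟨φ, rfl⟩ := hd.surj ψ
    exact hx' φ
  · have : (LinearMap.applyₗ : K →ₗ[S] (K →ₗ[S] S) →ₗ[S] S).flip = LinearMap.id := by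
      ext; simp
    rw [this]
    exact Function.bijective_id
  · refine hd.extAcyclic_right (extAcyclic_of_projective _ _) h.ext_right fun φ => ?_
    obtain ⟨y, rfl⟩ := h.bijective.2 φ
    obtain ⟨x, rfl⟩ := hs.surj y
    exact ⟨LinearMap.applyₗ x, fun k => rfl⟩

end IsReflexivePair

/-- A member of a perfect pairing as in `IsReflexivePair`. -/
def IsReflexiveModule {S : Type u} [CommRing S] (G : ModuleCat.{u} S) : Prop :=
  ∃ (H : ModuleCat.{u} S) (p : G →ₗ[S] H →ₗ[S] S), IsReflexivePair p

/-- There is a short exact sequence `0 → K → X → G → 0` with `X` finitely generated and free. -/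
def IsSyzygyOf {S : Type u} [CommRing S] (K G : ModuleCat.{u} S) : Prop :=
  ∃ (X : ModuleCat.{u} S) (f : K →ₗ[S] X) (g : X →ₗ[S] G), Module.Finite S X ∧ Module.Free S X ∧
    IsSES f g

namespace IsReflexiveModule

variable {S : Type u} [CommRing S] [IsNoetherianRing S] {G : ModuleCat.{u} S}

theorem exists_syzygy (h : IsReflexiveModule G) :
    ∃ K : ModuleCat.{u} S, IsReflexiveModule K ∧ IsSyzygyOf K G := by
  obtain ⟨H, p, hp⟩ := h
  have := hp.finite_left
  obtain ⟨n, K, _, _, _, f, g, hs⟩ := exists_finite_syzygy S G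
  exact ⟨ModuleCat.of S K, ⟨ModuleCat.of S (K →ₗ[S] S), _, hp.syzygy hs⟩,
    ModuleCat.of S (Fin n → S), f, g, inferInstanceAs (Module.Finite S (Fin n → S)),
    inferInstanceAs (Module.Free S (Fin n → S)), hs⟩

theorem exists_cosyzygy (h : IsReflexiveModule G) :
    ∃ K : ModuleCat.{u} S, IsReflexiveModule K ∧ IsSyzygyOf G K := by
  obtain ⟨H, p, hp⟩ := h
  have := hp.finite_right
  obtain ⟨n, K, _, _, _, f, g, hs⟩ := exists_finite_syzygy S H
  exact ⟨ModuleCat.of S (K →ₗ[S] S), ⟨ModuleCat.of S K, _, (hp.symm.syzygy hs).symm⟩,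
    ModuleCat.of S ((Fin n → S) →ₗ[S] S), _, _,
    inferInstanceAs (Module.Finite S ((Fin n → S) →ₗ[S] S)),
    inferInstanceAs (Module.Free S ((Fin n → S) →ₗ[S] S)), hp.symm.dual_ses hs⟩

end IsReflexiveModule

theorem exists_int_chain {α : Type*} (P : α → Prop) (r : α → α → Prop)
    (hl : ∀ a, P a → ∃ b, P b ∧ r b a) (hr : ∀ a, P a → ∃ b, P b ∧ r a b) (a : α) (ha : P a) :
    ∃ Z : ℤ → α, Z 0 = a ∧ (∀ i, P (Z i)) ∧ ∀ i, r (Z (i + 1)) (Z i) := by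
  choose! s hs hs' using hl
  choose! t ht ht' using hr
  have hu : ∀ n, P (s^[n] a) := fun n => by
    induction n with
    | zero => exact ha
    | succ n ih => rw [Function.iterate_succ_apply']; exact hs _ ih
  have hv : ∀ n, P (t^[n] a) := fun n => by
    induction n with
    | zero => exact ha
    | succ n ih => rw [Function.iterate_succ_apply']; exact ht _ ih
  let Z : ℤ → α := fun i => match i with
    | Int.ofNat n => s^[n] a
    | Int.negSucc n => t^[n + 1] a
  refine ⟨Z, rfl, ?_, ?_⟩
  · rintro (n | n)
    · exact hu n
    · exact hv (n + 1)
  · rintro (n | _ | n)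
    · change r (s^[n + 1] a) (s^[n] a)
      rw [Function.iterate_succ_apply']
      exact hs' _ (hu n)
    · change r a (t a)
      exact ht' a ha
    · have : Int.negSucc (n + 1) + 1 = Int.negSucc n := by omega
      rw [this]
      change r (t^[n + 1] a) (t^[n + 1 + 1] a)
      rw [Function.iterate_succ_apply' t (n + 1)]
      exact ht' _ (hv _)

/-- A two-sided sequence of short exact sequences `0 → Z_{i+1} → X_i → Z_i → 0` with `X_i` finitely
generated and free. -/
structure SyzygyFamily (S : Type u) [CommRing S] where
  Z : ℤ → ModuleCat.{u} S
  X : ℤ → ModuleCat.{u} S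
  ι : ∀ i, Z (i + 1) →ₗ[S] X i
  π : ∀ i, X i →ₗ[S] Z i
  finite : ∀ i, Module.Finite S (X i)
  free : ∀ i, Module.Free S (X i)
  ses : ∀ i, IsSES (ι i) (π i)

theorem IsReflexiveModule.exists_family {S : Type u} [CommRing S] [IsNoetherianRing S]
    {G : ModuleCat.{u} S} (h : IsReflexiveModule G) :
    ∃ F : SyzygyFamily S, F.Z 0 = G ∧ ∀ i, IsReflexiveModule (F.Z i) := by
  obtain ⟨Z, hZ, hZ', hr⟩ := exists_int_chain IsReflexiveModule IsSyzygyOf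
    (fun _ => exists_syzygy) (fun _ => exists_cosyzygy) G h
  choose X f g h1 h2 h3 using hr
  exact ⟨⟨Z, X, f, g, h1, h2, h3⟩, hZ, hZ'⟩

/-! ### Exactness of complexes of modules in terms of elements -/

section Complex

variable {S : Type u} [CommRing S]

theorem exactAt_succ_iff (X : ChainComplex (ModuleCat.{u} S) ℤ) (j : ℤ) :
    X.ExactAt (j + 1) ↔
      Function.Exact (X.d (j + 1 + 1) (j + 1)).hom (X.d (j + 1) j).hom := by
  rw [X.exactAt_iff' (j + 1 + 1) (j + 1) j (ComplexShape.prev_eq' _ rfl)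
    (ComplexShape.next_eq' _ rfl), ShortComplex.ShortExact.moduleCat_exact_iff_function_exact]
  rfl

theorem tensorComplex_exactAt_succ_iff (X : ChainComplex (ModuleCat.{u} S) ℤ)
    (N : ModuleCat.{u} S) (j : ℤ) :
    (tensorComplex X N).ExactAt (j + 1) ↔
      Function.Exact ((X.d (j + 1 + 1) (j + 1)).hom.rTensor N)
        ((X.d (j + 1) j).hom.rTensor N) := by
  rw [exactAt_succ_iff]
  rfl

theorem homComplex_exactAt_succ_iff (X : ChainComplex (ModuleCat.{u} S) ℤ)
    (N : ModuleCat.{u} S) (j : ℤ) :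
    (homComplex X N).ExactAt (j + 1) ↔
      ∀ φ : X.X (j + 1) →ₗ[S] N, (∀ x, φ ((X.d (j + 1 + 1) (j + 1)).hom x) = 0) →
        ∃ ψ : X.X j →ₗ[S] N, ∀ x, ψ ((X.d (j + 1) j).hom x) = φ x := by
  rw [(homComplex X N).exactAt_iff' j (j + 1) (j + 1 + 1) (ComplexShape.prev_eq' _ rfl)
    (ComplexShape.next_eq' _ rfl), ShortComplex.moduleCat_exact_iff]
  constructor
  · intro h φ hφ
    obtain ⟨ψ, hψ⟩ := h (ModuleCat.ofHom φ)
      (show (X.d (j + 1 + 1) (j + 1) ≫ ModuleCat.ofHom φ : X.X (j + 1 + 1) ⟶ N) = 0 from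
        ModuleCat.hom_ext (LinearMap.ext hφ))
    exact ⟨ModuleCat.Hom.hom (show X.X j ⟶ N from ψ), fun x =>
      congrArg (fun t : X.X (j + 1) ⟶ N => t.hom x) hψ⟩
  · intro h φ hφ
    obtain ⟨ψ, hψ⟩ := h (ModuleCat.Hom.hom (show X.X (j + 1) ⟶ N from φ)) fun x =>
      congrArg (fun t : X.X (j + 1 + 1) ⟶ N => t.hom x) hφ
    exact ⟨(ModuleCat.ofHom ψ : X.X j ⟶ N),
      show (X.d (j + 1) j ≫ ModuleCat.ofHom ψ : X.X (j + 1) ⟶ N) = φ from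
        ModuleCat.hom_ext (LinearMap.ext hψ)⟩

end Complex

namespace SyzygyFamily

variable {S : Type u} [CommRing S] (F : SyzygyFamily S)

/-- The exact complex that is spliced from the short exact sequences of the family. -/
def complex : ChainComplex (ModuleCat.{u} S) ℤ :=
  ChainComplex.of F.X (fun i => ModuleCat.ofHom (F.ι i ∘ₗ F.π (i + 1))) fun i => by
    ext x
    simp [(F.ses (i + 1)).comp_eq_zero]

theorem complex_d (i : ℤ) :
    F.complex.d (i + 1) i = ModuleCat.ofHom (F.ι i ∘ₗ F.π (i + 1)) :=
  ChainComplex.of_d F.X (fun i => ModuleCat.ofHom (F.ι i ∘ₗ F.π (i + 1))) i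

theorem forall_int_of_succ {P : ℤ → Prop} (h : ∀ i, P (i + 1)) (i : ℤ) : P i := by
  have := h (i - 1)
  rwa [sub_add_cancel] at this

theorem complex_exactAt (i : ℤ) : F.complex.ExactAt i := by
  refine forall_int_of_succ (fun j => ?_) i
  rw [exactAt_succ_iff, complex_d, complex_d]
  intro x
  have h1 : F.ι j (F.π (j + 1) x) = 0 ↔ F.π (j + 1) x = 0 :=
    map_eq_zero_iff _ (F.ses j).inj
  refine h1.trans (((F.ses (j + 1)).exact x).trans ?_)
  constructor
  · rintro ⟨z, rfl⟩
    obtain ⟨y, rfl⟩ := (F.ses (j + 1 + 1)).surj z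
    exact ⟨y, rfl⟩
  · rintro ⟨y, rfl⟩
    exact ⟨_, rfl⟩

theorem homComplex_exactAt (N : ModuleCat.{u} S)
    (hN : ∀ i (φ : F.Z (i + 1) →ₗ[S] N), ∃ ψ : F.X i →ₗ[S] N, ∀ z, ψ (F.ι i z) = φ z) (i : ℤ) :
    (homComplex F.complex N).ExactAt i := by
  refine forall_int_of_succ (fun j => ?_) i
  rw [homComplex_exactAt_succ_iff, complex_d, complex_d]
  intro φ hφ
  obtain ⟨ψ, hψ⟩ := (F.ses (j + 1)).exists_desc φ fun z => by
    obtain ⟨y, rfl⟩ := (F.ses (j + 1 + 1)).surj z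
    exact hφ y
  obtain ⟨θ, hθ⟩ := hN j ψ
  exact ⟨θ, fun x => (hθ _).trans (hψ x)⟩

theorem complex_isTotallyAcyclic (hF : ∀ i, ExtZero S (F.Z i) S 1) :
    IsTotallyAcyclic F.complex where
  finite := F.finite
  free := F.free
  exact := F.complex_exactAt
  exact_dual := F.homComplex_exactAt _ fun i φ => (F.ses i).extend (hF i) φ

theorem isTotallyReflexive (hF : ∀ i, ExtZero S (F.Z i) S 1) : IsTotallyReflexive (F.Z 0) := by
  refine ⟨F.complex, F.complex_isTotallyAcyclic hF, ?_⟩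
  have h0 : F.complex.d 1 0 ≫ ModuleCat.ofHom (F.π 0) = 0 := by
    change F.complex.d (0 + 1) 0 ≫ _ = 0
    rw [F.complex_d 0]
    ext x
    exact (F.ses 0).comp_eq_zero _
  have hex : (ShortComplex.mk _ _ h0).Exact := by
    rw [ShortComplex.ShortExact.moduleCat_exact_iff_function_exact]
    change Function.Exact (F.complex.d (0 + 1) 0).hom (F.π 0)
    rw [F.complex_d 0]
    intro x
    refine ((F.ses 0).exact x).trans ?_
    constructor
    · rintro ⟨z, rfl⟩
      obtain ⟨y, rfl⟩ := (F.ses (0 + 1)).surj z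
      exact ⟨y, rfl⟩
    · rintro ⟨y, rfl⟩
      exact ⟨_, rfl⟩
  have : Epi (ShortComplex.mk _ _ h0).g := (ModuleCat.epi_iff_surjective _).2 (F.ses 0).surj
  exact ⟨hex.gIsCokernel.coconePointUniqueUpToIso (colimit.isColimit _)⟩

end SyzygyFamily

theorem IsReflexiveModule.isTotallyReflexive {S : Type u} [CommRing S] [IsNoetherianRing S]
    {G : ModuleCat.{u} S} (h : IsReflexiveModule G) : IsTotallyReflexive G := by
  obtain ⟨F, rfl, hF⟩ := h.exists_family
  refine F.isTotallyReflexive fun i => ?_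
  obtain ⟨H, p, hp⟩ := hF i
  exact hp.ext_left 1 le_rfl

theorem IsTotallyReflexive.of_isZero {S : Type u} [CommRing S] {G : ModuleCat.{u} S}
    (h : IsZero G) : IsTotallyReflexive G := by
  have h0 : ∀ i, Subsingleton (((HomologicalComplex.zero :
      ChainComplex (ModuleCat.{u} S) ℤ)).X i) := fun i =>
    ModuleCat.isZero_iff_subsingleton.1 (isZero_zero _)
  refine ⟨HomologicalComplex.zero, ⟨fun i => ?_, fun i => ?_, fun i => ?_, fun i => ?_⟩, ⟨?_⟩⟩
  · have := h0 i; infer_instance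
  · have := h0 i; infer_instance
  · refine SyzygyFamily.forall_int_of_succ (fun j => ?_) i
    rw [exactAt_succ_iff]
    have := h0 (j + 1)
    intro x
    exact ⟨fun _ => ⟨0, Subsingleton.elim _ _⟩, fun _ => by rw [Subsingleton.elim x 0, map_zero]⟩
  · refine SyzygyFamily.forall_int_of_succ (fun j => ?_) i
    rw [homComplex_exactAt_succ_iff]
    have := h0 (j + 1)
    exact fun φ _ => ⟨0, fun x => by rw [Subsingleton.elim x 0]; simp⟩
  · refine h.iso ?_
    exact IsZero.of_epi (cokernel.π _) (isZero_zero (ModuleCat.{u} S))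

theorem IsTotallyReflexive.gdim_lt_top {S : Type u} [CommRing S] {G : ModuleCat.{u} S}
    (h : IsTotallyReflexive G) : gdim G < ⊤ := by
  have : HasTotallyReflexiveResolution G 0 := by
    refine ⟨(ChainComplex.single₀ _).obj G, 𝟙 _, fun i => ?_, fun i hi => ?_, inferInstance⟩
    · rcases Nat.eq_zero_or_pos i with rfl | hi
      · exact h
      · exact .of_isZero (HomologicalComplex.isZero_single_obj_X _ _ _ _ hi.ne')
    · exact HomologicalComplex.isZero_single_obj_X _ _ _ _ hi.ne'
  refine lt_of_le_of_lt (iInf₂_le 0 this) ?_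
  simp

/-! ### `R` is totally reflexive over `R ⋉ B` -/

section

variable {R S B : Type u} [CommRing R] [CommRing S] [Algebra R S] [AddCommGroup B]
  [Module R B] {ε : S →ₐ[R] R} {l : S →ₗ[R] B}

theorem IsTrivialExt.isReflexiveModule (h : IsTrivialExt ε l) (hB : IsSemidualizing R B) :
    IsReflexiveModule ((ModuleCat.restrictScalars (ε : S →+* R)).obj (ModuleCat.of R R)) := by
  let _ : Module S R := Module.compHom R (ε : S →+* R)
  have hsR : ∀ (s : S) (r : R), s • r = ε s * r := fun _ _ => rfl
  let _ : Module S B := Module.compHom B (ε : S →+* R)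
  have hsB : ∀ (s : S) (b : B), s • b = ε s • b := fun _ _ => rfl
  have tR : IsScalarTower R S R := ⟨fun r s x => by simp [hsR, mul_assoc]⟩
  have tB : IsScalarTower R S B := ⟨fun r s x => by simp [hsB, mul_smul]⟩
  have hS := h.extAcyclic hB.ext_eq_zero
  have hl := h.isPerfectForm hB
  have hj : ∀ b, h.equiv (h.equiv.symm (0, b)) = (0, b) := fun b => h.equiv.apply_symm_apply _
  have hj1 : ∀ b, ε (h.equiv.symm (0, b)) = 0 := fun b => congrArg Prod.fst (hj b)
  have hj2 : ∀ b, l (h.equiv.symm (0, b)) = b := fun b => congrArg Prod.snd (hj b)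
  let j : B →ₗ[S] S :=
    { toFun := fun b => h.equiv.symm (0, b)
      map_add' := fun x y => by rw [← map_add, Prod.mk_add_mk, add_zero]
      map_smul' := fun s x => h.ext
        (by simp [hj1]) (by simp [hj2, h.mul, hj1, hsB]) }
  have hj1 : ∀ b, ε (j b) = 0 := hj1
  have hj2 : ∀ b, l (j b) = b := hj2
  have hj3 : ∀ s, ε s = 0 → s = j (l s) := fun s hs => h.ext (by rw [hs, hj1]) (hj2 _).symm
  have hj4 : ∀ s, (∀ b, j b * s = 0) → ε s = 0 := fun s hs => by
    refine hB.homothety_bijective.1 (LinearMap.ext fun b => ?_)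
    have := congrArg l (hs b)
    simpa [h.mul, hj1, hj2] using this
  let p : R →ₗ[S] B →ₗ[S] S := LinearMap.mk₂ S (fun r b => j (r • b))
    (fun r r' b => by rw [add_smul, map_add])
    (fun s r b => by rw [hsR, mul_smul, ← hsB, map_smul])
    (fun r b b' => by rw [smul_add, map_add])
    (fun s r b => by rw [hsB, smul_comm, ← hsB, map_smul])
  have hp : ∀ r b, p r b = j (r • b) := fun _ _ => rfl
  have hfin := hB.finite
  have hfS : Module.Finite S B := Module.Finite.of_restrictScalars_finite R S B
  have hfR : Module.Finite S R := Module.Finite.of_restrictScalars_finite R S R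
  have : IsReflexivePair p := by
    refine ⟨hfR, hfS, ⟨?_, ?_⟩, ⟨?_, ?_⟩,
      ((extAcyclic_coindHom_iff hS R).2 (extAcyclic_of_projective R B)).of_equiv_right
        hl.equiv.symm,
      ((extAcyclic_coindHom_iff hS B).2 hB.ext_eq_zero).of_equiv_right hl.equiv.symm⟩
    · intro r r' hr
      refine hB.homothety_bijective.1 (LinearMap.ext fun b => ?_)
      have := congrArg l (LinearMap.congr_fun hr b)
      simpa [hp, hj2] using this
    · intro φ
      have h1 : ∀ b, ε (φ b) = 0 := fun b => hj4 _ fun b' => by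
        rw [← smul_eq_mul, ← map_smul, hsB, hj1, zero_smul, map_zero]
      obtain ⟨r, hr⟩ := hB.homothety_bijective.2 (l ∘ₗ φ.restrictScalars R)
      refine ⟨r, LinearMap.ext fun b => ?_⟩
      have h2 : r • b = l (φ b) := LinearMap.congr_fun hr b
      rw [hp, h2, ← hj3 _ (h1 b)]
    · intro b b' hb
      have := congrArg l (LinearMap.congr_fun hb (1 : R))
      simpa [hp, hj2] using this
    · intro φ
      have h1 : ε (φ 1) = 0 := hj4 _ fun b' => by
        rw [← smul_eq_mul, ← map_smul, hsR, hj1, zero_mul, map_zero]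
      refine ⟨l (φ 1), LinearMap.ext fun r => ?_⟩
      obtain ⟨s, rfl⟩ := h.surjective r
      have h2 : ε s = s • (1 : R) := by rw [hsR, mul_one]
      rw [LinearMap.flip_apply, hp, ← hsB, map_smul, ← hj3 _ h1, ← map_smul, ← h2]
  exact ⟨ModuleCat.of S B, p, this⟩

end

/-! ### Vanishing of `Tor_1` -/

section TorOne

variable {S : Type u} [CommRing S]

/-- `Tor_1^S(M, N) = 0`: tensoring with `N` preserves injectivity of maps with cokernel `M`. -/
def TorOneZero (S M N : Type u) [CommRing S] [AddCommGroup M] [AddCommGroup N] [Module S M]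
    [Module S N] : Prop :=
  ∀ (K X : Type u) [AddCommGroup K] [AddCommGroup X] [Module S K] [Module S X] (f : K →ₗ[S] X)
    (g : X →ₗ[S] M), IsSES f g → Function.Injective (f.rTensor N)

variable {K X M N M' : Type u} [AddCommGroup K] [AddCommGroup X] [AddCommGroup M]
  [AddCommGroup N] [AddCommGroup M'] [Module S K] [Module S X] [Module S M] [Module S N]
  [Module S M'] {f : K →ₗ[S] X} {g : X →ₗ[S] M}

theorem IsSES.torOneZero (h : IsSES f g) [Module.Projective S X]
    (hf : Function.Injective (f.rTensor N)) : TorOneZero S M N := by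
  intro K' X' _ _ _ _ f' g' h'
  obtain ⟨a, ha⟩ := Module.projective_lifting_property g' g h'.surj
  have ha' : ∀ x, g' (a x) = g x := fun x => LinearMap.congr_fun ha x
  obtain ⟨b, hb⟩ := h'.exists_lift (a ∘ₗ f) fun k => by
    rw [LinearMap.comp_apply, ha', h.comp_eq_zero]
  have hs : Function.Exact (b.prod (-f)) (f'.coprod a) := by
    rintro ⟨k, x⟩
    constructor
    · intro hx
      have hx' : f' k + a x = 0 := hx
      have h1 : g x = 0 := by
        rw [← ha', eq_neg_of_add_eq_zero_right hx', map_neg, h'.comp_eq_zero, neg_zero]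
      obtain ⟨y, rfl⟩ := (h.exact x).1 h1
      refine ⟨-y, Prod.ext (h'.inj ?_) (by simp)⟩
      change f' (b (-y)) = f' k
      rw [hb, LinearMap.comp_apply, map_neg, map_neg, eq_comm]
      exact eq_neg_of_add_eq_zero_left hx'
    · rintro ⟨y, hy⟩
      rw [← hy]
      change f' (b y) + a (-f y) = 0
      rw [hb, map_neg]
      simp
  have hsurj : Function.Surjective (f'.coprod a) := fun x => by
    obtain ⟨y, hy⟩ := h.surj (g' x)
    obtain ⟨k, hk⟩ := (h'.exact (x - a y)).1 (by rw [map_sub, ha', hy, sub_self])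
    exact ⟨(k, y), by simp [hk]⟩
  rw [injective_iff_map_eq_zero]
  intro t ht
  have h1 : (f'.coprod a).rTensor N ((LinearMap.inl S K' X).rTensor N t) = 0 := by
    rw [← LinearMap.rTensor_comp_apply, LinearMap.coprod_inl, ht]
  obtain ⟨s, hs'⟩ := (rTensor_exact N hs hsurj _).1 h1
  have h2 := congrArg ((LinearMap.snd S K' X).rTensor N) hs'
  have h3 := congrArg ((LinearMap.fst S K' X).rTensor N) hs'
  rw [← LinearMap.rTensor_comp_apply, ← LinearMap.rTensor_comp_apply] at h2 h3
  rw [LinearMap.snd_prod, LinearMap.snd_comp_inl, LinearMap.rTensor_zero, LinearMap.zero_apply,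
    LinearMap.rTensor_neg, LinearMap.neg_apply, neg_eq_zero] at h2
  rw [LinearMap.fst_prod, LinearMap.fst_comp_inl, LinearMap.rTensor_id_apply] at h3
  rw [← h3, hf (h2.trans (map_zero _).symm), map_zero]

theorem TorOneZero.of_equiv (e : M ≃ₗ[S] M') (h : TorOneZero S M N) : TorOneZero S M' N := by
  intro K X _ _ _ _ f g hs
  refine h K X f (e.symm.toLinearMap ∘ₗ g) ⟨hs.inj, fun x => ?_, e.symm.surjective.comp hs.surj⟩
  rw [← hs.exact x]
  simp

theorem IsSES.prodMap_id (h : IsSES f g) (F : Type*) [AddCommGroup F] [Module S F] :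
    IsSES (LinearMap.inl S X F ∘ₗ f) (g.prodMap (LinearMap.id : F →ₗ[S] F)) := by
  refine ⟨LinearMap.inl_injective.comp h.inj, ?_, h.surj.prodMap Function.surjective_id⟩
  rintro ⟨x, y⟩
  constructor
  · intro hx
    obtain ⟨k, hk⟩ := (h.exact x).1 (congrArg Prod.fst hx)
    exact ⟨k, Prod.ext hk (congrArg Prod.snd hx).symm⟩
  · rintro ⟨k, hk⟩
    rw [← hk]
    simp [h.comp_eq_zero]

theorem TorOneZero.of_prod (h : TorOneZero S (M × M') N) : TorOneZero S M N := by
  intro K X _ _ _ _ f g hs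
  have h1 := hs.prodMap_id M'
  have h2 := h _ _ _ _ h1
  rw [LinearMap.rTensor_comp] at h2
  exact Function.Injective.of_comp h2

theorem TorOneZero.prod [Module.Projective S M'] (h : TorOneZero S M N) :
    TorOneZero S (M × M') N := by
  obtain ⟨K, _, _, f, g, hs⟩ := exists_free_presentation S M
  have h1 := hs.prodMap_id M'
  refine h1.torOneZero ?_
  rw [LinearMap.rTensor_comp, LinearMap.coe_comp]
  refine Function.Injective.comp ?_ (h _ _ _ _ hs)
  refine Function.LeftInverse.injective (g := (LinearMap.fst S (M →₀ S) M').rTensor N) fun t => ?_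
  rw [← LinearMap.rTensor_comp_apply, LinearMap.fst_comp_inl, LinearMap.rTensor_id_apply]

theorem TorOneZero.symm (h : TorOneZero S M N) : TorOneZero S N M := by
  obtain ⟨K, _, _, f, g, hs⟩ := exists_free_presentation S M
  obtain ⟨L, _, _, i, q, hq⟩ := exists_free_presentation S N
  refine hq.torOneZero ?_
  rw [injective_iff_map_eq_zero]
  intro t ht
  obtain ⟨t, rfl⟩ := LinearMap.lTensor_surjective L hs.surj t
  have e1 : g.lTensor _ (i.rTensor _ t) = 0 := by
    rw [← ht]
    exact LinearMap.congr_fun ((LinearMap.lTensor_comp_rTensor _ _ _).trans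
      (LinearMap.rTensor_comp_lTensor _ _ _).symm) t
  obtain ⟨y, hy⟩ := (lTensor_exact _ hs.exact hs.surj _).1 e1
  have e2 : f.lTensor N (q.rTensor K y) = 0 := by
    have h1 : f.lTensor N (q.rTensor K y) = q.rTensor _ (f.lTensor _ y) :=
      LinearMap.congr_fun ((LinearMap.lTensor_comp_rTensor _ _ _).trans
        (LinearMap.rTensor_comp_lTensor _ _ _).symm) y
    rw [h1, hy, ← LinearMap.rTensor_comp_apply,
      show q ∘ₗ i = 0 from LinearMap.ext hq.comp_eq_zero]
    simp
  have hf : Function.Injective (f.lTensor N) := by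
    rw [LinearMap.lTensor_inj_iff_rTensor_inj]
    exact h _ _ _ _ hs
  have e3 : q.rTensor K y = 0 := hf (e2.trans (map_zero _).symm)
  obtain ⟨z, rfl⟩ := (rTensor_exact _ hq.exact hq.surj _).1 e3
  have e4 : i.rTensor _ (f.lTensor _ z) = i.rTensor _ t := by
    rw [← hy]
    exact LinearMap.congr_fun ((LinearMap.lTensor_comp_rTensor _ _ _).trans
      (LinearMap.rTensor_comp_lTensor _ _ _).symm).symm z
  have e5 := Module.Flat.rTensor_preserves_injective_linearMap (M := M →₀ S) i hq.inj e4
  rw [← e5, ← LinearMap.lTensor_comp_apply, show g ∘ₗ f = 0 from LinearMap.ext hs.comp_eq_zero]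
  simp

theorem ExtZero.of_prod {i : ℕ} (h : ExtZero S (M × M') N i) : ExtZero S M N i := by
  refine subsingleton_of_forall_eq 0 fun x => ?_
  have : x = (Abelian.Ext.mk₀ (ModuleCat.ofHom (LinearMap.inl S M M'))).comp
      ((Abelian.Ext.mk₀ (ModuleCat.ofHom (LinearMap.fst S M M'))).comp x (zero_add i))
      (zero_add i) := by
    rw [Abelian.Ext.mk₀_comp_mk₀_assoc, ← ModuleCat.ofHom_comp, LinearMap.fst_comp_inl,
      ModuleCat.ofHom_id, Abelian.Ext.mk₀_id_comp]
  rw [this, h.elim ((Abelian.Ext.mk₀ _).comp x (zero_add i)) 0, Abelian.Ext.comp_zero]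

end TorOne

/-! ### Schanuel's lemma -/

section Schanuel

variable {S : Type*} [CommRing S] {K X M K' X' M' : Type*} [AddCommGroup K] [AddCommGroup X]
  [AddCommGroup M] [AddCommGroup K'] [AddCommGroup X'] [AddCommGroup M'] [Module S K] [Module S X]
  [Module S M] [Module S K'] [Module S X'] [Module S M'] {f : K →ₗ[S] X} {g : X →ₗ[S] M}
  {f' : K' →ₗ[S] X'} {g' : X' →ₗ[S] M'}

theorem IsSES.nonempty_equiv_pullback (h' : IsSES f' g') (φ : X →ₗ[S] M') [Module.Projective S X] :
    Nonempty ((K' × X) ≃ₗ[S]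
      LinearMap.ker (φ ∘ₗ LinearMap.fst S X X' - g' ∘ₗ LinearMap.snd S X X')) := by
  obtain ⟨a, ha⟩ := Module.projective_lifting_property g' φ h'.surj
  have ha' : ∀ x, g' (a x) = φ x := fun x => LinearMap.congr_fun ha x
  let ψ : K' × X →ₗ[S] X × X' :=
    (LinearMap.snd S K' X).prod (f'.coprod a)
  refine ⟨LinearEquiv.ofBijective (ψ.codRestrict _ ?_) ⟨?_, ?_⟩⟩
  · rintro ⟨k, x⟩
    simp [ψ, ha', h'.comp_eq_zero]
  · rintro ⟨k, x⟩ ⟨k', x'⟩ hx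
    have hx' : ψ (k, x) = ψ (k', x') := congrArg Subtype.val hx
    have h1 : x = x' := congrArg Prod.fst hx'
    subst h1
    have h2 : f' k + a x = f' k' + a x := congrArg Prod.snd hx'
    rw [h'.inj (add_right_cancel h2)]
  · rintro ⟨⟨x, x'⟩, hx⟩
    have hx' : φ x = g' x' := by simpa [sub_eq_zero] using hx
    obtain ⟨k, hk⟩ := (h'.exact (x' - a x)).1 (by rw [map_sub, ha', hx', sub_self])
    refine ⟨(k, x), Subtype.ext (Prod.ext rfl ?_)⟩
    simp [ψ, hk]

theorem IsSES.schanuel (h : IsSES f g) (h' : IsSES f' g') [Module.Projective S X]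
    [Module.Projective S X'] (e : M ≃ₗ[S] M') : Nonempty ((K × X') ≃ₗ[S] (K' × X)) := by
  obtain ⟨e₁⟩ := h'.nonempty_equiv_pullback (e.toLinearMap ∘ₗ g)
  obtain ⟨e₂⟩ := h.nonempty_equiv_pullback (e.symm.toLinearMap ∘ₗ g')
  refine ⟨e₂.trans (LinearEquiv.trans ((LinearEquiv.prodComm S X' X).ofSubmodules _ _ ?_) e₁.symm)⟩
  ext ⟨x, x'⟩
  rw [Submodule.mem_map_equiv, LinearMap.mem_ker, LinearMap.mem_ker]
  change e.symm (g' x') - g x = 0 ↔ e (g x) - g' x' = 0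
  rw [sub_eq_zero, sub_eq_zero, LinearEquiv.symm_apply_eq, eq_comm]

/-- Surjections with the same kernel have isomorphic targets. -/
theorem nonempty_equiv_of_ker_eq {φ : X →ₗ[S] M} {φ' : X →ₗ[S] M'} (h : Function.Surjective φ)
    (h' : Function.Surjective φ') (hk : ∀ x, φ x = 0 ↔ φ' x = 0) : Nonempty (M ≃ₗ[S] M') :=
  ⟨(φ.quotKerEquivOfSurjective h).symm.trans ((Submodule.quotEquivOfEq _ _ (by
    ext x; exact hk x)).trans (φ'.quotKerEquivOfSurjective h'))⟩

theorem IsSES.dual_schanuel (h : IsSES f g) (h' : IsSES f' g') (e : K ≃ₗ[S] K')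
    (a : X →ₗ[S] X') (ha : ∀ k, a (f k) = f' (e k)) (b : X' →ₗ[S] X)
    (hb : ∀ k, b (f' k) = f (e.symm k)) : Nonempty ((M × X') ≃ₗ[S] (M' × X)) := by
  let φ : X × X' →ₗ[S] M × X' := (g ∘ₗ LinearMap.fst S X X').prod (a.coprod LinearMap.id)
  let φ' : X × X' →ₗ[S] M' × X := (g' ∘ₗ LinearMap.snd S X X').prod (LinearMap.id.coprod b)
  refine nonempty_equiv_of_ker_eq (φ := φ) (φ' := φ') ?_ ?_ ?_
  · rintro ⟨m, x'⟩
    obtain ⟨x, rfl⟩ := h.surj m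
    exact ⟨(x, x' - a x), Prod.ext rfl (by simp [φ])⟩
  · rintro ⟨m, x⟩
    obtain ⟨x', rfl⟩ := h'.surj m
    exact ⟨(x - b x', x'), Prod.ext rfl (by simp [φ'])⟩
  · rintro ⟨x, x'⟩
    have h1 : φ (x, x') = 0 ↔ g x = 0 ∧ a x + x' = 0 := by simp [φ, Prod.ext_iff]
    have h2 : φ' (x, x') = 0 ↔ g' x' = 0 ∧ x + b x' = 0 := by simp [φ', Prod.ext_iff]
    rw [h1, h2]
    constructor
    · rintro ⟨hx, hx'⟩
      obtain ⟨k, rfl⟩ := (h.exact x).1 hx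
      rw [ha] at hx'
      have : x' = f' (-(e k)) := by rw [map_neg]; exact eq_neg_of_add_eq_zero_right hx'
      subst this
      refine ⟨h'.comp_eq_zero _, ?_⟩
      rw [hb]; simp
    · rintro ⟨hx, hx'⟩
      obtain ⟨k, rfl⟩ := (h'.exact x').1 hx
      rw [hb] at hx'
      have : x = f (-(e.symm k)) := by rw [map_neg]; exact eq_neg_of_add_eq_zero_left hx'
      subst this
      refine ⟨h.comp_eq_zero _, ?_⟩
      rw [ha]; simp

end Schanuel

/-! ### Stable isomorphism -/

section Stable

variable {S : Type u} [CommRing S]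

/-- Stable isomorphism: `M ⊕ S^n ≅ M' ⊕ S^m`. -/
def StablyIso (S M M' : Type u) [CommRing S] [AddCommGroup M] [AddCommGroup M'] [Module S M]
    [Module S M'] : Prop :=
  ∃ n m : ℕ, Nonempty ((M × (Fin n → S)) ≃ₗ[S] (M' × (Fin m → S)))

variable {K X M N K' X' M' : Type u} [AddCommGroup K] [AddCommGroup X] [AddCommGroup M]
  [AddCommGroup N] [AddCommGroup K'] [AddCommGroup X'] [AddCommGroup M'] [Module S K]
  [Module S X] [Module S M] [Module S N] [Module S K'] [Module S X'] [Module S M']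
  {f : K →ₗ[S] X} {g : X →ₗ[S] M} {f' : K' →ₗ[S] X'} {g' : X' →ₗ[S] M'}

theorem StablyIso.of_equiv (e : M ≃ₗ[S] M') : StablyIso S M M' :=
  ⟨0, 0, ⟨e.prodCongr (LinearEquiv.refl _ _)⟩⟩

theorem StablyIso.of_equiv_left (e : M ≃ₗ[S] M') (h : StablyIso S M N) : StablyIso S M' N := by
  obtain ⟨n, m, ⟨e'⟩⟩ := h
  exact ⟨n, m, ⟨(e.symm.prodCongr (LinearEquiv.refl _ _)).trans e'⟩⟩

theorem StablyIso.torOneZero (h : StablyIso S M M') (h' : TorOneZero S M' N) :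
    TorOneZero S M N := by
  obtain ⟨n, m, ⟨e⟩⟩ := h
  exact (h'.prod.of_equiv e.symm).of_prod

theorem StablyIso.extZero (h : StablyIso S M M') {i : ℕ} (hi : 1 ≤ i) (h' : ExtZero S M' N i) :
    ExtZero S M N i := by
  obtain ⟨n, m, ⟨e⟩⟩ := h
  exact ((h'.prod (extAcyclic_of_projective _ _ i hi)).of_equiv e.symm).of_prod

theorem StablyIso.of_finite_free [Module.Finite S X] [Module.Free S X] [Module.Finite S X']
    [Module.Free S X'] (e : (M × X) ≃ₗ[S] (M' × X')) : StablyIso S M M' := by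
  rcases subsingleton_or_nontrivial S with hS | hS
  · have := Module.subsingleton S M
    have := Module.subsingleton S M'
    exact .of_equiv ⟨0, 0, fun _ => Subsingleton.elim _ _, fun _ => Subsingleton.elim _ _⟩
  · exact ⟨_, _, ⟨((LinearEquiv.refl S M).prodCongr
      (Module.finBasis S X).equivFun.symm).trans (e.trans
        ((LinearEquiv.refl S M').prodCongr (Module.finBasis S X').equivFun))⟩⟩

theorem IsSES.prodMap_id_left (h : IsSES f g) (F : Type*) [AddCommGroup F] [Module S F] :
    IsSES (f.prodMap (LinearMap.id : F →ₗ[S] F)) (g ∘ₗ LinearMap.fst S X F) := by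
  refine ⟨h.inj.prodMap Function.injective_id, ?_, h.surj.comp LinearMap.fst_surjective⟩
  rintro ⟨x, y⟩
  constructor
  · intro hx
    obtain ⟨k, hk⟩ := (h.exact x).1 hx
    exact ⟨(k, y), Prod.ext hk rfl⟩
  · rintro ⟨k, hk⟩
    rw [← hk]
    simp [h.comp_eq_zero]

theorem StablyIso.syzygy (h : IsSES f g) (h' : IsSES f' g') [Module.Finite S X]
    [Module.Free S X] [Module.Finite S X'] [Module.Free S X'] (hM : StablyIso S M M') :
    StablyIso S K K' := by
  obtain ⟨n, m, ⟨e⟩⟩ := hM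
  obtain ⟨e'⟩ := (h.prodMap_id (Fin n → S)).schanuel (h'.prodMap_id (Fin m → S)) e
  exact .of_finite_free e'

theorem IsSES.extend_free (h : IsSES f g) (h1 : ExtZero S M S 1) (F : Type u) [AddCommGroup F]
    [Module S F] [Module.Finite S F] [Module.Free S F] (φ : K →ₗ[S] F) :
    ∃ ψ : X →ₗ[S] F, ∀ k, ψ (f k) = φ k := by
  let b := Module.Free.chooseBasis S F
  choose ψ hψ using fun i => h.extend h1 (b.coord i ∘ₗ φ)
  refine ⟨b.equivFun.symm.toLinearMap ∘ₗ LinearMap.pi ψ, fun k => ?_⟩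
  rw [LinearMap.comp_apply, LinearEquiv.coe_coe, LinearEquiv.symm_apply_eq]
  ext i
  simp [hψ]

theorem StablyIso.cosyzygy (h : IsSES f g) (h' : IsSES f' g') [Module.Finite S X]
    [Module.Free S X] [Module.Finite S X'] [Module.Free S X'] (hM : ExtZero S M S 1)
    (hM' : ExtZero S M' S 1) (hK : StablyIso S K K') : StablyIso S M M' := by
  obtain ⟨n, m, ⟨e⟩⟩ := hK
  have hs := h.prodMap_id_left (Fin n → S)
  have hs' := h'.prodMap_id_left (Fin m → S)
  obtain ⟨a, ha⟩ := hs.extend_free hM _ (f'.prodMap LinearMap.id ∘ₗ e.toLinearMap)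
  obtain ⟨b, hb⟩ := hs'.extend_free hM' _ (f.prodMap LinearMap.id ∘ₗ e.symm.toLinearMap)
  obtain ⟨e'⟩ := hs.dual_schanuel hs' e a ha b hb
  exact .of_finite_free e'

end Stable

/-! ### Cokernels of the differentials of an exact complex -/

section Cokernels

variable {S : Type u} [CommRing S] (X : ChainComplex (ModuleCat.{u} S) ℤ)

/-- The cokernel of the differential `X_{i+1} → X_i`. -/
abbrev cokerD (i : ℤ) : Type u := X.X i ⧸ LinearMap.range (X.d (i + 1) i).hom

/-- The map `Coker(∂_{i+2}) → X_i` induced by the differential. -/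
def cokerDι (i : ℤ) : cokerD X (i + 1) →ₗ[S] X.X i :=
  (LinearMap.range (X.d (i + 1 + 1) (i + 1)).hom).liftQ (X.d (i + 1) i).hom (by
    rintro _ ⟨x, rfl⟩
    exact congrArg (fun t => t.hom x) (X.d_comp_d (i + 1 + 1) (i + 1) i))

theorem cokerDι_mkQ (i : ℤ) (x : X.X (i + 1)) :
    cokerDι X i ((LinearMap.range (X.d (i + 1 + 1) (i + 1)).hom).mkQ x) = (X.d (i + 1) i).hom x :=
  rfl

variable {X}

theorem isSES_cokerD {i : ℤ} (h : X.ExactAt (i + 1)) :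
    IsSES (cokerDι X i) (LinearMap.range (X.d (i + 1) i).hom).mkQ := by
  rw [exactAt_succ_iff] at h
  refine ⟨?_, ?_, Submodule.mkQ_surjective _⟩
  · rw [injective_iff_map_eq_zero]
    intro z hz
    obtain ⟨x, rfl⟩ := Submodule.mkQ_surjective _ z
    rw [cokerDι_mkQ] at hz
    rw [Submodule.mkQ_apply, Submodule.Quotient.mk_eq_zero]
    exact (h x).1 hz
  · intro x
    rw [Submodule.mkQ_apply, Submodule.Quotient.mk_eq_zero]
    constructor
    · rintro ⟨y, rfl⟩
      exact ⟨Submodule.mkQ _ y, rfl⟩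
    · rintro ⟨z, rfl⟩
      obtain ⟨y, rfl⟩ := Submodule.mkQ_surjective _ z
      exact ⟨y, rfl⟩

theorem tensorComplex_exactAt_of_torOneZero (hX : ∀ i, X.ExactAt i) {N : ModuleCat.{u} S}
    (hN : ∀ i, TorOneZero S (cokerD X i) N) (i : ℤ) : (tensorComplex X N).ExactAt i := by
  refine SyzygyFamily.forall_int_of_succ (fun j => ?_) i
  rw [tensorComplex_exactAt_succ_iff]
  have e1 : (X.d (j + 1) j).hom = cokerDι X j ∘ₗ Submodule.mkQ _ := rfl
  have e2 : (X.d (j + 1 + 1) (j + 1)).hom = cokerDι X (j + 1) ∘ₗ Submodule.mkQ _ := rfl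
  have hs := isSES_cokerD (hX (j + 1 + 1))
  rw [e1, LinearMap.rTensor_comp]
  intro x
  rw [LinearMap.comp_apply, map_eq_zero_iff _ (hN j _ _ _ _ (isSES_cokerD (hX (j + 1)))),
    rTensor_exact N hs.exact hs.surj x]
  have h2 : Function.Surjective
      ((Submodule.mkQ (LinearMap.range (X.d (j + 1 + 1 + 1) (j + 1 + 1)).hom)).rTensor N) :=
    LinearMap.rTensor_surjective _ (Submodule.mkQ_surjective _)
  rw [e2, LinearMap.rTensor_comp, LinearMap.coe_comp, h2.range_comp]

theorem homComplex_exactAt_of_extZero (hX : ∀ i, X.ExactAt i) {N : ModuleCat.{u} S}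
    (hN : ∀ i, ExtZero S (cokerD X i) N 1) (i : ℤ) : (homComplex X N).ExactAt i := by
  refine SyzygyFamily.forall_int_of_succ (fun j => ?_) i
  rw [homComplex_exactAt_succ_iff]
  intro φ hφ
  obtain ⟨ψ, hψ⟩ := (isSES_cokerD (hX (j + 1))).extend (hN j)
    ((LinearMap.range (X.d (j + 1 + 1) (j + 1)).hom).liftQ φ (by
      rintro _ ⟨x, rfl⟩
      exact hφ x))
  exact ⟨ψ, fun x => hψ (Submodule.mkQ _ x)⟩

theorem IsTotallyAcyclic.extZero_cokerD (hX : IsTotallyAcyclic X) (i : ℤ) :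
    ExtZero S (cokerD X i) S 1 := by
  have := hX.free i
  refine (isSES_cokerD (hX.exact (i + 1))).extZero_one
    (extAcyclic_of_projective (X.X i) S 1 le_rfl) fun φ => ?_
  obtain ⟨ψ, hψ⟩ := (homComplex_exactAt_succ_iff X _ i).1 (hX.exact_dual (i + 1))
    (φ ∘ₗ Submodule.mkQ _) fun x => by
      have : Submodule.mkQ (LinearMap.range (X.d (i + 1 + 1) (i + 1)).hom)
          ((X.d (i + 1 + 1) (i + 1)).hom x) = 0 := by
        rw [Submodule.mkQ_apply, Submodule.Quotient.mk_eq_zero]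
        exact ⟨x, rfl⟩
      rw [LinearMap.comp_apply, this, map_zero]
  refine ⟨ψ, fun k => ?_⟩
  obtain ⟨x, rfl⟩ := Submodule.mkQ_surjective _ k
  exact hψ x

theorem nonempty_cokerD_equiv {Y : ChainComplex (ModuleCat.{u} S) ℤ} (α : X ⟶ Y) (i : ℤ)
    [IsIso (α.f i)] [IsIso (α.f (i + 1))] : Nonempty (cokerD X i ≃ₗ[S] cokerD Y i) := by
  refine ⟨Submodule.Quotient.equiv _ _ (asIso (α.f i)).toLinearEquiv ?_⟩
  ext y
  have hc : ∀ x, (α.f i).hom ((X.d (i + 1) i).hom x) = (Y.d (i + 1) i).hom ((α.f (i + 1)).hom x) :=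
    fun x => (congrArg (fun t => t.hom x) (α.comm (i + 1) i)).symm
  constructor
  · rintro ⟨_, ⟨x, rfl⟩, rfl⟩
    exact ⟨(α.f (i + 1)).hom x, (hc x).symm⟩
  · rintro ⟨x, rfl⟩
    obtain ⟨x, rfl⟩ := (asIso (α.f (i + 1))).toLinearEquiv.surjective x
    exact ⟨_, ⟨x, rfl⟩, hc x⟩

end Cokernels

/-! ### Tate resolutions -/

section Tate

variable {S : Type u} [CommRing S]

theorem quasiIsoAt_zero_iff {P : ChainComplex (ModuleCat.{u} S) ℤ} {M : ModuleCat.{u} S}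
    (β : P ⟶ (HomologicalComplex.single (ModuleCat.{u} S) (ComplexShape.down ℤ) 0).obj M)
    (hP : IsZero (P.X (-1))) :
    QuasiIsoAt β 0 ↔ Function.Exact (P.d (0 + 1) 0).hom (β.f 0).hom ∧
      Function.Surjective (β.f 0).hom := by
  rw [quasiIsoAt_iff' β (0 + 1) 0 (-1) (ComplexShape.prev_eq' _ rfl)
    (ComplexShape.next_eq' _ (by simp)), ShortComplex.quasiIso_iff_of_zeros']
  · rw [ShortComplex.ShortExact.moduleCat_exact_iff_function_exact, ModuleCat.epi_iff_surjective]
    rfl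
  · exact hP.eq_of_tgt _ _
  · exact (HomologicalComplex.isZero_single_obj_X (ComplexShape.down ℤ) 0 M (0 + 1)
      (by decide)).eq_of_src _ _
  · exact (HomologicalComplex.isZero_single_obj_X (ComplexShape.down ℤ) 0 M (-1)
      (by decide)).eq_of_tgt _ _

namespace TateResolution

variable {M : ModuleCat.{u} S} (t : TateResolution M)

theorem nonempty_equiv_cokerD_zero : Nonempty (M ≃ₗ[S] cokerD t.P 0) := by
  have h := t.quasiIso_β
  rw [quasiIso_iff] at h
  obtain ⟨h1, h2⟩ := (quasiIsoAt_zero_iff t.β (t.isZero_of_neg _ (by decide))).1 (h 0)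
  let e := (HomologicalComplex.singleObjXSelf (ComplexShape.down ℤ) 0 M).toLinearEquiv
  obtain ⟨e'⟩ := nonempty_equiv_of_ker_eq (φ := (t.β.f 0).hom)
    (φ' := (LinearMap.range (t.P.d (0 + 1) 0).hom).mkQ) h2 (Submodule.mkQ_surjective _) fun x => by
      rw [Submodule.mkQ_apply, Submodule.Quotient.mk_eq_zero]
      exact h1 x
  exact ⟨e.symm.trans e'⟩

theorem exactAt_P {i : ℤ} (hi : i ≠ 0) : t.P.ExactAt i := by
  have h := t.quasiIso_β
  rw [quasiIso_iff] at h
  exact (quasiIsoAt_iff_exactAt' _ _ (HomologicalComplex.exactAt_single_obj _ _ _ _ hi)).1 (h i)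

variable (F : SyzygyFamily S)

theorem stablyIso_P (e : M ≃ₗ[S] F.Z 0) (n : ℕ) : StablyIso S (cokerD t.P n) (F.Z n) := by
  induction n with
  | zero =>
    obtain ⟨e'⟩ := t.nonempty_equiv_cokerD_zero
    exact .of_equiv (e'.symm.trans e)
  | succ n ih =>
    have h1 := t.finite n
    have h2 := t.free n
    have h3 := F.finite n
    have h4 := F.free n
    exact ih.syzygy (isSES_cokerD (t.exactAt_P (i := (n : ℤ) + 1) (by omega))) (F.ses n)

theorem stablyIso_T (e : M ≃ₗ[S] F.Z 0) (hF : ∀ i, ExtZero S (F.Z i) S 1) (i : ℤ) :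
    StablyIso S (cokerD t.T i) (F.Z i) := by
  obtain ⟨n, hn⟩ := t.isIso_α
  have h1 := t.isTotallyAcyclic.finite
  have h2 := t.isTotallyAcyclic.free
  have h3 := F.finite
  have h4 := F.free
  have hbase : StablyIso S (cokerD t.T (n.toNat : ℤ)) (F.Z (n.toNat : ℤ)) := by
    have := hn n.toNat (by omega)
    have := hn (n.toNat + 1) (by omega)
    obtain ⟨e'⟩ := nonempty_cokerD_equiv t.α (n.toNat : ℤ)
    exact (t.stablyIso_P F e n.toNat).of_equiv_left e'.symm
  rcases le_total (n.toNat : ℤ) i with h | h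
  · induction i, h using Int.leInduction with
    | base => exact hbase
    | succ i _ ih => exact ih.syzygy (isSES_cokerD (t.isTotallyAcyclic.exact (i + 1))) (F.ses i)
  · induction i, h using Int.leInductionDown with
    | base => exact hbase
    | pred i _ ih =>
      obtain ⟨j, rfl⟩ : ∃ j, i = j + 1 := ⟨i - 1, by omega⟩
      rw [add_sub_cancel_right]
      exact ih.cosyzygy (isSES_cokerD (t.isTotallyAcyclic.exact (j + 1))) (F.ses j)
        (t.isTotallyAcyclic.extZero_cokerD j) (hF j)

end TateResolution

namespace SyzygyFamily

variable (F : SyzygyFamily S)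

/-- The differential of the nonnegative part of the complex of a family of syzygies. -/
def truncationD (i : ℤ) :
    (PLift (0 ≤ i + 1) → F.X (i + 1)) →ₗ[S] (PLift (0 ≤ i) → F.X i) :=
  LinearMap.pi fun h => (F.ι i ∘ₗ F.π (i + 1)) ∘ₗ LinearMap.proj ⟨by have := h.down; omega⟩

/-- The nonnegative part of the complex of a family of syzygies. -/
def truncation : ChainComplex (ModuleCat.{u} S) ℤ :=
  ChainComplex.of (fun i => ModuleCat.of S (PLift (0 ≤ i) → F.X i))
    (fun i => ModuleCat.ofHom (F.truncationD i)) fun i =>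
      ModuleCat.hom_ext (LinearMap.ext fun x => funext fun h => by
        change F.ι i (F.π (i + 1) (F.ι (i + 1) _)) = 0
        rw [(F.ses (i + 1)).comp_eq_zero, map_zero])

theorem truncation_d (i : ℤ) : F.truncation.d (i + 1) i = ModuleCat.ofHom (F.truncationD i) :=
  ChainComplex.of_d (fun i => ModuleCat.of S (PLift (0 ≤ i) → F.X i))
    (fun i => ModuleCat.ofHom (F.truncationD i)) i

/-- The projection onto the nonnegative part. -/
def toTruncation : F.complex ⟶ F.truncation where
  f i := ModuleCat.ofHom (LinearMap.pi fun _ => LinearMap.id : F.X i →ₗ[S] PLift (0 ≤ i) → F.X i)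
  comm' := by
    rintro _ i rfl
    rw [truncation_d, complex_d]
    rfl

theorem truncation_exactAt {i : ℤ} (hi : i ≠ 0) : F.truncation.ExactAt i := by
  obtain ⟨j, rfl⟩ : ∃ j, i = j + 1 := ⟨i - 1, by omega⟩
  rw [exactAt_succ_iff, truncation_d, truncation_d]
  intro (x : PLift (0 ≤ j + 1) → F.X (j + 1))
  change (fun h : PLift (0 ≤ j) => F.ι j (F.π (j + 1) (x ⟨by have := h.down; omega⟩))) = 0 ↔
    ∃ y : PLift (0 ≤ j + 1 + 1) → F.X (j + 1 + 1), (fun h : PLift (0 ≤ j + 1) =>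
      F.ι (j + 1) (F.π (j + 1 + 1) (y ⟨by have := h.down; omega⟩))) = x
  constructor
  · intro hx
    by_cases hj : 0 ≤ j
    · have h1 := congrFun hx ⟨hj⟩
      have h2 : F.π (j + 1) (x ⟨hj.trans (by omega)⟩) = 0 :=
        (F.ses j).inj (h1.trans (map_zero _).symm)
      obtain ⟨z, hz⟩ := ((F.ses (j + 1)).exact _).1 h2
      obtain ⟨y, rfl⟩ := (F.ses (j + 1 + 1)).surj z
      exact ⟨fun _ => y, funext fun h => hz⟩
    · exact ⟨0, funext fun h => absurd h.down (by omega)⟩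
  · rintro ⟨y, rfl⟩
    funext h
    simp [(F.ses (j + 1)).comp_eq_zero]

/-- The augmentation of the nonnegative part in degree zero. -/
def augmentationZero (M : ModuleCat.{u} S) (e : F.Z 0 ≃ₗ[S] M) : F.truncation.X 0 ⟶ M :=
  ModuleCat.ofHom (e.toLinearMap ∘ₗ F.π 0 ∘ₗ
    LinearMap.proj (φ := fun _ : PLift ((0 : ℤ) ≤ 0) => F.X 0) ⟨le_rfl⟩)

/-- The augmentation of the nonnegative part. -/
def augmentation (M : ModuleCat.{u} S) (e : F.Z 0 ≃ₗ[S] M) : F.truncation ⟶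
    (HomologicalComplex.single (ModuleCat.{u} S) (ComplexShape.down ℤ) 0).obj M :=
  HomologicalComplex.mkHomToSingle (F.augmentationZero M e) (by
    rintro _ rfl
    rw [truncation_d]
    refine ModuleCat.hom_ext (LinearMap.ext fun x => ?_)
    change e (F.π 0 (F.ι 0 _)) = 0
    rw [(F.ses 0).comp_eq_zero, map_zero])

theorem quasiIso_augmentation (M : ModuleCat.{u} S) (e : F.Z 0 ≃ₗ[S] M) :
    QuasiIso (F.augmentation M e) := by
  rw [quasiIso_iff]
  intro i
  by_cases hi : i = 0
  · subst hi
    have hz : IsZero (F.truncation.X (-1)) := by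
      have : IsEmpty (PLift ((0 : ℤ) ≤ -1)) := ⟨fun h => absurd h.down (by decide)⟩
      exact ModuleCat.isZero_iff_subsingleton.2
        (inferInstanceAs (Subsingleton (PLift ((0 : ℤ) ≤ -1) → F.X (-1))))
    rw [quasiIsoAt_zero_iff _ hz, augmentation, HomologicalComplex.mkHomToSingle_f, truncation_d]
    let e' := (HomologicalComplex.singleObjXSelf (ComplexShape.down ℤ) 0 M).symm.toLinearEquiv
    constructor
    · intro (x : PLift ((0 : ℤ) ≤ 0) → F.X 0)
      change e' (e (F.π 0 (x ⟨le_rfl⟩))) = 0 ↔ ∃ y : PLift ((0 : ℤ) ≤ 0 + 1) → F.X (0 + 1),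
        (fun h : PLift ((0 : ℤ) ≤ 0) => F.ι 0 (F.π (0 + 1) (y ⟨by have := h.down; omega⟩))) = x
      rw [map_eq_zero_iff _ e'.injective, map_eq_zero_iff _ e.injective, (F.ses 0).exact]
      constructor
      · rintro ⟨z, hz⟩
        obtain ⟨y, rfl⟩ := (F.ses (0 + 1)).surj z
        exact ⟨fun _ => y, funext fun _ => hz⟩
      · rintro ⟨y, rfl⟩
        exact ⟨_, rfl⟩
    · have h1 : Function.Surjective
          (fun x : PLift ((0 : ℤ) ≤ 0) → F.X 0 => e' (e (F.π 0 (x ⟨le_rfl⟩)))) :=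
        e'.surjective.comp (e.surjective.comp ((F.ses 0).surj.comp fun y => ⟨fun _ => y, rfl⟩))
      exact h1
  · exact (quasiIsoAt_iff_exactAt' _ _ (HomologicalComplex.exactAt_single_obj _ _ _ _ hi)).2
      (F.truncation_exactAt hi)

/-- The Tate resolution given by a family of syzygies. -/
def tateResolution (hF : ∀ i, ExtZero S (F.Z i) S 1) (M : ModuleCat.{u} S) (e : F.Z 0 ≃ₗ[S] M) :
    TateResolution M where
  T := F.complex
  P := F.truncation
  α := F.toTruncation
  β := F.augmentation M e
  isTotallyAcyclic := F.complex_isTotallyAcyclic hF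
  isIso_α := by
    refine ⟨0, fun i hi => ?_⟩
    rw [ConcreteCategory.isIso_iff_bijective]
    change Function.Bijective (fun (x : F.X i) (_ : PLift (0 ≤ i)) => x)
    exact ⟨fun x y h => congrFun h ⟨hi⟩, fun y => ⟨y ⟨hi⟩, rfl⟩⟩
  finite i := by
    have := F.finite i
    exact inferInstanceAs (Module.Finite S (PLift (0 ≤ i) → F.X i))
  free i := by
    have := F.free i
    exact inferInstanceAs (Module.Free S (PLift (0 ≤ i) → F.X i))
  isZero_of_neg i hi := by
    have : IsEmpty (PLift (0 ≤ i)) := ⟨fun h => absurd h.down (by omega)⟩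
    exact ModuleCat.isZero_iff_subsingleton.2
      (inferInstanceAs (Subsingleton (PLift (0 ≤ i) → F.X i)))
  quasiIso_β := F.quasiIso_augmentation M e

theorem tateVanishing (hF : ∀ i, ExtZero S (F.Z i) S 1) {M N : ModuleCat.{u} S}
    (e : F.Z 0 ≃ₗ[S] M) (hext : ∀ i, ExtZero S (F.Z i) N 1) (htor : ∀ i, TorOneZero S (F.Z i) N) :
    TateVanishing M N := by
  refine ⟨⟨F.tateResolution hF M e⟩, fun t i => ⟨?_, ?_⟩⟩
  · exact (tensorComplex_exactAt_of_torOneZero t.isTotallyAcyclic.exact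
      (fun i => (t.stablyIso_T F e.symm hF i).torOneZero (htor i)) i).isZero_homology
  · exact (homComplex_exactAt_of_extZero t.isTotallyAcyclic.exact
      (fun i => (t.stablyIso_T F e.symm hF i).extZero le_rfl (hext i)) i).isZero_homology

theorem extAcyclic {N : Type u} [AddCommGroup N] [Module S N]
    (hext : ∀ i, ExtZero S (F.Z i) N 1) (i : ℤ) : ExtAcyclic S (F.Z i) N := by
  rintro (_ | n) hn
  · omega
  · clear hn
    induction n generalizing i with
    | zero => exact hext i
    | succ n ih =>
      have := F.free i
      exact (F.ses i).extZero_right (extAcyclic_of_projective (F.X i) N _ (by omega)) (ih (i + 1))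

theorem extVanishing {M N : ModuleCat.{u} S} (e : F.Z 0 ≃ₗ[S] M)
    (hext : ∀ i, ExtZero S (F.Z i) N 1) : ExtVanishing M N := fun i hi =>
  (F.extAcyclic hext 0 i hi).of_equiv e

end SyzygyFamily

end Tate

/-! ### Vanishing of `Tor` from a resolution -/

section Tor

variable {S : Type u} [CommRing S]

theorem natExactAt_succ_iff (X : ChainComplex (ModuleCat.{u} S) ℕ) (n : ℕ) :
    X.ExactAt (n + 1) ↔
      Function.Exact (X.d (n + 1 + 1) (n + 1)).hom (X.d (n + 1) n).hom := by
  rw [X.exactAt_iff' (n + 1 + 1) (n + 1) n (ComplexShape.prev_eq' _ rfl)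
    (ComplexShape.next_eq' _ rfl), ShortComplex.ShortExact.moduleCat_exact_iff_function_exact]
  rfl

variable {Z X : ℕ → ModuleCat.{u} S} {ι : ∀ n, Z (n + 1) →ₗ[S] X n} {π : ∀ n, X n →ₗ[S] Z n}

/-- The resolution spliced from short exact sequences `0 → Z_{n+1} → X_n → Z_n → 0`. -/
def splice (hs : ∀ n, IsSES (ι n) (π n)) : ChainComplex (ModuleCat.{u} S) ℕ :=
  ChainComplex.of X (fun n => ModuleCat.ofHom (ι n ∘ₗ π (n + 1))) fun n => by
    ext x
    simp [(hs (n + 1)).comp_eq_zero]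

theorem splice_d (hs : ∀ n, IsSES (ι n) (π n)) (n : ℕ) :
    (splice hs).d (n + 1) n = ModuleCat.ofHom (ι n ∘ₗ π (n + 1)) :=
  ChainComplex.of_d X (fun n => ModuleCat.ofHom (ι n ∘ₗ π (n + 1))) n

theorem splice_exact (hs : ∀ n, IsSES (ι n) (π n)) {n : ℕ} {Y : Type*} [AddCommGroup Y]
    [Module S Y] (j : Z n →ₗ[S] Y) (hj : Function.Injective j) :
    Function.Exact (ι n ∘ₗ π (n + 1)) (j ∘ₗ π n) := by
  intro x
  rw [LinearMap.comp_apply, map_eq_zero_iff _ hj, (hs n).exact, LinearMap.coe_comp,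
    (hs (n + 1)).surj.range_comp]

theorem splice_exact_lTensor (hs : ∀ n, IsSES (ι n) (π n)) {n : ℕ} {Y M : Type u} [AddCommGroup Y]
    [Module S Y] [AddCommGroup M] [Module S M] (j : Z n →ₗ[S] Y)
    (hj : Function.Injective (j.lTensor M)) :
    Function.Exact ((ι n ∘ₗ π (n + 1)).lTensor M) ((j ∘ₗ π n).lTensor M) := by
  intro x
  rw [LinearMap.lTensor_comp, LinearMap.comp_apply, map_eq_zero_iff _ hj,
    lTensor_exact M (hs n).exact (hs n).surj, LinearMap.lTensor_comp, LinearMap.coe_comp,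
    (LinearMap.lTensor_surjective M (hs (n + 1)).surj).range_comp]

/-- The augmentation of a spliced resolution. -/
def spliceπ (hs : ∀ n, IsSES (ι n) (π n)) {N : ModuleCat.{u} S} (e : Z 0 ≃ₗ[S] N) :
    splice hs ⟶ (ChainComplex.single₀ (ModuleCat.{u} S)).obj N :=
  (ChainComplex.toSingle₀Equiv _ _).symm ⟨(ModuleCat.ofHom (e.toLinearMap ∘ₗ π 0) : X 0 ⟶ N), by
    rw [splice_d hs 0]
    refine ModuleCat.hom_ext (LinearMap.ext fun x => ?_)
    change e (π 0 (ι 0 _)) = 0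
    rw [(hs 0).comp_eq_zero, map_zero]⟩

theorem quasiIso_spliceπ (hs : ∀ n, IsSES (ι n) (π n)) {N : ModuleCat.{u} S} (e : Z 0 ≃ₗ[S] N) :
    QuasiIso (spliceπ hs e) := by
  rw [quasiIso_iff]
  rintro (_ | n)
  · rw [ChainComplex.quasiIsoAt₀_iff, ShortComplex.quasiIso_iff_of_zeros']
    · constructor
      · rw [ShortComplex.ShortExact.moduleCat_exact_iff_function_exact]
        change Function.Exact ((splice hs).d (0 + 1) 0).hom (e.toLinearMap ∘ₗ π 0)
        rw [splice_d]
        exact splice_exact hs _ e.injective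
      · exact (ModuleCat.epi_iff_surjective _).2 (e.surjective.comp (hs 0).surj)
    all_goals rfl
  · rw [quasiIsoAt_iff_exactAt' _ _ (ChainComplex.exactAt_succ_single_obj _ _),
      natExactAt_succ_iff, splice_d, splice_d]
    exact splice_exact hs _ (hs n).inj

theorem torVanishing_of_isSES (hs : ∀ n, IsSES (ι n) (π n))
    (hX : ∀ n, Module.Projective S (X n)) {M N : ModuleCat.{u} S} (e : Z 0 ≃ₗ[S] N)
    (hM : ∀ n, Function.Injective ((ι n).lTensor M)) : TorVanishing M N := by
  let P : ProjectiveResolution N :=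
    { complex := splice hs
      projective := fun n => (IsProjective.iff_projective (X n)).1 (hX n)
      π := spliceπ hs e
      quasiIso := quasiIso_spliceπ hs e }
  rintro (_ | n) hn
  · omega
  · refine IsZero.of_iso ?_ (P.isoLeftDerivedObj ((tensoringLeft (ModuleCat.{u} S)).obj M) (n + 1))
    refine HomologicalComplex.ExactAt.isZero_homology ?_
    rw [natExactAt_succ_iff]
    change Function.Exact (((splice hs).d (n + 1 + 1) (n + 1)).hom.lTensor M)
      (((splice hs).d (n + 1) n).hom.lTensor M)
    rw [splice_d, splice_d]
    exact splice_exact_lTensor hs _ (hM n)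

theorem SyzygyFamily.torVanishing (F : SyzygyFamily S) {M N : ModuleCat.{u} S} (e : F.Z 0 ≃ₗ[S] N)
    (hM : ∀ i, Function.Injective ((F.ι i).lTensor M)) : TorVanishing M N :=
  torVanishing_of_isSES (Z := fun n => F.Z n) (X := fun n => F.X n) (ι := fun n => F.ι n)
    (π := fun n => F.π n) (fun n => F.ses n)
    (fun n => by have := F.free n; exact inferInstance) e fun n => hM n

end Tor

/-! ### Reflexive modules and modules of finite injective dimension -/

namespace IsReflexivePair

variable {S G H E : Type u} [CommRing S] [AddCommGroup G] [AddCommGroup H] [AddCommGroup E]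
  [Module S G] [Module S H] [Module S E] {p : G →ₗ[S] H →ₗ[S] S} [IsNoetherianRing S]

theorem extAcyclic (h : IsReflexivePair p) {n : ℕ}
    (hE : HasInjectiveDimensionLT (ModuleCat.of S E) n) : ExtAcyclic S G E := by
  have := h.finite_right
  exact (extAcyclic_hom hE (extAcyclic_of_projective S E) h.ext_right).of_equiv
    (LinearEquiv.ofBijective p h.bijective).symm

theorem torOneZero (h : IsReflexivePair p) {n : ℕ}
    (hE : HasInjectiveDimensionLT (ModuleCat.of S E) n) : TorOneZero S G E := by
  have := h.finite_left
  obtain ⟨m, K, _, _, _, f, g, hs⟩ := exists_finite_syzygy S G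
  have hK : ExtAcyclic S K S := hs.extAcyclic_left (extAcyclic_of_projective _ _) h.ext_left
  have h1 := tensorEval_bijective hE (extAcyclic_of_projective S E) hK
  have h2 : TorOneZero S G (S →ₗ[S] E) := by
    refine hs.torOneZero ?_
    rw [injective_iff_map_eq_zero]
    intro t ht
    refine h1.1 (LinearMap.ext fun φ => ?_)
    obtain ⟨ψ, hψ⟩ := hs.extend (h.ext_left 1 le_rfl) φ
    have h3 := tensorEval_natural f t ψ
    rw [ht] at h3
    have h4 : φ = ψ ∘ₗ f := LinearMap.ext fun k => (hψ k).symm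
    rw [h4, ← h3]
    simp
  exact (h2.symm.of_equiv (LinearMap.ringLmapEquivSelf S S E)).symm

end IsReflexivePair

/-! ### Base change of a family of syzygies -/

section BaseChange

variable {S Q : Type u} [CommRing S] [CommRing Q] [Algebra S Q] {K X G N : Type u}
  [AddCommGroup K] [AddCommGroup X] [AddCommGroup G] [AddCommGroup N] [Module S K] [Module S X]
  [Module S G] [Module Q N] [Module S N] [IsScalarTower S Q N] {f : K →ₗ[S] X} {g : X →ₗ[S] G}

theorem IsSES.baseChange (h : IsSES f g) (hQ : TorOneZero S G Q) :
    IsSES (f.baseChange Q) (g.baseChange Q) where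
  inj := (LinearMap.lTensor_inj_iff_rTensor_inj Q f).2 (hQ _ _ _ _ h)
  exact := lTensor_exact Q h.exact h.surj
  surj := LinearMap.lTensor_surjective Q h.surj

theorem IsSES.extZero_baseChange (h : IsSES f g) [Module.Projective S X]
    (hQ : TorOneZero S G Q) (hN : ExtZero S G N 1) : ExtZero Q (Q ⊗[S] G) N 1 := by
  refine (h.baseChange hQ).extZero_one (extAcyclic_of_projective _ _ 1 le_rfl) fun φ => ?_
  obtain ⟨ψ, hψ⟩ := h.extend hN (φ.restrictScalars S ∘ₗ (TensorProduct.mk S Q K 1))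
  refine ⟨ψ.liftBaseChange Q, fun t => ?_⟩
  induction t with
  | zero => simp
  | add x y hx hy => rw [map_add, map_add, hx, hy, map_add]
  | tmul q k =>
    rw [LinearMap.baseChange_tmul, LinearMap.liftBaseChange_tmul, hψ]
    simp [← map_smul, TensorProduct.smul_tmul']

theorem IsSES.torOneZero_baseChange (h : IsSES f g) [Module.Projective S X]
    (hQ : TorOneZero S G Q) (hN : TorOneZero S G N) : TorOneZero Q (Q ⊗[S] G) N := by
  refine (h.baseChange hQ).torOneZero ?_
  rw [← LinearMap.lTensor_inj_iff_rTensor_inj]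
  have h1 := (LinearMap.lTensor_inj_iff_rTensor_inj N f).2 (hN _ _ _ _ h)
  have h2 : ∀ t, f.lTensor N (TensorProduct.AlgebraTensorModule.cancelBaseChange S Q Q N K t) =
      TensorProduct.AlgebraTensorModule.cancelBaseChange S Q Q N X
        ((f.baseChange Q).lTensor N t) := fun t =>
    LinearMap.congr_fun
      (TensorProduct.AlgebraTensorModule.lTensor_comp_cancelBaseChange S Q Q f) t
  intro t t' ht
  refine (TensorProduct.AlgebraTensorModule.cancelBaseChange S Q Q N K).injective (h1 ?_)
  rw [h2, h2, ht]

/-- The base change of a family of syzygies to an algebra. -/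
def SyzygyFamily.baseChange (F : SyzygyFamily S) (hQ : ∀ i, TorOneZero S (F.Z i) Q) :
    SyzygyFamily Q where
  Z i := ModuleCat.of Q (Q ⊗[S] F.Z i)
  X i := ModuleCat.of Q (Q ⊗[S] F.X i)
  ι i := (F.ι i).baseChange Q
  π i := (F.π i).baseChange Q
  finite i := by
    have := F.finite i
    exact inferInstanceAs (Module.Finite Q (Q ⊗[S] F.X i))
  free i := by
    have := F.free i
    exact inferInstanceAs (Module.Free Q (Q ⊗[S] F.X i))
  ses i := (F.ses i).baseChange (hQ i)

variable [IsNoetherianRing S] {E : Type u} [AddCommGroup E] [Module S E]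

/-- For `Q ≅ S ⊕ E` with `E` of finite injective dimension and a reflexive `S`-module `G`, the
base change of `G` to `Q` has a two-sided resolution whose syzygies have vanishing `Ext^1` into
`Q` and `S`, and vanishing `Tor_1` with `S`. -/
theorem IsReflexiveModule.exists_baseChange {G : ModuleCat.{u} S} (hG : IsReflexiveModule G)
    {n : ℕ} (hE : HasInjectiveDimensionLT (ModuleCat.of S E) n) (e : Q ≃ₗ[S] S × E)
    (eN : N ≃ₗ[S] S) :
    ∃ F : SyzygyFamily Q, Nonempty (F.Z 0 ≃ₗ[Q] Q ⊗[S] G) ∧ (∀ i, ExtZero Q (F.Z i) Q 1) ∧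
      (∀ i, ExtZero Q (F.Z i) N 1) ∧ ∀ i, TorOneZero Q (F.Z i) N := by
  obtain ⟨F, rfl, hF⟩ := hG.exists_family
  have flat : ∀ i, TorOneZero S (F.Z i) S := fun i K X _ _ _ _ f g h =>
    Module.Flat.rTensor_preserves_injective_linearMap f h.inj
  have hQ : ∀ i, TorOneZero S (F.Z i) Q := fun i => by
    obtain ⟨H, p, hp⟩ := hF i
    exact ((hp.torOneZero hE).symm.prod.of_equiv
      ((LinearEquiv.prodComm S E S).trans e.symm)).symm
  have hQ' : ∀ i, ExtZero S (F.Z i) Q 1 := fun i => by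
    obtain ⟨H, p, hp⟩ := hF i
    exact ((hp.ext_left 1 le_rfl).prod_right (hp.extAcyclic hE 1 le_rfl)).of_equiv_right e.symm
  have hN : ∀ i, ExtZero S (F.Z i) N 1 := fun i => by
    obtain ⟨H, p, hp⟩ := hF i
    exact (hp.ext_left 1 le_rfl).of_equiv_right eN.symm
  have hX := F.free
  exact ⟨F.baseChange hQ, ⟨LinearEquiv.refl Q _⟩,
    fun i => (F.ses i).extZero_baseChange (hQ i) (hQ' i),
    fun i => (F.ses i).extZero_baseChange (hQ i) (hN i),
    fun i => (F.ses i).torOneZero_baseChange (hQ i) ((flat i).symm.of_equiv eN.symm).symm⟩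

end BaseChange

/-! ### Vanishing of `Tor` between ideals -/

section

variable {S : Type u} [CommRing S] [IsNoetherianRing S]

theorem exists_finite_free_resolution (N : ModuleCat.{u} S) [hN : Module.Finite S N] :
    ∃ Z : ℕ → ModuleCat.{u} S, Z 0 = N ∧ ∀ n, IsSyzygyOf (Z (n + 1)) (Z n) := by
  have hex : ∀ M : ModuleCat.{u} S, Module.Finite S M →
      ∃ K : ModuleCat.{u} S, Module.Finite S K ∧ IsSyzygyOf K M := fun M _ => by
    obtain ⟨n, K, _, _, hK, f, g, hs⟩ := exists_finite_syzygy S M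
    exact ⟨ModuleCat.of S K, hK, ModuleCat.of S (Fin n → S), f, g,
      inferInstanceAs (Module.Finite S (Fin n → S)), inferInstanceAs (Module.Free S (Fin n → S)),
      hs⟩
  choose! s hs hs' using hex
  have hu : ∀ n, Module.Finite S (s^[n] N) := fun n => by
    induction n with
    | zero => exact hN
    | succ n ih => rw [Function.iterate_succ_apply']; exact hs _ ih
  refine ⟨fun n => s^[n] N, rfl, fun n => ?_⟩
  change IsSyzygyOf (s^[n + 1] N) (s^[n] N)
  rw [Function.iterate_succ_apply']
  exact hs' _ (hu n)

/-- `Tor_i(I, J) = 0` for `i ≥ 1` as soon as the syzygies of `S/J` have vanishing `Tor_1`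
with `S/I`. -/
theorem SyzygyFamily.torVanishing_ideals (F : SyzygyFamily S) {I J : Ideal S}
    (e : F.Z 0 ≃ₗ[S] S ⧸ J) (hF : ∀ i, TorOneZero S (F.Z i) (S ⧸ I)) :
    TorVanishing (ModuleCat.of S I) (ModuleCat.of S J) := by
  have hs : IsSES (Submodule.subtype I) (Submodule.mkQ I) :=
    ⟨Subtype.val_injective, LinearMap.exact_subtype_mkQ I, Submodule.mkQ_surjective I⟩
  have hs' : IsSES (Submodule.subtype J) (Submodule.mkQ J) :=
    ⟨Subtype.val_injective, LinearMap.exact_subtype_mkQ J, Submodule.mkQ_surjective J⟩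
  have hfin : Module.Finite S (ModuleCat.of S J) := inferInstanceAs (Module.Finite S J)
  obtain ⟨Z, hZ, hr⟩ := exists_finite_free_resolution (ModuleCat.of S J)
  choose X f g h1 h2 h3 using hr
  have h4 := F.finite
  have h5 := F.free
  have hst : ∀ n : ℕ, StablyIso S (Z n) (F.Z (n + 1 : ℕ)) := fun n => by
    induction n with
    | zero =>
      rw [hZ]
      exact (StablyIso.of_equiv e.symm).syzygy hs' (F.ses 0)
    | succ n ih => exact ih.syzygy (h3 n) (F.ses (n + 1 : ℕ))
  refine torVanishing_of_isSES (N := ModuleCat.of S J) h3 (fun n => inferInstance)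
    (eqToIso hZ).toLinearEquiv fun n => ?_
  have h6 := ((hst (n + 1)).torOneZero (hF _)).symm _ _ _ _ hs
  have h7 := Module.Flat.lTensor_preserves_injective_linearMap (M := S) (f n) (h3 n).inj
  have h8 := h7.comp h6
  rw [← LinearMap.coe_comp, LinearMap.lTensor_comp_rTensor, ← LinearMap.rTensor_comp_lTensor,
    LinearMap.coe_comp] at h8
  exact Function.Injective.of_comp h8

end

/-! ### The trivial extension and its projections -/

namespace TrivExt

variable (R B : Type u) [CommRing R] [AddCommGroup B] [Module R B]

/-- The projection `R ⋉ B → R`. -/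
def fstHom : TrivExt R B →ₐ[R] R where
  toFun s := TrivSqZeroExt.fst s
  map_one' := rfl
  map_mul' _ _ := rfl
  map_zero' := rfl
  map_add' _ _ := rfl
  commutes' _ := rfl

/-- The projection `R ⋉ B → B`. -/
def sndHom : TrivExt R B →ₗ[R] B where
  toFun s := TrivSqZeroExt.snd s
  map_add' _ _ := rfl
  map_smul' _ _ := rfl

theorem isTrivialExt : IsTrivialExt (fstHom R B) (sndHom R B) where
  bijective := ⟨fun _ _ h => h, fun x => ⟨mk x.1 x.2, rfl⟩⟩
  mul _ _ := rfl

end TrivExt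

/-! ### The ring `R ⊕ C ⊕ B ⊕ D` of a pairing `C × B → D` -/

/-- `Q` is, through its coordinates `(ε, γ, β, δ)`, the ring `R ⊕ C ⊕ B ⊕ D` in which the product of
`C` and `B` is given by the pairing `p`, and `D` is annihilated by `C`, `B` and `D`. -/
structure IsPairingExt {R Q C B D : Type u} [CommRing R] [CommRing Q] [Algebra R Q]
    [AddCommGroup C] [AddCommGroup B] [AddCommGroup D] [Module R C] [Module R B] [Module R D]
    (p : C →ₗ[R] B →ₗ[R] D) (ε : Q →ₐ[R] R) (γ : Q →ₗ[R] C) (β : Q →ₗ[R] B) (δ : Q →ₗ[R] D) :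
    Prop where
  bijective : Function.Bijective
    (ε.toLinearMap.prod (γ.prod (β.prod δ)) : Q →ₗ[R] R × C × B × D)
  mul_γ : ∀ x y, γ (x * y) = ε x • γ y + ε y • γ x
  mul_β : ∀ x y, β (x * y) = ε x • β y + ε y • β x
  mul_δ : ∀ x y, δ (x * y) = ε x • δ y + ε y • δ x + p (γ x) (β y) + p (γ y) (β x)

/-- The ideal `ker ε ∩ ker γ` for an algebra map `ε` and a derivation `γ` over it. -/
def derivationKer {R Q C : Type u} [CommRing R] [CommRing Q] [Algebra R Q] [AddCommGroup C]
    [Module R C] (ε : Q →ₐ[R] R) (γ : Q →ₗ[R] C)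
    (hγ : ∀ x y, γ (x * y) = ε x • γ y + ε y • γ x) : Ideal Q where
  carrier := {q | ε q = 0 ∧ γ q = 0}
  add_mem' := fun hx hy => ⟨by rw [map_add, hx.1, hy.1, add_zero],
    by rw [map_add, hx.2, hy.2, add_zero]⟩
  zero_mem' := ⟨map_zero _, map_zero _⟩
  smul_mem' := fun q x hx => ⟨by rw [smul_eq_mul, map_mul, hx.1, mul_zero],
    by rw [smul_eq_mul, hγ, hx.1, hx.2, smul_zero, zero_smul, add_zero]⟩

section

variable {R Q C : Type u} [CommRing R] [CommRing Q] [Algebra R Q] [AddCommGroup C] [Module R C]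
  {ε : Q →ₐ[R] R} {γ : Q →ₗ[R] C} (hγ : ∀ x y, γ (x * y) = ε x • γ y + ε y • γ x)

theorem mem_derivationKer {q : Q} : q ∈ derivationKer ε γ hγ ↔ ε q = 0 ∧ γ q = 0 := Iff.rfl

/-- The algebra map induced by `ε` on the quotient by `derivationKer ε γ`. -/
def quotε : Q ⧸ derivationKer ε γ hγ →ₐ[R] R :=
  Ideal.Quotient.liftₐ _ ε fun _ h => h.1

/-- The derivation induced by `γ` on the quotient by `derivationKer ε γ`. -/
def quotγ : Q ⧸ derivationKer ε γ hγ →ₗ[R] C :=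
  ((derivationKer ε γ hγ).restrictScalars R).liftQ γ (fun _ h => h.2) ∘ₗ
    (Submodule.Quotient.restrictScalarsEquiv R (derivationKer ε γ hγ)).symm.toLinearMap

@[simp]
theorem quotγ_mk (q : Q) : quotγ hγ (Ideal.Quotient.mk _ q) = γ q := rfl

theorem isTrivialExt_quot (hs : ∀ r c, ∃ q, ε q = r ∧ γ q = c) :
    IsTrivialExt (quotε hγ) (quotγ hγ) where
  bijective := by
    constructor
    · rw [injective_iff_map_eq_zero]
      intro x hx
      obtain ⟨q, rfl⟩ := Ideal.Quotient.mk_surjective x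
      exact Ideal.Quotient.eq_zero_iff_mem.2 ⟨congrArg Prod.fst hx, congrArg Prod.snd hx⟩
    · rintro ⟨r, c⟩
      obtain ⟨q, rfl, rfl⟩ := hs r c
      exact ⟨Ideal.Quotient.mk _ q, rfl⟩
  mul x y := by
    obtain ⟨x, rfl⟩ := Ideal.Quotient.mk_surjective x
    obtain ⟨y, rfl⟩ := Ideal.Quotient.mk_surjective y
    exact hγ x y

end

namespace IsPairingExt

variable {R Q C B D : Type u} [CommRing R] [CommRing Q] [Algebra R Q] [AddCommGroup C]
  [AddCommGroup B] [AddCommGroup D] [Module R C] [Module R B] [Module R D]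
  {p : C →ₗ[R] B →ₗ[R] D} {ε : Q →ₐ[R] R} {γ : Q →ₗ[R] C} {β : Q →ₗ[R] B} {δ : Q →ₗ[R] D}

theorem symm (h : IsPairingExt p ε γ β δ) : IsPairingExt p.flip ε β γ δ where
  bijective := by
    constructor
    · intro x y hxy
      have h1 : ε x = ε y := congrArg Prod.fst hxy
      have h2 : β x = β y := congrArg (fun t => t.2.1) hxy
      have h3 : γ x = γ y := congrArg (fun t => t.2.2.1) hxy
      have h4 : δ x = δ y := congrArg (fun t => t.2.2.2) hxy
      exact h.bijective.1 (Prod.ext h1 (Prod.ext h3 (Prod.ext h2 h4)))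
    · rintro ⟨r, b, c, d⟩
      obtain ⟨q, hq⟩ := h.bijective.2 (r, c, b, d)
      have h1 : ε q = r := congrArg Prod.fst hq
      have h2 : γ q = c := congrArg (fun t => t.2.1) hq
      have h3 : β q = b := congrArg (fun t => t.2.2.1) hq
      have h4 : δ q = d := congrArg (fun t => t.2.2.2) hq
      exact ⟨q, Prod.ext h1 (Prod.ext h3 (Prod.ext h2 h4))⟩
  mul_γ := h.mul_β
  mul_β := h.mul_γ
  mul_δ x y := by
    rw [h.mul_δ, LinearMap.flip_apply, LinearMap.flip_apply]
    abel

variable (h : IsPairingExt p ε γ β δ)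
include h

theorem ext {x y : Q} (h1 : ε x = ε y) (h2 : γ x = γ y) (h3 : β x = β y) (h4 : δ x = δ y) :
    x = y :=
  h.bijective.1 (Prod.ext h1 (Prod.ext h2 (Prod.ext h3 h4)))

theorem exists_eq (r : R) (c : C) (b : B) (d : D) :
    ∃ q, ε q = r ∧ γ q = c ∧ β q = b ∧ δ q = d := by
  obtain ⟨q, hq⟩ := h.bijective.2 (r, c, b, d)
  exact ⟨q, congrArg Prod.fst hq, congrArg (fun t => t.2.1) hq, congrArg (fun t => t.2.2.1) hq,
    congrArg (fun t => t.2.2.2) hq⟩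

theorem γ_one : γ 1 = 0 := by simpa using h.mul_γ 1 1

theorem β_one : β 1 = 0 := by simpa using h.mul_β 1 1

theorem δ_one : δ 1 = 0 := by simpa [h.γ_one, h.β_one] using h.mul_δ 1 1

theorem surjective : Function.Surjective ε := fun r => by
  obtain ⟨q, hq, -⟩ := h.exists_eq r 0 0 0
  exact ⟨q, hq⟩

theorem isNilpotent {x : Q} (hx : ε x = 0) : IsNilpotent x := by
  have h1 : γ (x * x) = 0 := by simp [h.mul_γ, hx]
  have h2 : β (x * x) = 0 := by simp [h.mul_β, hx]
  refine ⟨3, h.ext ?_ ?_ ?_ ?_⟩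
  · simp [hx]
  · rw [pow_succ, sq, h.mul_γ, h1, hx]; simp [hx]
  · rw [pow_succ, sq, h.mul_β, h2, hx]; simp [hx]
  · rw [pow_succ, sq, h.mul_δ, h1, h2, hx]; simp [hx]

theorem isLocalRing [IsLocalRing R] : IsLocalRing Q := by
  have : IsLocalHom ε.toRingHom := by
    refine ⟨fun s hs => ?_⟩
    have hs' : IsUnit (algebraMap R Q (ε s)) := RingHom.isUnit_map _ hs
    have hn : IsNilpotent (s - algebraMap R Q (ε s)) := h.isNilpotent (by simp)
    have := hn.isUnit_add_left_of_commute hs' (Commute.all _ _)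
    rwa [add_sub_cancel] at this
  exact RingHom.domain_isLocalRing ε.toRingHom

theorem finite [Module.Finite R C] [Module.Finite R B] [Module.Finite R D] : Module.Finite R Q :=
  Module.Finite.equiv (LinearEquiv.ofBijective _ h.bijective).symm

theorem isTrivialExt_left : IsTrivialExt (quotε h.mul_γ) (quotγ h.mul_γ) :=
  isTrivialExt_quot h.mul_γ fun r c => by
    obtain ⟨q, h1, h2, -⟩ := h.exists_eq r c 0 0
    exact ⟨q, h1, h2⟩

theorem extAcyclic (hp : DualPair p) : ExtAcyclic R Q D :=
  ((extAcyclic_of_projective R D).prod (hp.ext_left.prod (hp.ext_right.prod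
    hp.dualizing.ext_eq_zero))).of_equiv (LinearEquiv.ofBijective _ h.bijective).symm

theorem isPerfectForm (hp : DualPair p) : IsPerfectForm δ := by
  constructor
  · rw [injective_iff_map_eq_zero]
    intro q hq
    have h1 : ∀ t, δ (t * q) = 0 := fun t => congrArg (fun f => CoindHom.toHom f t) hq
    have hδ : δ q = 0 := by simpa using h1 1
    refine h.ext ?_ ?_ ?_ ?_
    · rw [map_zero]
      refine hp.dualizing.homothety_bijective.1 (LinearMap.ext fun d => ?_)
      obtain ⟨t, t1, t2, t3, t4⟩ := h.exists_eq 0 0 0 d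
      have := h1 t
      rw [h.mul_δ, t1, t2, t3, t4] at this
      simpa using this
    · rw [map_zero]
      refine hp.bijective.1 (LinearMap.ext fun b => ?_)
      obtain ⟨t, t1, t2, t3, t4⟩ := h.exists_eq 0 0 b 0
      have := h1 t
      rw [h.mul_δ, t1, t2, t3, t4] at this
      simpa using this
    · rw [map_zero]
      refine hp.bijective_flip.1 (LinearMap.ext fun c => ?_)
      obtain ⟨t, t1, t2, t3, t4⟩ := h.exists_eq 0 c 0 0
      have := h1 t
      rw [h.mul_δ, t1, t2, t3, t4] at this
      simpa using this
    · rw [hδ, map_zero]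
  · intro Φ
    let e : Q ≃ₗ[R] R × C × B × D := LinearEquiv.ofBijective _ h.bijective
    have he : ∀ q, e q = (ε q, γ q, β q, δ q) := fun _ => rfl
    let Ψ : R × C × B × D →ₗ[R] D := CoindHom.toHom Φ ∘ₗ e.symm.toLinearMap
    have hΨ : ∀ q, CoindHom.toHom Φ q = Ψ (ε q, γ q, β q, δ q) := fun q => by
      rw [← he]; simp [Ψ]
    obtain ⟨b, hb⟩ := hp.bijective_flip.2
      (Ψ ∘ₗ LinearMap.inr R R (C × B × D) ∘ₗ LinearMap.inl R C (B × D))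
    obtain ⟨c, hc⟩ := hp.bijective.2
      (Ψ ∘ₗ LinearMap.inr R R (C × B × D) ∘ₗ LinearMap.inr R C (B × D) ∘ₗ LinearMap.inl R B D)
    obtain ⟨r, hr⟩ := hp.dualizing.homothety_bijective.2
      (Ψ ∘ₗ LinearMap.inr R R (C × B × D) ∘ₗ LinearMap.inr R C (B × D) ∘ₗ LinearMap.inr R B D)
    have hb' : ∀ x, p x b = Ψ (0, x, 0, 0) := fun x => LinearMap.congr_fun hb x
    have hc' : ∀ x, p c x = Ψ (0, 0, x, 0) := fun x => LinearMap.congr_fun hc x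
    have hr' : ∀ x, r • x = Ψ (0, 0, 0, x) := fun x => LinearMap.congr_fun hr x
    obtain ⟨q, q1, q2, q3, q4⟩ := h.exists_eq r c b (Ψ (1, 0, 0, 0))
    refine ⟨q, CoindHom.hom_ext fun t => ?_⟩
    rw [CoindHom.toHom_curry_apply, smul_eq_mul, h.mul_δ, q1, q2, q3, q4, hr', hb', hc', hΨ,
      ← map_smul, ← map_add, ← map_add, ← map_add]
    simp

theorem isGorensteinLocal (hp : DualPair p) (hR : IsNoetherianRing R) (hR' : IsLocalRing R) :
    IsGorensteinLocal Q := by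
  have := hp.left.finite
  have := hp.right.finite
  have := hp.dualizing.finite
  have := h.finite
  exact (h.isPerfectForm hp).isGorensteinLocal (IsNoetherianRing.of_finite R Q) h.isLocalRing
    (h.extAcyclic hp) hp.dualizing.injectiveDimension_ne_top

/-! ### The two ideals -/

theorem mem_of_mul_mem (hp : Function.Surjective (TensorProduct.lift p)) {I : Ideal Q}
    (hI : ∀ x y, ε x = 0 → γ x = 0 → δ x = 0 → ε y = 0 → β y = 0 → δ y = 0 → x * y ∈ I) {q : Q}
    (h1 : ε q = 0) (h2 : γ q = 0) (h3 : β q = 0) : q ∈ I := by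
  obtain ⟨t, ht⟩ := hp (δ q)
  induction t generalizing q with
  | zero =>
    have : q = 0 := h.ext (by simpa) (by simpa) (by simpa) (by simpa using ht.symm)
    rw [this]
    exact I.zero_mem
  | tmul c b =>
    obtain ⟨x, x1, x2, x3, x4⟩ := h.exists_eq 0 0 b 0
    obtain ⟨y, y1, y2, y3, y4⟩ := h.exists_eq 0 c 0 0
    have : q = x * y := by
      refine h.ext ?_ ?_ ?_ ?_
      · simp [h1, x1]
      · simp [h.mul_γ, h2, x1, y1]
      · simp [h.mul_β, h3, x1, y1]
      · rw [← ht, h.mul_δ, x1, x2, x3, y1, y2, y3]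
        simp
    rw [this]
    exact hI x y x1 x2 x4 y1 y3 y4
  | add s t hs ht' =>
    obtain ⟨x, x1, x2, x3, x4⟩ := h.exists_eq 0 0 0 (TensorProduct.lift p s)
    obtain ⟨y, y1, y2, y3, y4⟩ := h.exists_eq 0 0 0 (TensorProduct.lift p t)
    have : q = x + y := by
      refine h.ext ?_ ?_ ?_ ?_
      · simp [h1, x1, y1]
      · simp [h2, x2, y2]
      · simp [h3, x3, y3]
      · rw [← ht, map_add, map_add, x4, y4]
    rw [this]
    exact I.add_mem (hs x1 x2 x3 x4.symm) (ht' y1 y2 y3 y4.symm)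

theorem inf_eq_mul (hp : Function.Surjective (TensorProduct.lift p)) :
    derivationKer ε γ h.mul_γ ⊓ derivationKer ε β h.mul_β =
      derivationKer ε γ h.mul_γ * derivationKer ε β h.mul_β := by
  refine le_antisymm (fun q hq => ?_) Ideal.mul_le_inf
  refine h.mem_of_mul_mem hp (fun x y x1 x2 _ y1 y2 _ => ?_) hq.1.1 hq.1.2 hq.2.2
  exact Ideal.mul_mem_mul ((mem_derivationKer _).2 ⟨x1, x2⟩) ((mem_derivationKer _).2 ⟨y1, y2⟩)

theorem mem_sup {q : Q} :
    q ∈ derivationKer ε γ h.mul_γ ⊔ derivationKer ε β h.mul_β ↔ ε q = 0 := by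
  constructor
  · intro hq
    obtain ⟨x, hx, y, hy, rfl⟩ := Submodule.mem_sup.1 hq
    rw [map_add, hx.1, hy.1, add_zero]
  · intro hq
    obtain ⟨x, x1, x2, x3, x4⟩ := h.exists_eq 0 0 (β q) 0
    refine Submodule.mem_sup.2 ⟨x, ⟨x1, x2⟩, q - x, ⟨?_, ?_⟩, add_sub_cancel _ _⟩
    · rw [map_sub, hq, x1, sub_zero]
    · rw [map_sub, x3, sub_self]

end IsPairingExt

namespace IsPairingExt

variable {R Q C B D : Type u} [CommRing R] [CommRing Q] [Algebra R Q] [AddCommGroup C]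
  [AddCommGroup B] [AddCommGroup D] [Module R C] [Module R B] [Module R D]
  {p : C →ₗ[R] B →ₗ[R] D} {ε : Q →ₐ[R] R} {γ : Q →ₗ[R] C} {β : Q →ₗ[R] B} {δ : Q →ₗ[R] D}

/-- `C ⊕ D ≅ Hom_R(R ⋉ B, D)`. -/
theorem exists_dual_equiv (h : IsPairingExt p ε γ β δ) (hp : Function.Bijective p) {S : Type u}
    [CommRing S] [Algebra R S] {ε' : S →ₐ[R] R} {l : S →ₗ[R] B} (hl : IsTrivialExt ε' l) :
    ∃ θ : derivationKer ε β h.mul_β ≃+ CoindHom R S D,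
      ∀ (q : Q) (s : S) (i : derivationKer ε β h.mul_β), ε q = ε' s → β q = l s →
        θ (q • i) = s • θ i := by
  let f : derivationKer ε β h.mul_β →+ CoindHom R S D :=
    { toFun := fun i => CoindHom.toHom.symm (ε'.toLinearMap.smulRight (δ i) + p (γ i) ∘ₗ l)
      map_zero' := by
        refine CoindHom.hom_ext fun s => ?_
        change ε' s • δ ((0 : derivationKer ε β h.mul_β) : Q) + p (γ 0) (l s) = 0
        simp
      map_add' := fun i j => by
        refine CoindHom.hom_ext fun s => ?_
        change ε' s • δ (i + j : Q) + p (γ (i + j : Q)) (l s) =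
          (ε' s • δ i + p (γ i) (l s)) + (ε' s • δ j + p (γ j) (l s))
        rw [map_add, map_add, map_add, LinearMap.add_apply, smul_add]
        abel }
  have hf : ∀ i s, CoindHom.toHom (f i) s = ε' s • δ i + p (γ i) (l s) := fun _ _ => rfl
  have hbij : Function.Bijective f := by
    constructor
    · rw [injective_iff_map_eq_zero]
      intro i hi
      have h1 : ∀ s, ε' s • δ i + p (γ i) (l s) = 0 := fun s => by rw [← hf, hi]; rfl
      refine Subtype.ext (h.ext ?_ ?_ ?_ ?_)
      · rw [i.2.1]; simp
      · change γ i = γ 0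
        rw [map_zero]
        refine hp.1 (LinearMap.ext fun b => ?_)
        obtain ⟨s, s1, s2⟩ := hl.exists_eq 0 b
        simpa [s1, s2] using h1 s
      · rw [i.2.2]; simp
      · change δ i = δ 0
        simpa [hl.map_one] using h1 1
    · intro Φ
      let e := hl.equiv
      obtain ⟨c, hc⟩ := hp.2 (CoindHom.toHom Φ ∘ₗ e.symm.toLinearMap ∘ₗ LinearMap.inr R R B)
      obtain ⟨q, q1, q2, q3, q4⟩ := h.exists_eq 0 c 0 (CoindHom.toHom Φ (e.symm (1, 0)))
      refine ⟨⟨q, q1, q3⟩, CoindHom.hom_ext fun s => ?_⟩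
      have hc' : p c (l s) = CoindHom.toHom Φ (e.symm (0, l s)) := LinearMap.congr_fun hc _
      rw [hf, q4, q2, hc', ← map_smul, ← map_add, ← map_smul, ← map_add]
      congr 1
      rw [LinearEquiv.symm_apply_eq]
      change _ = (ε' s, l s)
      simp
  refine ⟨AddEquiv.ofBijective f hbij, fun q s i h1 h2 => CoindHom.hom_ext fun t => ?_⟩
  have e1 : δ (q * i) = ε' s • δ i + p (γ i) (l s) := by
    rw [h.mul_δ, i.2.1, i.2.2, h1, h2]; simp
  have e2 : γ (q * i) = ε' s • γ i := by
    rw [h.mul_γ, i.2.1, h1]; simp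
  change ε' t • δ (q * i) + p (γ (q * i)) (l t) = ε' (s * t) • δ i + p (γ i) (l (s * t))
  rw [e1, e2, hl.mul, map_mul, smul_add, smul_smul, mul_comm (ε' t), map_smul,
    LinearMap.smul_apply, map_add, map_smul, map_smul]
  abel

/-- The ring embedding `R ⋉ B → Q`. -/
def ofTrivExt (h : IsPairingExt p ε γ β δ) : TrivExt R B →+* Q :=
  let e : Q ≃ₗ[R] R × C × B × D := LinearEquiv.ofBijective _ h.bijective
  let f : TrivExt R B → Q := fun s => e.symm (TrivExt.fstHom R B s, 0, TrivExt.sndHom R B s, 0)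
  have hf : ∀ s, (ε (f s), γ (f s), β (f s), δ (f s)) =
    (TrivExt.fstHom R B s, 0, TrivExt.sndHom R B s, 0) := fun _ => e.apply_symm_apply _
  have h1 : ∀ s, ε (f s) = TrivExt.fstHom R B s := fun s => congrArg Prod.fst (hf s)
  have h2 : ∀ s, γ (f s) = 0 := fun s => congrArg (fun t => t.2.1) (hf s)
  have h3 : ∀ s, β (f s) = TrivExt.sndHom R B s := fun s => congrArg (fun t => t.2.2.1) (hf s)
  have h4 : ∀ s, δ (f s) = 0 := fun s => congrArg (fun t => t.2.2.2) (hf s)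
  { toFun := f
    map_one' := h.ext (by rw [h1, map_one, map_one]) (by rw [h2, h.γ_one])
      (by rw [h3, h.β_one, (TrivExt.isTrivialExt R B).map_one]) (by rw [h4, h.δ_one])
    map_mul' := fun s t => h.ext (by simp [h1]) (by simp [h2, h.mul_γ])
      (by simp [h1, h3, h.mul_β, (TrivExt.isTrivialExt R B).mul]) (by simp [h2, h4, h.mul_δ])
    map_zero' := h.ext (by simp [h1]) (by simp [h2]) (by simp [h3]) (by simp [h4])
    map_add' := fun s t => h.ext (by simp [h1]) (by simp [h2]) (by simp [h3]) (by simp [h4]) }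

theorem ofTrivExt_apply (h : IsPairingExt p ε γ β δ) (s : TrivExt R B) :
    ε (h.ofTrivExt s) = TrivExt.fstHom R B s ∧ γ (h.ofTrivExt s) = 0 ∧
      β (h.ofTrivExt s) = TrivExt.sndHom R B s ∧ δ (h.ofTrivExt s) = 0 := by
  have hf : (ε (h.ofTrivExt s), γ (h.ofTrivExt s), β (h.ofTrivExt s), δ (h.ofTrivExt s)) =
      (TrivExt.fstHom R B s, 0, TrivExt.sndHom R B s, 0) :=
    (LinearEquiv.ofBijective _ h.bijective).apply_symm_apply _
  exact ⟨congrArg Prod.fst hf, congrArg (fun t => t.2.1) hf, congrArg (fun t => t.2.2.1) hf,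
    congrArg (fun t => t.2.2.2) hf⟩

section

variable {S : Type u} [CommRing S] [Algebra R S] [Algebra S Q] {ε' : S →ₐ[R] R} {l : S →ₗ[R] B}
  (h : IsPairingExt p ε γ β δ) (hS : IsTrivialExt ε' l)
  (hA : ∀ s, ε (algebraMap S Q s) = ε' s ∧ γ (algebraMap S Q s) = 0 ∧ β (algebraMap S Q s) = l s ∧
    δ (algebraMap S Q s) = 0)

/-- The projection of `Q` onto its subring `R ⊕ B`. -/
def toTrivExt : Q →ₗ[S] S where
  toFun q := hS.equiv.symm (ε q, β q)
  map_add' x y := by rw [map_add, map_add, ← Prod.mk_add_mk, map_add]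
  map_smul' s x := by
    rw [LinearEquiv.symm_apply_eq, Algebra.smul_def, map_mul, h.mul_β, (hA s).1, (hA s).2.2.1]
    obtain ⟨t, t1, t2⟩ := hS.exists_eq (ε x) (β x)
    have h1 : hS.equiv.symm (ε x, β x) = t := by
      rw [LinearEquiv.symm_apply_eq, ← t1, ← t2]; rfl
    rw [h1, ← t1, ← t2]
    change _ = (ε' (s * t), l (s * t))
    rw [map_mul, hS.mul]

theorem toTrivExt_algebraMap (s : S) : h.toTrivExt hS hA (algebraMap _ Q s) = s := by
  change hS.equiv.symm _ = s
  rw [LinearEquiv.symm_apply_eq, (hA s).1, (hA s).2.2.1]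
  rfl

theorem toTrivExt_eq_zero {q : Q} :
    h.toTrivExt hS hA q = 0 ↔ q ∈ derivationKer ε β h.mul_β := by
  change hS.equiv.symm _ = 0 ↔ _
  rw [map_eq_zero_iff _ (LinearEquiv.injective _), Prod.ext_iff]
  rfl

include hS hA

theorem nonempty_equiv_prod :
    Nonempty (Q ≃ₗ[S] S × derivationKer ε β h.mul_β) := by
  have hker : ∀ q : Q, q - algebraMap _ Q (h.toTrivExt hS hA q) ∈ derivationKer ε β h.mul_β :=
    fun q => by
      rw [← h.toTrivExt_eq_zero hS hA, map_sub, h.toTrivExt_algebraMap hS hA, sub_self]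
  let f : Q →ₗ[S] derivationKer ε β h.mul_β :=
    { toFun := fun q => ⟨q - algebraMap _ Q (h.toTrivExt hS hA q), hker q⟩
      map_add' := fun x y => Subtype.ext (by
        change x + y - algebraMap _ Q (h.toTrivExt hS hA (x + y)) =
          (x - algebraMap _ Q (h.toTrivExt hS hA x)) + (y - algebraMap _ Q (h.toTrivExt hS hA y))
        rw [map_add, map_add]; ring)
      map_smul' := fun s x => Subtype.ext (by
        change s • x - algebraMap _ Q (h.toTrivExt hS hA (s • x)) =
          s • (x - algebraMap _ Q (h.toTrivExt hS hA x))
        rw [map_smul, smul_eq_mul, map_mul, Algebra.smul_def, Algebra.smul_def, mul_sub]) }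
  have hf : ∀ q, (f q : Q) = q - algebraMap _ Q (h.toTrivExt hS hA q) := fun _ => rfl
  refine ⟨LinearEquiv.ofBijective ((h.toTrivExt hS hA).prod f) ⟨fun x y hxy => ?_, ?_⟩⟩
  · have e1 : h.toTrivExt hS hA x = h.toTrivExt hS hA y := congrArg Prod.fst hxy
    have e2 : (f x : Q) = f y := congrArg (fun t => (t.2 : Q)) hxy
    rwa [hf, hf, e1, sub_left_inj] at e2
  · rintro ⟨s, i⟩
    have e1 : h.toTrivExt hS hA i = 0 := (h.toTrivExt_eq_zero hS hA).2 i.2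
    have e2 : h.toTrivExt hS hA (algebraMap _ Q s + i) = s := by
      rw [map_add, h.toTrivExt_algebraMap hS hA, e1, add_zero]
    refine ⟨algebraMap _ Q s + i, Prod.ext e2 (Subtype.ext ?_)⟩
    change (f (algebraMap _ Q s + i) : Q) = i
    rw [hf, e2, add_sub_cancel_left]

theorem nonempty_quot_equiv :
    Nonempty ((Q ⧸ derivationKer ε β h.mul_β) ≃ₗ[S] S) := by
  have h1 : Function.Surjective (h.toTrivExt hS hA) := fun s => ⟨_, h.toTrivExt_algebraMap hS hA s⟩
  have h2 : (derivationKer ε β h.mul_β).restrictScalars (S) =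
      LinearMap.ker (h.toTrivExt hS hA) := by
    ext q
    rw [LinearMap.mem_ker, h.toTrivExt_eq_zero hS hA, Submodule.restrictScalars_mem]
  exact ⟨(Submodule.Quotient.restrictScalarsEquiv (S)
    (derivationKer ε β h.mul_β)).symm.trans ((Submodule.quotEquivOfEq _ _ h2).trans
      ((h.toTrivExt hS hA).quotKerEquivOfSurjective h1))⟩

theorem exists_hasInjectiveDimensionLT [IsNoetherianRing R] (hp : DualPair p) :
    ∃ n, HasInjectiveDimensionLT
      (ModuleCat.of (S) (derivationKer ε β h.mul_β)) n := by
  have := hp.right.finite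
  have := hS.finite
  obtain ⟨θ, hθ⟩ := h.exists_dual_equiv hp.bijective hS
  let θ' : derivationKer ε β h.mul_β ≃ₗ[S] CoindHom R (S) D :=
    { θ with
      map_smul' := fun s i => by
        change θ (s • i) = s • θ i
        rw [← hθ (algebraMap _ Q s) s i (hA s).1 (hA s).2.2.1,
          algebraMap_smul] }
  obtain ⟨n, hn⟩ :=
    (hp.dualizing.coindHom (hS.extAcyclic hp.ext_right)).exists_hasInjectiveDimensionLT
  exact ⟨n, hasInjectiveDimensionLT_of_iso θ'.symm.toModuleIso n⟩

theorem map_ker (hp : Function.Surjective (TensorProduct.lift p)) :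
    (RingHom.ker ε').map (algebraMap S Q) = derivationKer ε γ h.mul_γ := by
  refine le_antisymm (Ideal.map_le_iff_le_comap.2 fun s hs => ⟨?_, (hA s).2.1⟩) fun q hq => ?_
  · rw [(hA s).1]; exact hs
  · have h0 : ∀ b, ∃ x ∈ (RingHom.ker ε').map (algebraMap S Q), ε x = 0 ∧ γ x = 0 ∧ β x = b ∧
        δ x = 0 := fun b => by
      obtain ⟨s, s1, s2⟩ := hS.exists_eq 0 b
      exact ⟨_, Ideal.mem_map_of_mem _ (RingHom.mem_ker.2 s1), (hA s).1.trans s1, (hA s).2.1,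
        (hA s).2.2.1.trans s2, (hA s).2.2.2⟩
    obtain ⟨z, z0, z1, z2, z3, z4⟩ := h0 (β q)
    rw [← sub_add_cancel q z]
    refine Ideal.add_mem _ (h.mem_of_mul_mem hp (fun x y x1 x2 x3 _ _ _ => ?_) ?_ ?_ ?_) z0
    · obtain ⟨w, w0, w1, w2, w3, w4⟩ := h0 (β x)
      rw [show x = w from h.ext (x1.trans w1.symm) (x2.trans w2.symm) w3.symm (x3.trans w4.symm)]
      exact Ideal.mul_mem_right _ _ w0
    · rw [map_sub, hq.1, z1, sub_zero]
    · rw [map_sub, hq.2, z2, sub_zero]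
    · rw [map_sub, z3, sub_self]

theorem nonempty_tensor_equiv (hp : Function.Surjective (TensorProduct.lift p)) :
    Nonempty (Q ⊗[S] (ModuleCat.restrictScalars
      (ε' : S →+* R)).obj (ModuleCat.of R R) ≃ₗ[Q]
        Q ⧸ derivationKer ε γ h.mul_γ) := by
  let g : S →ₗ[S] (ModuleCat.restrictScalars
      (ε' : S →+* R)).obj (ModuleCat.of R R) :=
    { toFun := fun s => ε' s
      map_add' := fun x y => map_add (ε') x y
      map_smul' := fun x y => map_mul (ε') x y }
  let J : Ideal (S) := RingHom.ker (ε')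
  have hg : ∀ s, g s = 0 ↔ Submodule.mkQ J s = 0 := fun s => by
    rw [Submodule.mkQ_apply, Submodule.Quotient.mk_eq_zero]
    rfl
  obtain ⟨e⟩ := nonempty_equiv_of_ker_eq hS.surjective
    (Submodule.mkQ_surjective J) hg
  exact ⟨(e.baseChange (S) Q _ _).trans
    ((Algebra.TensorProduct.quotIdealMapEquivTensorQuot Q J).toLinearEquiv.symm.trans
      (Submodule.quotEquivOfEq _ _ (h.map_ker hS hA hp)))⟩

end

/-- `Q/(B ⊕ D)` has a two-sided resolution over `Q` whose syzygies have vanishing `Ext^1` into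
`Q` and `Q/(C ⊕ D)`, and vanishing `Tor_1` with `Q/(C ⊕ D)`. -/
theorem exists_syzygyFamily [IsNoetherianRing R] (h : IsPairingExt p ε γ β δ) (hp : DualPair p) :
    ∃ F : SyzygyFamily Q, Nonempty (F.Z 0 ≃ₗ[Q] Q ⧸ derivationKer ε γ h.mul_γ) ∧
      (∀ i, ExtZero Q (F.Z i) Q 1) ∧
      (∀ i, ExtZero Q (F.Z i) (Q ⧸ derivationKer ε β h.mul_β) 1) ∧
      ∀ i, TorOneZero Q (F.Z i) (Q ⧸ derivationKer ε β h.mul_β) := by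
  have := hp.right.finite
  have hS := TrivExt.isTrivialExt R B
  have := hS.isNoetherianRing
  let _ : Algebra (TrivExt R B) Q := h.ofTrivExt.toAlgebra
  have hA := h.ofTrivExt_apply
  obtain ⟨n, hn⟩ := h.exists_hasInjectiveDimensionLT hS hA hp
  obtain ⟨e⟩ := h.nonempty_equiv_prod hS hA
  obtain ⟨eN⟩ := h.nonempty_quot_equiv hS hA
  obtain ⟨e'⟩ := h.nonempty_tensor_equiv hS hA hp.surjective
  obtain ⟨F, ⟨e0⟩, hF⟩ := (hS.isReflexiveModule hp.right).exists_baseChange hn e eN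
  exact ⟨F, ⟨e0.trans e'⟩, hF⟩

end IsPairingExt

/-! ### Cyclic semidualizing modules are free -/

section Cyclic

variable {R : Type u} [CommRing R] {B C D : Type u} [AddCommGroup B] [Module R B]
  [AddCommGroup C] [Module R C] [AddCommGroup D] [Module R D]

theorem IsSemidualizing.nonempty_equiv_of_cyclic (hB : IsSemidualizing R B) (b : B)
    (hb : ∀ x, ∃ r : R, r • b = x) : Nonempty (R ≃ₗ[R] B) := by
  refine ⟨LinearEquiv.ofBijective (LinearMap.toSpanSingleton R B b) ⟨?_, fun x => ?_⟩⟩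
  · rw [injective_iff_map_eq_zero]
    intro r hr
    refine hB.homothety_bijective.1 (LinearMap.ext fun x => ?_)
    obtain ⟨s, rfl⟩ := hb x
    have hr' : r • b = 0 := hr
    simp [hr']
  · obtain ⟨r, rfl⟩ := hb x
    exact ⟨r, rfl⟩

/-- The number of generators of a finitely generated module over a local ring. -/
def residueRank (R M : Type*) [CommRing R] [IsLocalRing R] [AddCommGroup M] [Module R M] : ℕ :=
  Module.finrank (IsLocalRing.ResidueField R) (IsLocalRing.ResidueField R ⊗[R] M)

variable [IsLocalRing R]

theorem residueRank_tensor (M N : Type u) [AddCommGroup M] [AddCommGroup N] [Module R M]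
    [Module R N] : residueRank R (M ⊗[R] N) = residueRank R M * residueRank R N := by
  rw [residueRank, (TensorProduct.AlgebraTensorModule.distribBaseChange R
    (IsLocalRing.ResidueField R) M N).finrank_eq, Module.finrank_tensorProduct]
  rfl

theorem residueRank_congr {M N : Type u} [AddCommGroup M] [AddCommGroup N] [Module R M]
    [Module R N] (e : M ≃ₗ[R] N) : residueRank R M = residueRank R N :=
  (e.baseChange R (IsLocalRing.ResidueField R) _ _).finrank_eq

theorem residueRank_ne_zero (M : Type u) [AddCommGroup M] [Module R M] [Module.Finite R M]
    [Nontrivial M] : residueRank R M ≠ 0 := by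
  intro h
  have h1 : Subsingleton (IsLocalRing.ResidueField R ⊗[R] M) :=
    Module.finrank_zero_iff.1 h
  have h2 : (⊥ : Submodule R M) = ⊤ :=
    IsLocalRing.map_tensorProduct_mk_eq_top.1 (Subsingleton.elim _ _)
  exact bot_ne_top h2

theorem exists_generator_of_residueRank_eq_one {M : Type u} [AddCommGroup M] [Module R M]
    [Module.Finite R M] (h : residueRank R M = 1) : ∃ m : M, ∀ x, ∃ r : R, r • m = x := by
  have hnt : Nontrivial (IsLocalRing.ResidueField R ⊗[R] M) :=
    Module.nontrivial_of_finrank_pos (R := IsLocalRing.ResidueField R)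
      (by rw [residueRank] at h; omega)
  have hsurj : Function.Surjective (TensorProduct.mk R (IsLocalRing.ResidueField R) M 1) :=
    TensorProduct.mk_surjective _ _ _ Ideal.Quotient.mk_surjective
  obtain ⟨v, hv⟩ := exists_ne (0 : IsLocalRing.ResidueField R ⊗[R] M)
  obtain ⟨m, rfl⟩ := hsurj v
  refine ⟨m, fun x => ?_⟩
  have h1 : Submodule.span R {m} = ⊤ := by
    refine IsLocalRing.map_tensorProduct_mk_eq_top.1 (eq_top_iff.2 fun w _ => ?_)
    obtain ⟨a, rfl⟩ := (finrank_eq_one_iff_of_nonzero' _ hv).1 h w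
    obtain ⟨r, rfl⟩ := Ideal.Quotient.mk_surjective a
    exact ⟨r • m, Submodule.smul_mem _ _ (Submodule.mem_span_singleton_self m), by
      rw [map_smul]; rfl⟩
  exact Submodule.mem_span_singleton.1 (h1 ▸ Submodule.mem_top)

theorem IsSemidualizing.nontrivial (hB : IsSemidualizing R B) : Nontrivial B := by
  by_contra h
  rw [not_nontrivial_iff_subsingleton] at h
  exact one_ne_zero (hB.homothety_bijective.1 (LinearMap.ext fun _ => Subsingleton.elim _ _) :
    (1 : R) = 0)

/-- If `Hom_R(C, D)` is dualizing, then `C` is free. -/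
theorem IsSemidualizing.free_of_isDualizing [IsNoetherianRing R] (hC : IsSemidualizing R C)
    (hD : IsDualizing R D) (hB : IsDualizing R (C →ₗ[R] D)) : Module.Free R C := by
  have := hC.finite
  have := hD.finite
  have := hD.toIsSemidualizing.nontrivial
  obtain ⟨n, hn⟩ := hD.exists_hasInjectiveDimensionLT
  obtain ⟨m, hm⟩ := hB.exists_hasInjectiveDimensionLT
  have h1 := residueRank_congr (LinearEquiv.ofBijective _
    (hC.eval_bijective hn (hC.extAcyclic n D hn)))
  have h2 := residueRank_congr (LinearEquiv.ofBijective _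
    (hD.toIsSemidualizing.eval_bijective hm (hD.toIsSemidualizing.extAcyclic m _ hm)))
  rw [residueRank_tensor] at h1 h2
  have h3 := residueRank_ne_zero (R := R) D
  have h4 : residueRank R C = 1 := by
    rw [← h2, mul_left_comm] at h1
    have h5 : residueRank R C * residueRank R (D →ₗ[R] C →ₗ[R] D) = 1 :=
      Nat.eq_of_mul_eq_mul_left (Nat.pos_of_ne_zero h3) (by rw [h1, mul_one])
    exact Nat.eq_one_of_mul_eq_one_right h5
  obtain ⟨c, hc⟩ := exists_generator_of_residueRank_eq_one h4
  obtain ⟨e⟩ := hC.nonempty_equiv_of_cyclic c hc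
  exact Module.Free.of_equiv e

end Cyclic

namespace IsPairingExt

variable {R Q C B D : Type u} [CommRing R] [CommRing Q] [Algebra R Q] [AddCommGroup C]
  [AddCommGroup B] [AddCommGroup D] [Module R C] [Module R B] [Module R D]
  {p : C →ₗ[R] B →ₗ[R] D} {ε : Q →ₐ[R] R} {γ : Q →ₗ[R] C} {β : Q →ₗ[R] B} {δ : Q →ₗ[R] D}

/-- If `Hom_Q(Q/(B ⊕ D), Q/(C ⊕ D))` is cyclic, then so is `B`. -/
theorem exists_generator (h : IsPairingExt p ε γ β δ) (hB : IsSemidualizing R B)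
    (hc : (⊤ : Submodule Q ((Q ⧸ derivationKer ε γ h.mul_γ) →ₗ[Q]
      (Q ⧸ derivationKer ε β h.mul_β))).IsPrincipal) : ∃ b : B, ∀ x, ∃ r : R, r • b = x := by
  obtain ⟨φ₀, hφ₀⟩ := hc
  refine ⟨quotγ h.mul_β (φ₀ 1), fun x => ?_⟩
  have h0 : quotε h.mul_β (φ₀ 1) = 0 := by
    refine hB.homothety_bijective.1 (LinearMap.ext fun b => ?_)
    obtain ⟨q, q1, q2, q3, q4⟩ := h.exists_eq 0 0 b 0
    have h1 : q • (1 : Q ⧸ derivationKer ε γ h.mul_γ) = 0 := by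
      rw [Algebra.smul_def, mul_one]
      exact Ideal.Quotient.eq_zero_iff_mem.2 ⟨q1, q2⟩
    have h2 : q • φ₀ 1 = 0 := by rw [← map_smul, h1, map_zero]
    rw [Algebra.smul_def] at h2
    have h3 := congrArg (quotγ h.mul_β) h2
    rw [h.symm.isTrivialExt_left.mul] at h3
    change ε q • _ + quotε h.mul_β (φ₀ 1) • β q = _ at h3
    rw [q1, q3, zero_smul, zero_add, map_zero] at h3
    rw [LinearMap.lsmul_apply, h3, map_zero, LinearMap.zero_apply]
  obtain ⟨q, q1, q2, q3, q4⟩ := h.exists_eq 0 0 x 0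
  let φ : (Q ⧸ derivationKer ε γ h.mul_γ) →ₗ[Q] (Q ⧸ derivationKer ε β h.mul_β) :=
    (derivationKer ε γ h.mul_γ).liftQ
      (Submodule.mkQ (derivationKer ε β h.mul_β) ∘ₗ LinearMap.mulRight Q q) fun y hy => by
      refine (Submodule.Quotient.mk_eq_zero _).2 ⟨?_, ?_⟩
      · rw [LinearMap.mulRight_apply, map_mul, q1, mul_zero]
      · rw [LinearMap.mulRight_apply, h.mul_β, q1, hy.1, zero_smul, zero_smul, add_zero]
  obtain ⟨t, ht⟩ := Submodule.mem_span_singleton.1 (hφ₀ ▸ Submodule.mem_top (x := φ))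
  refine ⟨ε t, ?_⟩
  have h1 : t • φ₀ 1 = Ideal.Quotient.mk _ (1 * q) := LinearMap.congr_fun ht 1
  rw [Algebra.smul_def, one_mul] at h1
  have h2 := congrArg (quotγ h.mul_β) h1
  rw [h.symm.isTrivialExt_left.mul, h0, quotγ_mk, q3, zero_smul, add_zero] at h2
  exact h2

/-- `(B ⊕ D) ⊗_Q (C ⊕ D) ≅ D`. -/
theorem nonempty_tensor_ideals_equiv [IsNoetherianRing R] (h : IsPairingExt p ε γ β δ)
    (hp : DualPair p) {N : Type u} [AddCommGroup N] [Module Q N] (eN : N ≃+ D)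
    (hN : ∀ (q : Q) (n : N), eN (q • n) = ε q • eN n) :
    Nonempty (derivationKer ε γ h.mul_γ ⊗[Q] derivationKer ε β h.mul_β ≃ₗ[Q] N) := by
  obtain ⟨F, ⟨e⟩, -, -, hF⟩ := h.exists_syzygyFamily hp
  have hs : ∀ I : Ideal Q, IsSES (Submodule.subtype I) (Submodule.mkQ I) := fun I =>
    ⟨Subtype.val_injective, LinearMap.exact_subtype_mkQ I, Submodule.mkQ_surjective I⟩
  have h1 : TorOneZero Q (F.Z 0) (derivationKer ε β h.mul_β) := by
    have := F.free 0
    refine (F.ses 0).torOneZero ?_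
    have h2 := (hF (0 + 1)).symm _ _ _ _ (hs _)
    have h3 := Module.Flat.lTensor_preserves_injective_linearMap (M := Q) (F.ι 0) (F.ses 0).inj
    have h4 := h3.comp h2
    rw [← LinearMap.coe_comp, LinearMap.lTensor_comp_rTensor, ← LinearMap.rTensor_comp_lTensor,
      LinearMap.coe_comp] at h4
    exact (LinearMap.lTensor_inj_iff_rTensor_inj _ _).1 (Function.Injective.of_comp h4)
  have h2 := (h1.of_equiv e) _ _ _ _ (hs (derivationKer ε γ h.mul_γ))
  let μ : derivationKer ε γ h.mul_γ ⊗[Q] derivationKer ε β h.mul_β →ₗ[Q] Q :=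
    Submodule.subtype _ ∘ₗ (TensorProduct.lid Q _).toLinearMap ∘ₗ
      (Submodule.subtype (derivationKer ε γ h.mul_γ)).rTensor (derivationKer ε β h.mul_β)
  have hμ : Function.Injective μ :=
    Subtype.val_injective.comp ((TensorProduct.lid Q (derivationKer ε β h.mul_β)).injective.comp h2)
  have hμ' : ∀ x y, μ (x ⊗ₜ y) = x * y := fun x y => rfl
  have hr : LinearMap.range μ = derivationKer ε γ h.mul_γ ⊓ derivationKer ε β h.mul_β := by
    refine le_antisymm ?_ ?_
    · rintro _ ⟨t, rfl⟩
      induction t with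
      | zero => rw [map_zero]; exact Submodule.zero_mem _
      | add x y hx hy => rw [map_add]; exact Submodule.add_mem _ hx hy
      | tmul x y =>
        rw [hμ']
        exact ⟨Ideal.mul_mem_right _ _ x.2, Ideal.mul_mem_left _ _ y.2⟩
    · rw [h.inf_eq_mul hp.surjective, Ideal.mul_le]
      exact fun x hx y hy => ⟨(⟨x, hx⟩ : derivationKer ε γ h.mul_γ) ⊗ₜ
        (⟨y, hy⟩ : derivationKer ε β h.mul_β), rfl⟩
  let ν : LinearMap.range μ →ₗ[Q] N :=
    { toFun := fun x => eN.symm (δ x)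
      map_add' := fun x y => by
        rw [Submodule.coe_add, map_add, map_add]
      map_smul' := fun q x => by
        have hx : (x : Q) ∈ derivationKer ε γ h.mul_γ ⊓ derivationKer ε β h.mul_β := hr ▸ x.2
        rw [RingHom.id_apply, AddEquiv.symm_apply_eq, hN, AddEquiv.apply_symm_apply,
          Submodule.coe_smul, smul_eq_mul, h.mul_δ, hx.1.1, hx.1.2, hx.2.2]
        simp }
  refine ⟨(LinearEquiv.ofInjective μ hμ).trans (LinearEquiv.ofBijective ν ⟨?_, fun n => ?_⟩)⟩
  · intro x y hxy
    have hx : (x : Q) ∈ derivationKer ε γ h.mul_γ ⊓ derivationKer ε β h.mul_β := hr ▸ x.2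
    have hy : (y : Q) ∈ derivationKer ε γ h.mul_γ ⊓ derivationKer ε β h.mul_β := hr ▸ y.2
    exact Subtype.ext (h.ext (hx.1.1.trans hy.1.1.symm) (hx.1.2.trans hy.1.2.symm)
      (hx.2.2.trans hy.2.2.symm) (eN.symm.injective hxy))
  · obtain ⟨q, q1, q2, q3, q4⟩ := h.exists_eq 0 0 0 (eN n)
    refine ⟨⟨q, ?_⟩, ?_⟩
    · rw [hr]; exact ⟨⟨q1, q2⟩, ⟨q1, q3⟩⟩
    · change eN.symm (δ q) = n
      rw [q4, AddEquiv.symm_apply_apply]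

end IsPairingExt

/-! ### The coordinates of the iterated trivial extension -/

namespace IterTrivExt

variable (R C D : Type u) [CommRing R] [AddCommGroup C] [Module R C] [AddCommGroup D] [Module R D]

/-- The structure of an `R`-algebra on `(R ⋉ C) ⋉ Hom_R(R ⋉ C, D)`. -/
@[reducible]
def algebra : Algebra R (IterTrivExt R C D) :=
  ((algebraMap (TrivExt R C) (IterTrivExt R C D)).comp (algebraMap R (TrivExt R C))).toAlgebra

attribute [local instance] algebra

/-- The first component of an element of the iterated trivial extension. -/
def base (q : IterTrivExt R C D) : TrivExt R C := TrivSqZeroExt.fst q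

/-- The second component of an element of the iterated trivial extension. -/
def form (q : IterTrivExt R C D) : CoindHom R (TrivExt R C) D := TrivSqZeroExt.snd q

variable {R C D}

theorem base_mul (x y : IterTrivExt R C D) :
    base R C D (x * y) = base R C D x * base R C D y := rfl

theorem form_mul (x y : IterTrivExt R C D) :
    form R C D (x * y) = base R C D x • form R C D y + base R C D y • form R C D x := rfl

theorem form_add (x y : IterTrivExt R C D) :
    form R C D (x + y) = form R C D x + form R C D y := rfl

theorem base_smul (r : R) (x : IterTrivExt R C D) :
    base R C D (r • x) = r • base R C D x := by
  rw [Algebra.smul_def, base_mul, Algebra.smul_def]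
  rfl

theorem form_smul (r : R) (x : IterTrivExt R C D) :
    form R C D (r • x) = r • form R C D x := by
  rw [Algebra.smul_def, form_mul]
  have h1 : form R C D (algebraMap R (IterTrivExt R C D) r) = 0 := rfl
  have h2 : base R C D (algebraMap R (IterTrivExt R C D) r) = algebraMap R (TrivExt R C) r := rfl
  rw [h1, h2, smul_zero, add_zero, algebraMap_smul]

variable (R C D)

/-- The projection to `R`. -/
def projRing : IterTrivExt R C D →ₐ[R] R where
  toFun q := TrivExt.fstHom R C (base R C D q)
  map_one' := rfl
  map_mul' _ _ := rfl
  map_zero' := rfl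
  map_add' _ _ := rfl
  commutes' _ := rfl

/-- The projection to `C`. -/
def projLeft : IterTrivExt R C D →ₗ[R] C where
  toFun q := TrivExt.sndHom R C (base R C D q)
  map_add' _ _ := rfl
  map_smul' r q := by rw [base_smul, map_smul, RingHom.id_apply]

/-- The inclusion of `C` into `R ⋉ C`. -/
def inclusion : C →ₗ[R] TrivExt R C where
  toFun c := TrivExt.mk 0 c
  map_add' c c' := by rw [TrivExt.mk_add_mk, add_zero]
  map_smul' r c := by
    rw [RingHom.id_apply, Algebra.smul_def, TrivExt.algebraMap_eq_mk, TrivExt.mk_mul_mk, mul_zero,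
      smul_zero, add_zero]

/-- The projection to `Hom_R(C, D)`. -/
def projDual : IterTrivExt R C D →ₗ[R] (C →ₗ[R] D) where
  toFun q := CoindHom.toHom (form R C D q) ∘ₗ inclusion R C
  map_add' x y := by rw [form_add, map_add, LinearMap.add_comp]
  map_smul' r q := by rw [form_smul, map_smul, LinearMap.smul_comp, RingHom.id_apply]

/-- The projection to `D`. -/
def projForm : IterTrivExt R C D →ₗ[R] D where
  toFun q := CoindHom.toHom (form R C D q) 1
  map_add' x y := by rw [form_add, map_add, LinearMap.add_apply]
  map_smul' r q := by rw [form_smul, map_smul, LinearMap.smul_apply, RingHom.id_apply]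

variable {R C D}

theorem eq_smul_one_add (a : TrivExt R C) :
    a = TrivExt.fstHom R C a • 1 + inclusion R C (TrivExt.sndHom R C a) :=
  (TrivExt.isTrivialExt R C).ext
    (by simp only [map_add, map_smul, map_one, smul_eq_mul, mul_one]; exact (add_zero _).symm)
    (by rw [map_add, map_smul, (TrivExt.isTrivialExt R C).map_one, smul_zero, zero_add]; rfl)

theorem toHom_apply (q : IterTrivExt R C D) (a : TrivExt R C) :
    CoindHom.toHom (form R C D q) a = TrivExt.fstHom R C a • projForm R C D q +
      projDual R C D q (TrivExt.sndHom R C a) := by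
  conv_lhs => rw [eq_smul_one_add a, map_add, map_smul]
  rfl

theorem mul_inclusion (a : TrivExt R C) (c : C) :
    a * inclusion R C c = inclusion R C (TrivExt.fstHom R C a • c) :=
  (TrivExt.isTrivialExt R C).ext (mul_zero _) (by
    rw [(TrivExt.isTrivialExt R C).mul]
    change _ + (0 : R) • _ = _
    rw [zero_smul, add_zero]
    rfl)

theorem isPairingExt : IsPairingExt (LinearMap.applyₗ : C →ₗ[R] (C →ₗ[R] D) →ₗ[R] D)
    (projRing R C D) (projLeft R C D) (projDual R C D) (projForm R C D) where
  bijective := by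
    constructor
    · intro x y hxy
      have h1 : projRing R C D x = projRing R C D y :=
        congrArg (fun t : R × C × (C →ₗ[R] D) × D => t.1) hxy
      have h2 : projLeft R C D x = projLeft R C D y := congrArg (fun t => t.2.1) hxy
      have h3 : projDual R C D x = projDual R C D y := congrArg (fun t => t.2.2.1) hxy
      have h4 : projForm R C D x = projForm R C D y := congrArg (fun t => t.2.2.2) hxy
      refine TrivSqZeroExt.ext ((TrivExt.isTrivialExt R C).ext h1 h2) ?_
      refine CoindHom.hom_ext fun a => ?_
      exact (toHom_apply x a).trans ((by rw [h3, h4]) : _ = _) |>.trans (toHom_apply y a).symm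
    · rintro ⟨r, c, b, d⟩
      let q : IterTrivExt R C D := TrivExt.mk (TrivExt.mk r c) (CoindHom.toHom.symm
        ((TrivExt.fstHom R C).toLinearMap.smulRight d + b ∘ₗ TrivExt.sndHom R C))
      have h3 : projDual R C D q = b := LinearMap.ext fun x => by
        change (0 : R) • d + b x = b x
        rw [zero_smul, zero_add]
      have h4 : projForm R C D q = d := by
        change (1 : R) • d + b 0 = d
        rw [one_smul, map_zero, add_zero]
      exact ⟨q, Prod.ext rfl (Prod.ext rfl (Prod.ext h3 h4))⟩
  mul_γ _ _ := rfl
  mul_β x y := LinearMap.ext fun c => by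
    change CoindHom.toHom (form R C D y) (base R C D x * inclusion R C c) +
      CoindHom.toHom (form R C D x) (base R C D y * inclusion R C c) = _
    rw [mul_inclusion, mul_inclusion, map_smul, map_smul, map_smul, map_smul]
    rfl
  mul_δ x y := by
    change CoindHom.toHom (form R C D y) (base R C D x * 1) +
      CoindHom.toHom (form R C D x) (base R C D y * 1) = _
    rw [mul_one, mul_one, toHom_apply, toHom_apply]
    change (projRing R C D x • projForm R C D y + projDual R C D y (projLeft R C D x)) +
      (projRing R C D y • projForm R C D x + projDual R C D x (projLeft R C D y)) =
      projRing R C D x • projForm R C D y + projRing R C D y • projForm R C D x +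
        projDual R C D y (projLeft R C D x) + projDual R C D x (projLeft R C D y)
    abel

end IterTrivExt

theorem TorVanishing.of_iso {S : Type u} [CommRing S] {M M' N N' : ModuleCat.{u} S}
    (h : TorVanishing M N) (e : M' ≅ M) (e' : N' ≅ N) : TorVanishing M' N' := fun i hi =>
  (h i hi).of_iso ((((Tor (ModuleCat.{u} S) i).mapIso e).app N') ≪≫
    ((Tor (ModuleCat.{u} S) i).obj M).mapIso e')

namespace IsPairingExt

variable {R Q C B D : Type u} [CommRing R] [CommRing Q] [Algebra R Q] [AddCommGroup C]
  [AddCommGroup B] [AddCommGroup D] [Module R C] [Module R B] [Module R D]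
  {p : C →ₗ[R] B →ₗ[R] D} {ε : Q →ₐ[R] R} {γ : Q →ₗ[R] C} {β : Q →ₗ[R] B} {δ : Q →ₗ[R] D}

theorem sup_eq_ker (h : IsPairingExt p ε γ β δ) :
    derivationKer ε γ h.mul_γ ⊔ derivationKer ε β h.mul_β = RingHom.ker (ε : Q →+* R) :=
  Ideal.ext fun _ => h.mem_sup

/-- `Q/(I₁ + I₂) ≅ R`. -/
def quotSupEquiv (h : IsPairingExt p ε γ β δ) :
    Q ⧸ (derivationKer ε γ h.mul_γ ⊔ derivationKer ε β h.mul_β) ≃+* R :=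
  (Ideal.quotEquivOfEq h.sup_eq_ker).trans
    (RingHom.quotientKerEquivOfSurjective (f := (ε : Q →+* R)) h.surjective)

/-- The dualizing module `Hom_R(Q/(B ⊕ D), D)` is isomorphic to `B ⊕ D`. -/
theorem nonempty_iso_dual (h : IsPairingExt p ε γ β δ) (hp : Function.Bijective p.flip) :
    Nonempty ((ModuleCat.restrictScalars (Ideal.Quotient.mk (derivationKer ε γ h.mul_γ))).obj
      (ModuleCat.of _ (CoindHom R (Q ⧸ derivationKer ε γ h.mul_γ) D)) ≅
        ModuleCat.of Q (derivationKer ε γ h.mul_γ)) := by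
  obtain ⟨θ, hθ⟩ := h.symm.exists_dual_equiv hp h.isTrivialExt_left
  let e : derivationKer ε γ h.mul_γ ≃ₗ[Q]
      (ModuleCat.restrictScalars (Ideal.Quotient.mk (derivationKer ε γ h.mul_γ))).obj
        (ModuleCat.of _ (CoindHom R (Q ⧸ derivationKer ε γ h.mul_γ) D)) :=
    { θ with map_smul' := fun q i => hθ q (Ideal.Quotient.mk _ q) i rfl rfl }
  exact ⟨e.symm.toModuleIso⟩

theorem quotient_properties (h : IsPairingExt p ε γ β δ) (hp : DualPair p)
    (hR : IsCohenMacaulayLocal R) (hC : ¬ IsDualizing R C) :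
    IsCohenMacaulayLocal (Q ⧸ derivationKer ε γ h.mul_γ) ∧
      IsDualizing (Q ⧸ derivationKer ε γ h.mul_γ)
        (CoindHom R (Q ⧸ derivationKer ε γ h.mul_γ) D) ∧
      ¬ IsGorensteinLocal (Q ⧸ derivationKer ε γ h.mul_γ) := by
  have := hR.isNoetherianRing
  have := hp.left.finite
  have := h.isTrivialExt_left.finite
  exact ⟨h.isTrivialExt_left.isCohenMacaulayLocal hR hp.left,
    hp.dualizing.coindHom (h.isTrivialExt_left.extAcyclic hp.ext_left),
    h.isTrivialExt_left.not_isGorensteinLocal hp.left hC⟩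

theorem gdim_lt_top [IsNoetherianRing R] (h : IsPairingExt p ε γ β δ) (hp : DualPair p)
    {ρ : Q ⧸ derivationKer ε γ h.mul_γ →+* R} (hρ : ∀ q, ρ (Ideal.Quotient.mk _ q) = ε q) :
    gdim ((ModuleCat.restrictScalars ρ).obj (ModuleCat.of R R)) < ⊤ := by
  have := hp.left.finite
  have := h.isTrivialExt_left.isNoetherianRing
  have : ρ = (quotε h.mul_γ : Q ⧸ derivationKer ε γ h.mul_γ →+* R) :=
    Ideal.Quotient.ringHom_ext (RingHom.ext hρ)
  rw [this]
  exact (h.isTrivialExt_left.isReflexiveModule hp.left).isTotallyReflexive.gdim_lt_top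

/-- The vanishing of Tate (co)homology, `Ext` and `Tor` for `R₁ = Q/(B ⊕ D)` and
`R₂ = Q/(C ⊕ D)`. -/
theorem vanishing [IsNoetherianRing R] (h : IsPairingExt p ε γ β δ) (hp : DualPair p) :
    TateVanishing (ModuleCat.of Q (Q ⧸ derivationKer ε γ h.mul_γ))
      (ModuleCat.of Q (Q ⧸ derivationKer ε β h.mul_β)) ∧
    ExtVanishing (ModuleCat.of Q (Q ⧸ derivationKer ε γ h.mul_γ))
      (ModuleCat.of Q (Q ⧸ derivationKer ε β h.mul_β)) ∧
    TorVanishing (ModuleCat.of Q (Q ⧸ derivationKer ε β h.mul_β))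
      (ModuleCat.of Q (Q ⧸ derivationKer ε γ h.mul_γ)) := by
  obtain ⟨F, ⟨e⟩, h1, h2, h3⟩ := h.exists_syzygyFamily hp
  exact ⟨F.tateVanishing (N := ModuleCat.of Q (Q ⧸ derivationKer ε β h.mul_β)) h1 e h2 h3,
    F.extVanishing (N := ModuleCat.of Q (Q ⧸ derivationKer ε β h.mul_β)) e h2,
    F.torVanishing (M := ModuleCat.of Q (Q ⧸ derivationKer ε β h.mul_β)) e fun i =>
      (LinearMap.lTensor_inj_iff_rTensor_inj _ _).2 (h3 i _ _ _ _ (F.ses i))⟩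

/-- `Tor_i(C ⊕ D, B ⊕ D) = 0` for `i ≥ 1`. -/
theorem torVanishing_ideals [IsNoetherianRing R] (h : IsPairingExt p ε γ β δ) (hp : DualPair p) :
    TorVanishing (ModuleCat.of Q (derivationKer ε β h.mul_β))
      (ModuleCat.of Q (derivationKer ε γ h.mul_γ)) := by
  have := hp.left.finite
  have := hp.right.finite
  have := hp.dualizing.finite
  have := h.finite
  have := IsNoetherianRing.of_finite R Q
  obtain ⟨F, ⟨e⟩, h1, h2, h3⟩ := h.exists_syzygyFamily hp
  exact F.torVanishing_ideals e h3

end IsPairingExt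

theorem IsDualizing.of_equiv {R C D : Type u} [CommRing R] [AddCommGroup C] [Module R C]
    [AddCommGroup D] [Module R D] (hD : IsDualizing R D) (hC : IsSemidualizing R C)
    (e : C ≃ₗ[R] D) : IsDualizing R C :=
  ⟨hC, by
    rw [injectiveDimension_eq_of_iso e.toModuleIso]
    exact hD.injectiveDimension_ne_top⟩

end

theorem theorem3p2 (R : Type u) [CommRing R] (hR : IsCohenMacaulayLocal R)
    (D : Type u) [AddCommGroup D] [Module R D] (hD : IsDualizing R D)
    (C : Type u) [AddCommGroup C] [Module R C] (hC : IsSemidualizing R C)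
    (hC_not_dualizing : ¬ IsDualizing R C) (hC_not_free : ¬ Module.Free R C) :
    let Q := IterTrivExt R C D
    IsGorensteinLocal Q ∧
    ∃ (I₁ I₂ : Ideal Q)
      -- (1) the isomorphism `Q/(I₁ + I₂) ≅ R`
      (σ : Q ⧸ (I₁ ⊔ I₂) ≃+* R)
      (D₁ : ModuleCat.{u} (Q ⧸ I₁)) (D₂ : ModuleCat.{u} (Q ⧸ I₂)),
      let R₁ : ModuleCat.{u} Q := ModuleCat.of Q (Q ⧸ I₁)
      let R₂ : ModuleCat.{u} Q := ModuleCat.of Q (Q ⧸ I₂)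
      -- `D₁` and `D₂` as `Q`-modules
      let D₁' : ModuleCat.{u} Q := (ModuleCat.restrictScalars (Ideal.Quotient.mk I₁)).obj D₁
      let D₂' : ModuleCat.{u} Q := (ModuleCat.restrictScalars (Ideal.Quotient.mk I₂)).obj D₂
      -- the surjections of `Q`, `Q/I₁` and `Q/I₂` onto `R` that `σ` induces
      let ρ : Q →+* R := (σ : Q ⧸ (I₁ ⊔ I₂) →+* R).comp (Ideal.Quotient.mk (I₁ ⊔ I₂))
      let ρ₁ : Q ⧸ I₁ →+* R := (σ : Q ⧸ (I₁ ⊔ I₂) →+* R).comp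
        (Ideal.Quotient.factor (le_sup_left : I₁ ≤ I₁ ⊔ I₂))
      let ρ₂ : Q ⧸ I₂ →+* R := (σ : Q ⧸ (I₁ ⊔ I₂) →+* R).comp
        (Ideal.Quotient.factor (le_sup_right : I₂ ≤ I₁ ⊔ I₂))
      -- (2)
      (IsCohenMacaulayLocal (Q ⧸ I₁) ∧ IsDualizing (Q ⧸ I₁) D₁ ∧ ¬ IsGorensteinLocal (Q ⧸ I₁)) ∧
      (IsCohenMacaulayLocal (Q ⧸ I₂) ∧ IsDualizing (Q ⧸ I₂) D₂ ∧ ¬ IsGorensteinLocal (Q ⧸ I₂)) ∧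
      -- (3)
      TateVanishing R₁ R₂ ∧ TateVanishing R₂ R₁ ∧
      -- (4)
      ¬ (⊤ : Submodule Q ((Q ⧸ I₁) →ₗ[Q] (Q ⧸ I₂))).IsPrincipal ∧
      ¬ (⊤ : Submodule Q ((Q ⧸ I₂) →ₗ[Q] (Q ⧸ I₁))).IsPrincipal ∧
      -- (5)
      ExtVanishing R₁ R₂ ∧ ExtVanishing R₂ R₁ ∧ TorVanishing R₁ R₂ ∧ TorVanishing R₂ R₁ ∧
      I₁ ⊓ I₂ = I₁ * I₂ ∧
      -- (6)
      gdim ((ModuleCat.restrictScalars ρ₁).obj (ModuleCat.of R R)) < ⊤ ∧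
      gdim ((ModuleCat.restrictScalars ρ₂).obj (ModuleCat.of R R)) < ⊤ ∧
      -- (7) since `ρ` is surjective, an `R`-isomorphism is the same as a `Q`-isomorphism
      Nonempty (D₁' ⊗ D₂' ≅ (ModuleCat.restrictScalars ρ).obj (ModuleCat.of R D)) ∧
      TorVanishing D₁' D₂' := by
  intro Q
  have := hR.isNoetherianRing
  have := hR.isLocalRing
  let _ : Algebra R Q := IterTrivExt.algebra R C D
  have h : IsPairingExt _ _ _ _ _ := IterTrivExt.isPairingExt (R := R) (C := C) (D := D)
  have hp := hC.dualPair hD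
  obtain ⟨h₁, h₂, h₃⟩ := h.vanishing hp
  obtain ⟨h₁', h₂', h₃'⟩ := h.symm.vanishing hp.symm
  obtain ⟨e₁⟩ := h.nonempty_iso_dual hp.bijective_flip
  obtain ⟨e₂⟩ := h.symm.nonempty_iso_dual hp.bijective
  refine ⟨h.isGorensteinLocal hp hR.isNoetherianRing hR.isLocalRing, derivationKer _ _ h.mul_γ,
    derivationKer _ _ h.mul_β, h.quotSupEquiv,
    ModuleCat.of _ (CoindHom R (Q ⧸ derivationKer _ _ h.mul_γ) D),
    ModuleCat.of _ (CoindHom R (Q ⧸ derivationKer _ _ h.mul_β) D), ?_⟩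
  refine ⟨h.quotient_properties hp hR hC_not_dualizing, h.symm.quotient_properties hp.symm hR
    fun hB => hC_not_free (hC.free_of_isDualizing hD hB), h₁, h₁', fun hc => ?_, fun hc => ?_,
    h₂, h₂', h₃', h₃, h.inf_eq_mul hp.surjective, h.gdim_lt_top hp fun _ => rfl,
    h.symm.gdim_lt_top hp.symm fun _ => rfl, ?_,
    (h.symm.torVanishing_ideals hp.symm).of_iso e₁ e₂⟩
  · obtain ⟨b, hb⟩ := h.exists_generator hp.right hc
    obtain ⟨e⟩ := hp.right.nonempty_equiv_of_cyclic b hb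
    exact hC_not_dualizing (hD.of_equiv hC ((LinearEquiv.ofBijective _ hp.bijective).trans
      ((e.congrLeft D R).symm.trans (LinearMap.ringLmapEquivSelf R R D))))
  · obtain ⟨c, hc⟩ := h.symm.exists_generator hp.left hc
    obtain ⟨e⟩ := hp.left.nonempty_equiv_of_cyclic c hc
    exact hC_not_free (Module.Free.of_equiv e)
  · obtain ⟨e⟩ := h.nonempty_tensor_ideals_equiv hp
      (N := (ModuleCat.restrictScalars (IterTrivExt.projRing R C D : Q →+* R)).obj
        (ModuleCat.of R D)) (AddEquiv.refl D) fun _ _ => rfl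
    exact ⟨(e₁ ⊗ᵢ e₂) ≪≫ e.toModuleIso⟩
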